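/- Let $L>0$ and let $\mathbb T=[-L,L]$ be the one-dimensional torus (end points identified), with the Sobolev norms $\|f\|_{H^s}^2=2L\sum_{l\in\mathbb Z}\bigl(1+(\pi l/L)^2\bigr)^s|\hat f_l|^2$, $\hat f_l=\frac1{2L}\int_{-L}^{L} f(x)e^{-i\pi l x/L}\,dx$. There is a constant $C_0>0$, depending only on $L$, with the following property. Let $s\ge 1$, $\alpha\in\mathbb R$, $\lambda_1>\lambda_2>\cdots>0$, $\psi_{in}\in H^s(\mathbb T;\mathbb C)$, and let $v_0,v_1,v_2,\ldots\in L^2(\mathbb T;\mathbb R)$ be such that, for every $\boldsymbol\xi\in U:=[-\tfrac12,\tfrac12]^{\mathbb N}$, the series $$V(\boldsymbol\xi)=v_0+\sum_{j=1}^\infty\sqrt{\lambda_j}\,\xi_j v_j$$ converges (unconditionally) in $L^2(\mathbb T)$, with $\|V\|_{L^\infty(U;H^s)}:=\sup_{\boldsymbol\xi\in U}\|V(\boldsymbol\xi)\|_{H^s}<\infty$. For $m\in\mathbb N$ and $\xi\in U_m:=[-\tfrac12,\tfrac12]^m$ put $V_m(\xi)=v_0+\sum_{j=1}^m\sqrt{\lambda_j}\,\xi_j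 v_j$. For every $\boldsymbol\xi\in U$ the problem $$i\partial_t\psi=-\tfrac12\partial_x^2\psi+V(\boldsymbol\xi)\psi+\alpha|\psi|^2\psi\quad(t>0),\qquad \psi(0,\boldsymbol\xi,\cdot)=\psi_{in},$$ understood in the sense of distributions in $x$, has a unique solution $\psi(\cdot,\boldsymbol\xi)\in C([0,\infty);H^1(\mathbb T))$, and $\|\psi\|_{L^\infty((0,T)\times U;H^s)}:=\sup_{t\in(0,T),\,\boldsymbol\xi\in U}\|\psi(t,\boldsymbol\xi,\cdot)\|_{H^s}<\infty$ for every $T>0$. Let $\psi_m(\cdot,\xi)\in C([0,\infty);H^1(\mathbb T))$ be the solution of the same problem with $V_m(\xi)$ in place of $V(\boldsymbol\xi)$, for $\xi\in U_m$. For $\nu\in\Gamma:=\{0,1\}^m$ write $|\nu|=\sum_{j=1}^m\nu_j$ and $\partial^\nu=\partial_{\xi_1}^{\nu_1}\cdots\partial_{\xi_m}^{\nu_m}$, the derivatives being those of the $H^1(\mathbb T)$-valued map $\xi\mapsto\psi_m(t,\xi,\cdot)$ on $U_m$ (one-sided on the boundary). Then, for every $T>0$ and every $m$, the derivatives $\partial^\nu\psi_m(t,\xi,\cdot)$,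 $\nu\in\Gamma$, exist in $H^1(\mathbb T)$ and do not depend on the order of differentiation, and for every $0\ne\nu\in\Gamma$ $$\|\partial^{\nu}\psi_m(t,\xi,\cdot)\|_{H^1}\le 3^{(|\nu|+2)(|\nu|-1)/2}\,C_T^{2|\nu|-1}\prod_{j=1}^m\bigl(\sqrt{\lambda_j}\,\|v_j\|_{H^1}\bigr)^{\nu_j}\qquad\text{for all }\xi\in U_m,\ t\in[0,T],$$ where $C_T=\max\{C_T^0,1\}$ and $$C_T^0=2\max\{1,|\alpha|\}\,C_0\,T\max\bigl\{1,\|\psi\|_{L^\infty((0,T)\times U;H^s)}\bigr\}\exp\Bigl(T\max\bigl\{1,\;C_0\bigl[\|V\|_{L^\infty(U;H^s)}+3|\alpha|\,\|\psi\|^2_{L^\infty((0,T)\times U;H^s)}\bigr]\bigr\}\Bigr).$$ In particular $C_T$ does not depend on $\nu$ or $m$. -/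

import Mathlib

open MeasureTheory Set
open scoped ENNReal

noncomputable section

namespace QmcNLS

/-- The space `L²(𝕋)` of complex-valued functions on the torus `𝕋 = ℝ / 2Lℤ`, i.e. `[-L, L]` with
its end points identified. -/
abbrev L2 (L : ℝ) [Fact (0 < 2 * L)] : Type :=
  Lp ℂ 2 (AddCircle.haarAddCircle (T := 2 * L))

/-- The frequency `π l / L` of the `l`-th Fourier mode `x ↦ exp (i π l x / L)`. -/
def freq (L : ℝ) (l : ℤ) : ℝ := Real.pi * l / L

/-- The `l`-th Fourier coefficient `(1 / 2L) ∫ f(x) exp (-i π l x / L) dx` of `f`. -/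
def fc {L : ℝ} [Fact (0 < 2 * L)] (f : AddCircle (2 * L) → ℂ) (l : ℤ) : ℂ :=
  fourierCoeff f l

/-- The norm `‖f‖_{H^s} = (2L ∑_l (1 + (π l / L)²)^s |f̂_l|²)^{1/2}`, with value `∞` when
`f ∉ H^s(𝕋)`. For `s = 0` this is the norm of `L²(-L, L)`, and for `s = 1` its square is
`∫ |f|² + |f'|²` over `(-L, L)`. -/
def hsNorm {L : ℝ} [Fact (0 < 2 * L)] (s : ℝ) (f : L2 L) : ℝ≥0∞ :=
  (ENNReal.ofReal (2 * L) *
    ∑' l : ℤ, ENNReal.ofReal ((1 + freq L l ^ 2) ^ s) * ‖fc f l‖ₑ ^ 2) ^ (1 / 2 : ℝ)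

section Helpers

variable {L : ℝ} [hL : Fact (0 < 2 * L)]

/-- The weighted Fourier coefficients. -/
def wfc (s : ℝ) (f : L2 L) (l : ℤ) : ℂ :=
  ((Real.sqrt (2 * L) * (1 + freq L l ^ 2) ^ (s / 2) : ℝ) : ℂ) * fc f l

theorem hsNorm_eq (s : ℝ) (f : L2 L) :
    hsNorm s f = eLpNorm (wfc s f) 2 (Measure.count : Measure ℤ) := by
  have h2 : (0 : ℝ) ≤ 2 * L := hL.out.le
  rw [eLpNorm_eq_lintegral_rpow_enorm_toReal (by norm_num) (by norm_num), hsNorm]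
  simp only [ENNReal.toReal_ofNat, lintegral_count]
  congr 1
  rw [← ENNReal.tsum_mul_left]
  refine tsum_congr fun l => ?_
  have hb : (0 : ℝ) ≤ 1 + freq L l ^ 2 := by positivity
  rw [wfc, enorm_mul, ENNReal.mul_rpow_of_nonneg _ _ (by norm_num), ← mul_assoc]
  congr 1
  · rw [← ENNReal.ofReal_mul h2, ← ofReal_norm, Complex.norm_real, Real.norm_of_nonneg
      (by positivity), ENNReal.ofReal_rpow_of_nonneg (by positivity) (by norm_num)]
    congr 1
    rw [Real.mul_rpow (by positivity) (by positivity), ← Real.rpow_mul hb]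
    have e1 : Real.sqrt (2 * L) ^ (2 : ℝ) = 2 * L := by
      rw [Real.rpow_two, Real.sq_sqrt h2]
    rw [e1, div_mul_cancel₀ s (by norm_num)]
  · norm_num

theorem fc_add (f g : L2 L) (l : ℤ) : fc ⇑(f + g) l = fc f l + fc g l := by
  simp only [fc, ← fourierBasis_repr, map_add, lp.coeFn_add, Pi.add_apply]

theorem fc_smul (c : ℂ) (f : L2 L) (l : ℤ) : fc ⇑(c • f) l = c * fc f l := by
  simp only [fc, ← fourierBasis_repr, map_smul, lp.coeFn_smul, Pi.smul_apply, smul_eq_mul]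

theorem wfc_add (s : ℝ) (f g : L2 L) : wfc s (f + g) = wfc s f + wfc s g := by
  funext l
  simp only [wfc, fc_add, Pi.add_apply]
  ring

theorem wfc_smul (s : ℝ) (c : ℂ) (f : L2 L) : wfc s (c • f) = c • wfc s f := by
  funext l
  simp only [wfc, fc_smul, Pi.smul_apply, smul_eq_mul]
  ring

theorem hsNorm_add_le (s : ℝ) (f g : L2 L) : hsNorm s (f + g) ≤ hsNorm s f + hsNorm s g := by
  simp only [hsNorm_eq, wfc_add]
  exact eLpNorm_add_le (Measurable.of_discrete).aestronglyMeasurable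
    (Measurable.of_discrete).aestronglyMeasurable (by norm_num)

theorem hsNorm_smul (s : ℝ) (c : ℂ) (f : L2 L) : hsNorm s (c • f) = ‖c‖ₑ * hsNorm s f := by
  simp only [hsNorm_eq, wfc_smul, eLpNorm_const_smul]

theorem hsNorm_zero (s : ℝ) : hsNorm s (0 : L2 L) = 0 := by
  simpa using hsNorm_smul s 0 (0 : L2 L)

theorem eq_zero_of_hsNorm (s : ℝ) (f : L2 L) (h : hsNorm s f = 0) : f = 0 := by
  have h2 : (0 : ℝ) < 2 * L := hL.out
  have hw : ∀ l, fc f l = 0 := by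
    intro l
    rw [hsNorm, ENNReal.rpow_eq_zero_iff_of_pos (by norm_num), mul_eq_zero, ENNReal.tsum_eq_zero]
      at h
    rcases h with h | h
    · exact absurd h (by simp only [ENNReal.ofReal_eq_zero, not_le]; exact h2)
    · have := h l
      rw [mul_eq_zero] at this
      rcases this with h' | h'
      · have : (0 : ℝ) < (1 + freq L l ^ 2) ^ s := Real.rpow_pos_of_pos (by positivity) _
        rw [ENNReal.ofReal_eq_zero] at h'
        linarith
      · simpa using h'
  apply (fourierBasis (T := 2 * L)).repr.injective
  ext l
  simp only [fourierBasis_repr, map_zero, lp.coeFn_zero, Pi.zero_apply]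
  exact hw l

end Helpers

/-- `H¹(𝕋)` as a subspace of `L²(𝕋)`. -/
def h1Submodule (L : ℝ) [Fact (0 < 2 * L)] : Submodule ℂ (L2 L) where
  carrier := {f | hsNorm 1 f < ∞}
  add_mem' hf hg := (hsNorm_add_le 1 _ _).trans_lt (ENNReal.add_lt_top.2 ⟨hf, hg⟩)
  zero_mem' := by simp [hsNorm_zero]
  smul_mem' c f hf := by
    change hsNorm 1 (c • f) < ∞
    rw [hsNorm_smul]
    exact ENNReal.mul_lt_top (by simp) hf

/-- The Sobolev space `H¹(𝕋)`, with the norm `‖·‖_{H¹}` (and not that of `L²(𝕋)`). -/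
def H1 (L : ℝ) [Fact (0 < 2 * L)] : Type := h1Submodule L

section H1

variable {L : ℝ} [Fact (0 < 2 * L)]

instance : AddCommGroup (H1 L) := inferInstanceAs (AddCommGroup (h1Submodule L))

instance : Module ℂ (H1 L) := inferInstanceAs (Module ℂ (h1Submodule L))

/-- The element of `L²(𝕋)` underlying an element of `H¹(𝕋)`. -/
def H1.toL2 : H1 L →ₗ[ℂ] L2 L := (h1Submodule L).subtype

instance : Norm (H1 L) := ⟨fun f => (hsNorm 1 f.toL2).toReal⟩

theorem H1.norm_def (f : H1 L) : ‖f‖ = (hsNorm 1 f.toL2).toReal := rfl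

theorem H1.normedSpaceCore : NormedSpace.Core ℂ (H1 L) where
  norm_nonneg f := ENNReal.toReal_nonneg
  norm_smul c f := by
    simp only [H1.norm_def, map_smul, hsNorm_smul, ENNReal.toReal_mul, toReal_enorm]
  norm_triangle f g := by
    have hf : hsNorm 1 f.toL2 < ∞ := f.2
    have hg : hsNorm 1 g.toL2 < ∞ := g.2
    simp only [H1.norm_def, map_add]
    rw [← ENNReal.toReal_add hf.ne hg.ne]
    exact ENNReal.toReal_mono (ENNReal.add_lt_top.2 ⟨hf, hg⟩).ne (hsNorm_add_le 1 _ _)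
  norm_eq_zero_iff f := by
    have hf : hsNorm 1 f.toL2 < ∞ := f.2
    constructor
    · intro h
      rw [H1.norm_def, ENNReal.toReal_eq_zero_iff] at h
      have h0 := eq_zero_of_hsNorm 1 _ (h.resolve_right hf.ne)
      exact Subtype.ext h0
    · rintro rfl
      simp [H1.norm_def, hsNorm_zero]

instance : NormedAddCommGroup (H1 L) := NormedAddCommGroup.ofCore H1.normedSpaceCore

instance : NormedSpace ℂ (H1 L) := NormedSpace.ofCore H1.normedSpaceCore

end H1

/-- The parameter set `U = [-1/2, 1/2]^ℕ`. -/
def U : Set (ℕ → ℝ) := {ξ | ∀ j, ξ j ∈ Icc (-1 / 2 : ℝ) (1 / 2)}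

/-- The truncated parameter set `U_m = [-1/2, 1/2]^m`. -/
def Um (m : ℕ) : Set (Fin m → ℝ) := {ξ | ∀ j, ξ j ∈ Icc (-1 / 2 : ℝ) (1 / 2)}

section Equation

variable {L : ℝ} [Fact (0 < 2 * L)]

/-- The potential `V(ξ) = v₀ + ∑_{j ≥ 1} √λ_j ξ_j v_j`; the `j`-th term of the series is stored at
index `j - 1`. -/
def potential (lam : ℕ → ℝ) (v₀ : L2 L) (v : ℕ → L2 L) (ξ : ℕ → ℝ) : L2 L :=
  v₀ + ∑' j, (Real.sqrt (lam j) * ξ j) • v j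

/-- The truncated potential `V_m(ξ) = v₀ + ∑_{j = 1}^m √λ_j ξ_j v_j`. -/
def potentialTrunc (lam : ℕ → ℝ) (v₀ : L2 L) (v : ℕ → L2 L) (m : ℕ) (ξ : Fin m → ℝ) : L2 L :=
  v₀ + ∑ j : Fin m, (Real.sqrt (lam j) * ξ j) • v j

/-- `f` is real-valued (almost everywhere). -/
def IsRealValued (f : L2 L) : Prop := ∀ᵐ x ∂AddCircle.haarAddCircle, (f x).im = 0

/-- `u ∈ C([0,∞); H¹(𝕋))` is a solution of
`i ∂ₜ u = -(1/2) ∂ₓ² u + W u + α |u|² u` for `t > 0`, `u(0) = u₀`.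
The equation is understood in the sense of (periodic) distributions in `x`, i.e. tested against all
the modes `exp (-i π l x / L)`, `l ∈ ℤ`: the operator `-(1/2) ∂ₓ²` then becomes multiplication of
the `l`-th Fourier coefficient by `(π l / L)² / 2`. -/
structure IsNLSSolution (α : ℝ) (W u₀ : L2 L) (u : ℝ → H1 L) : Prop where
  continuousOn : ContinuousOn u (Ici 0)
  initial : (u 0).toL2 = u₀
  equation : ∀ t > 0, ∀ l : ℤ, ∃ d : ℂ,
    HasDerivAt (fun τ => fc (u τ).toL2 l) d t ∧
    Complex.I * d = (freq L l ^ 2 / 2 : ℝ) * fc (u t).toL2 l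
      + fc (fun x => W x * (u t).toL2 x + α * ‖(u t).toL2 x‖ ^ 2 * (u t).toL2 x) l

/-- `‖V‖_{L^∞(U; H^s)} = sup_{ξ ∈ U} ‖V(ξ)‖_{H^s}`. -/
def supNormV (s : ℝ) (V : (ℕ → ℝ) → L2 L) : ℝ≥0∞ := ⨆ ξ ∈ U, hsNorm s (V ξ)

/-- `‖ψ‖_{L^∞((0,T) × U; H^s)} = sup_{t ∈ (0,T), ξ ∈ U} ‖ψ(t,ξ)‖_{H^s}`. -/
def supNormPsi (s T : ℝ) (ψ : ℝ → (ℕ → ℝ) → H1 L) : ℝ≥0∞ :=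
  ⨆ t ∈ Ioo 0 T, ⨆ ξ ∈ U, hsNorm s (ψ t ξ).toL2

end Equation

section Derivatives

variable {E : Type*} [NormedAddCommGroup E] [NormedSpace ℝ E] {m : ℕ}

/-- The partial derivative `∂_{ξ_j} F` of a function on `U_m` (one-sided on the boundary). -/
def partialDeriv (j : Fin m) (F : (Fin m → ℝ) → E) (ξ : Fin m → ℝ) : E :=
  derivWithin (fun r => F (Function.update ξ j r)) (Icc (-1 / 2) (1 / 2)) (ξ j)

/-- `∂^ν F = ∂_{ξ_1}^{ν_1} ⋯ ∂_{ξ_m}^{ν_m} F`. -/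
def mixedDeriv (ν : Fin m → ℕ) (F : (Fin m → ℝ) → E) : (Fin m → ℝ) → E :=
  (List.finRange m).foldr (fun j G => (partialDeriv j)^[ν j] G) F

/-- The set `Γ = {0, 1}^m` of multi-indices. -/
def Gam (m : ℕ) : Set (Fin m → ℕ) := {ν | ∀ j, ν j = 0 ∨ ν j = 1}

end Derivatives

/-- The constant `C_T = max {C_T⁰, 1}`, where `NV` and `M` stand for `‖V‖_{L^∞(U; H^s)}` and
`‖ψ‖_{L^∞((0,T) × U; H^s)}`. -/
def constCT (C₀ α T NV M : ℝ) : ℝ :=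
  max (2 * max 1 |α| * C₀ * T * max 1 M *
    Real.exp (T * max 1 (C₀ * (NV + 3 * |α| * M ^ 2)))) 1

end QmcNLS

end

/-!
The constant is `C₀ = max K (K ^ 2)`, where `K` is the constant `algConst L` of the algebra property
`‖u v‖ ≤ K ‖u‖ ‖v‖` of `H¹(𝕋)`.

*Well-posedness.* On the Fourier side the equation says that the profile
`p(t) = exp (-i t ∂ₓ² / 2) ψ(t)` solves an ordinary differential equation in `H¹(𝕋)` with a locally Lipschitz field, so
that solutions in the sense of distributions are the same as mild solutions
(`isMild_of_isNLSSolution`, `isNLSSolution_of_isMild`), and these are unique by Grönwall's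
inequality (`IsMild.unique`). As `V` is real, mass and energy are conserved; together with a
Gagliardo–Nirenberg inequality this bounds the `H¹` norm for all times, also in the focusing case
(`exists_apriori_bound`), hence solutions are global (`exists_isMild_global`). By a tame product
estimate the `H^s` norm then grows at most exponentially, with a rate that is uniform for
potentials in a bounded subset of `H^s` (`exists_hsNorm_bound`); this is the finiteness of the
supremum of the `H^s` norms.

*Smoothness in the parameters.* `V_m(ξ)` is affine in `ξ` and so extends to all `ξ ∈ ℝᵐ`. The
solution on `[0, T]`, as an element of `C([0, T]; H¹)`, is the only zero of a smooth map
`X ↦ X - Φ(ξ, X)`. The derivative of `Φ` in `X` is a Volterra operator, so the implicit function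
theorem applies at every `ξ` (`contDiff_path`). Therefore all mixed derivatives exist, commute, and
coincide on `U_m` with the one-sided ones (`mixedDeriv_eq_md`).

*The bound.* Differentiating Duhamel's formula in the directions `j ∈ S` gives an equation
(`md_path_eq`) whose right-hand side consists, with `n = |S|`, of `V ∂^S ψ`, of `n` terms in which
`V` is differentiated once, and of the `3 ^ n` terms `∂^Q ψ * conj (∂^{R ∖ Q} ψ) * ∂^{S ∖ R} ψ`,
`Q ⊆ R ⊆ S`. Three of the latter contain `∂^S ψ`. They and `V ∂^S ψ` account for the rate
`C₀ (‖V‖ + 3 |α| ‖ψ‖²)` in Grönwall's inequality, which does not depend on `S`; the remaining terms are of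
lower order. Since `ψ_m(t, ξ)` is `ψ(t, ·)` at the extension of `ξ` by zeros, it is bounded by the
supremum over `U`. As `n + 3 ^ n ≤ 2 * 3 ^ n` and the exponent `E(n) = (n + 2) (n - 1) / 2` is
superadditive up to a shift and satisfies `E(n) = E(n - 1) + n` for `n ≥ 2`, the bound follows by
induction on `n` (`source_le`, `norm_md_path_le`).
-/

open MeasureTheory Set
open scoped ENNReal

noncomputable section

namespace QmcNLS

section

/-! ### Weighted `ℓ²` norms and convolutions of nonnegative sequences -/

/-- The `ℓ²` norm of a sequence of extended nonnegative numbers. -/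
def l2norm (a : ℤ → ℝ≥0∞) : ℝ≥0∞ := (∑' l, a l ^ 2) ^ (1 / 2 : ℝ)

/-- The convolution of two sequences of extended nonnegative numbers. -/
def conv (a b : ℤ → ℝ≥0∞) (l : ℤ) : ℝ≥0∞ := ∑' k, a k * b (l - k)

theorem l2norm_eq_lintegral (a : ℤ → ℝ≥0∞) :
    l2norm a = (∫⁻ l, a l ^ (2 : ℝ) ∂(Measure.count : Measure ℤ)) ^ (1 / 2 : ℝ) := by
  simp [l2norm, lintegral_count]

theorem l2norm_sq (a : ℤ → ℝ≥0∞) : l2norm a ^ 2 = ∑' l, a l ^ 2 := by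
  rw [l2norm, ← ENNReal.rpow_natCast, ← ENNReal.rpow_mul]
  norm_num

theorem l2norm_mono {a b : ℤ → ℝ≥0∞} (h : ∀ l, a l ≤ b l) : l2norm a ≤ l2norm b :=
  ENNReal.rpow_le_rpow (ENNReal.tsum_le_tsum fun l => by gcongr; exact h l) (by norm_num)

theorem l2norm_add_le (a b : ℤ → ℝ≥0∞) :
    l2norm (fun l => a l + b l) ≤ l2norm a + l2norm b := by
  simp only [l2norm_eq_lintegral]
  exact ENNReal.lintegral_Lp_add_le (Measurable.of_discrete).aemeasurable
    (Measurable.of_discrete).aemeasurable (by norm_num)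

theorem l2norm_const_mul (c : ℝ≥0∞) (a : ℤ → ℝ≥0∞) :
    l2norm (fun l => c * a l) = c * l2norm a := by
  simp only [l2norm, mul_pow]
  rw [ENNReal.tsum_mul_left, ENNReal.mul_rpow_of_nonneg _ _ (by norm_num)]
  congr 1
  rw [← ENNReal.rpow_natCast, ← ENNReal.rpow_mul]
  norm_num

/-- The Cauchy–Schwarz inequality. -/
theorem tsum_mul_le_l2norm (a b : ℤ → ℝ≥0∞) : ∑' l, a l * b l ≤ l2norm a * l2norm b := by
  have := ENNReal.lintegral_mul_le_Lp_mul_Lq (Measure.count : Measure ℤ)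
    (Real.HolderConjugate.two_two) (f := a) (g := b)
    (Measurable.of_discrete).aemeasurable (Measurable.of_discrete).aemeasurable
  rw [l2norm_eq_lintegral, l2norm_eq_lintegral]
  simpa [lintegral_count] using this

theorem conv_comm (a b : ℤ → ℝ≥0∞) : conv a b = conv b a := by
  funext l
  rw [conv, conv, ← (Equiv.subLeft l).tsum_eq]
  simp [mul_comm]

/-- Young's inequality `‖a * b‖_{ℓ²} ≤ ‖a‖_{ℓ¹} ‖b‖_{ℓ²}`. -/
theorem l2norm_conv_le (a b : ℤ → ℝ≥0∞) : l2norm (conv a b) ≤ (∑' k, a k) * l2norm b := by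
  have key : ∀ l, conv a b l ^ 2 ≤ (∑' k, a k) * ∑' k, a k * b (l - k) ^ 2 := by
    intro l
    have hs : ∀ x : ℝ≥0∞, x ^ (1 / 2 : ℝ) * x ^ (1 / 2 : ℝ) = x := by
      intro x
      rw [← ENNReal.rpow_add_of_nonneg _ _ (by norm_num) (by norm_num)]
      norm_num
    have h := tsum_mul_le_l2norm (fun k => a k ^ (1 / 2 : ℝ))
      (fun k => a k ^ (1 / 2 : ℝ) * b (l - k))
    have h' : conv a b l ≤ l2norm (fun k => a k ^ (1 / 2 : ℝ)) *
        l2norm (fun k => a k ^ (1 / 2 : ℝ) * b (l - k)) := by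
      refine le_trans (le_of_eq ?_) h
      refine tsum_congr fun k => ?_
      rw [← mul_assoc, hs]
    calc conv a b l ^ 2 ≤ _ := pow_le_pow_left₀ zero_le h' 2
      _ = _ := by
        rw [mul_pow, l2norm_sq, l2norm_sq]
        simp only [mul_pow, pow_two (_ ^ (1 / 2 : ℝ)), hs]
  have h2 : l2norm (conv a b) ^ 2 ≤ ((∑' k, a k) * l2norm b) ^ 2 := by
    rw [l2norm_sq]
    calc ∑' l, conv a b l ^ 2 ≤ ∑' l, (∑' k, a k) * ∑' k, a k * b (l - k) ^ 2 :=
          ENNReal.tsum_le_tsum key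
      _ = (∑' k, a k) * ∑' k, ∑' l, a k * b (l - k) ^ 2 := by
          rw [ENNReal.tsum_mul_left, ENNReal.tsum_comm]
      _ = (∑' k, a k) * ∑' k, a k * ∑' l, b l ^ 2 := by
          congr 1
          refine tsum_congr fun k => ?_
          rw [ENNReal.tsum_mul_left, ← (Equiv.subRight k).tsum_eq (fun l => b l ^ 2)]
          simp
      _ = _ := by
          rw [ENNReal.tsum_mul_right, mul_pow, l2norm_sq]
          ring
  exact (ENNReal.pow_le_pow_left_iff two_ne_zero).1 h2

/-- The tame product estimate for a weight `w` which is subadditive up to a constant. -/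
theorem l2norm_mul_conv_le {w : ℤ → ℝ≥0∞} {C : ℝ≥0∞} (hw : ∀ k l, w (k + l) ≤ C * (w k + w l))
    (a b : ℤ → ℝ≥0∞) :
    l2norm (fun l => w l * conv a b l) ≤
      C * ((∑' k, b k) * l2norm (fun k => w k * a k) +
        (∑' k, a k) * l2norm (fun k => w k * b k)) := by
  have h1 : ∀ l, w l * conv a b l ≤
      C * (conv (fun k => w k * a k) b l + conv a (fun k => w k * b k) l) := by
    intro l
    simp only [conv]
    rw [← ENNReal.tsum_mul_left, ← ENNReal.tsum_add, ← ENNReal.tsum_mul_left]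
    refine ENNReal.tsum_le_tsum fun k => ?_
    have := hw k (l - k)
    rw [add_sub_cancel] at this
    calc w l * (a k * b (l - k)) ≤ C * (w k + w (l - k)) * (a k * b (l - k)) := by gcongr
      _ = _ := by ring
  refine (l2norm_mono h1).trans ?_
  rw [l2norm_const_mul]
  gcongr
  refine (l2norm_add_le _ _).trans ?_
  gcongr
  · rw [conv_comm]
    exact l2norm_conv_le _ _
  · exact l2norm_conv_le _ _

/-! ### Japanese brackets -/

/-- The Japanese bracket `⟨l⟩ = (1 + (π l / L)²)^{1/2}` of the `l`-th frequency. -/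
def bracket (L : ℝ) (l : ℤ) : ℝ := Real.sqrt (1 + freq L l ^ 2)

theorem freq_add (L : ℝ) (k l : ℤ) : freq L (k + l) = freq L k + freq L l := by
  simp only [freq]; push_cast; ring

theorem one_le_bracket (L : ℝ) (l : ℤ) : 1 ≤ bracket L l :=
  Real.one_le_sqrt.2 (by nlinarith [sq_nonneg (freq L l)])

theorem bracket_pos (L : ℝ) (l : ℤ) : 0 < bracket L l := one_pos.trans_le (one_le_bracket L l)

theorem bracket_sq (L : ℝ) (l : ℤ) : bracket L l ^ 2 = 1 + freq L l ^ 2 :=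
  Real.sq_sqrt (by positivity)

theorem bracket_add_le (L : ℝ) (k l : ℤ) : bracket L (k + l) ≤ bracket L k + bracket L l := by
  have h1 := bracket_pos L k
  have h2 := bracket_pos L l
  refine Real.sqrt_le_iff.2 ⟨by positivity, ?_⟩
  have h : freq L k * freq L l ≤ bracket L k * bracket L l := by
    refine abs_le_of_sq_le_sq' ?_ (by positivity) |>.2
    rw [mul_pow, mul_pow, bracket_sq, bracket_sq]
    nlinarith [sq_nonneg (freq L k), sq_nonneg (freq L l)]
  rw [freq_add, add_sq, add_sq, bracket_sq, bracket_sq]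
  nlinarith

theorem rpow_bracket (L s : ℝ) (l : ℤ) : (1 + freq L l ^ 2) ^ s = (bracket L l ^ s) ^ 2 := by
  rw [← bracket_sq, ← Real.rpow_natCast, ← Real.rpow_natCast, ← Real.rpow_mul (bracket_pos L l).le,
    ← Real.rpow_mul (bracket_pos L l).le, mul_comm]

theorem bracket_rpow_add_le (L : ℝ) {s : ℝ} (hs : 0 ≤ s) (k l : ℤ) :
    bracket L (k + l) ^ s ≤ 2 ^ s * (bracket L k ^ s + bracket L l ^ s) := by
  have h1 := bracket_pos L k
  have h2 := bracket_pos L l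
  have h0 := bracket_pos L (k + l)
  have hb : bracket L (k + l) ≤ 2 * max (bracket L k) (bracket L l) := by
    have := bracket_add_le L k l
    have := le_max_left (bracket L k) (bracket L l)
    have := le_max_right (bracket L k) (bracket L l)
    linarith
  calc bracket L (k + l) ^ s ≤ (2 * max (bracket L k) (bracket L l)) ^ s :=
        Real.rpow_le_rpow h0.le hb hs
    _ = 2 ^ s * max (bracket L k) (bracket L l) ^ s := by
        rw [Real.mul_rpow (by norm_num) (by positivity)]
    _ ≤ _ := by
        gcongr
        rcases max_cases (bracket L k) (bracket L l) with h | h <;> rw [h.1]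
        · have : 0 ≤ bracket L l ^ s := by positivity
          linarith
        · have : 0 ≤ bracket L k ^ s := by positivity
          linarith

theorem summable_bracket_inv_sq {L : ℝ} (hL : 0 < L) :
    Summable fun l : ℤ => (bracket L l ^ 2)⁻¹ := by
  have h : Summable fun l : ℤ => (L / Real.pi) ^ 2 * (1 / (l : ℝ) ^ 2) :=
    (Real.summable_one_div_int_pow.2 one_lt_two).mul_left _
  have h0 : Summable fun l : ℤ => (if l = 0 then (1 : ℝ) else 0) :=
    summable_of_ne_finset_zero (s := {0}) (by intro b hb; simp at hb; simp [hb])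
  refine Summable.of_nonneg_of_le (fun l => by positivity) (fun l => ?_) (h.add h0)
  rw [bracket_sq]
  have hpi := Real.pi_pos
  by_cases hl : l = 0
  · subst hl; simp [freq]
  · have hl' : (l : ℝ) ≠ 0 := by exact_mod_cast hl
    have : 0 < freq L l ^ 2 := by
      have : freq L l ≠ 0 := by simp [freq, hl', hpi.ne', hL.ne']
      positivity
    simp only [hl, if_false, add_zero]
    calc (1 + freq L l ^ 2)⁻¹ ≤ (freq L l ^ 2)⁻¹ := by
          apply inv_anti₀ this; linarith
      _ = _ := by simp only [freq]; field_simp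

end

section

variable {L : ℝ} [hL : Fact (0 < 2 * L)]

/-! ### Fourier coefficients of `L²` and `H¹` functions -/

theorem pos_of_fact : 0 < L := by
  have := hL.out
  linarith

theorem L2.ext_fc {f g : L2 L} (h : ∀ l, fc f l = fc g l) : f = g := by
  apply (fourierBasis (T := 2 * L)).repr.injective
  ext l
  rw [fourierBasis_repr, fourierBasis_repr]
  exact h l

/-- The `l`-th Fourier coefficient as a continuous linear functional on `L²(𝕋)`. -/
def fcL (l : ℤ) : L2 L →L[ℂ] ℂ := innerSL ℂ (fourierBasis (T := 2 * L) l)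

theorem fcL_apply (l : ℤ) (f : L2 L) : fcL l f = fc f l := by
  rw [fcL, innerSL_apply_apply, ← HilbertBasis.repr_apply_apply, fourierBasis_repr]
  rfl

theorem L2.enorm_eq (f : L2 L) : ‖f‖ₑ = l2norm fun l => ‖fc f l‖ₑ := by
  have H₁ : HasSum (fun i => ‖fc f i‖ ^ 2) (‖f‖ ^ 2) := by
    have : HasSum (fun i => ‖fourierBasis.repr f i‖ ^ 2) (‖fourierBasis.repr f‖ ^ 2) := by
      apply_mod_cast lp.hasSum_norm ?_ (fourierBasis.repr f)
      simp
    simp only [fourierBasis_repr, LinearIsometryEquiv.norm_map] at this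
    exact this
  have H₂ : ∑' l, ‖fc f l‖ₑ ^ 2 = ‖f‖ₑ ^ 2 := by
    rw [← ofReal_norm, ← ENNReal.ofReal_pow (norm_nonneg _), ← H₁.tsum_eq,
      ENNReal.ofReal_tsum_of_nonneg (fun l => by positivity) H₁.summable]
    refine tsum_congr fun l => ?_
    rw [← ofReal_norm, ENNReal.ofReal_pow (norm_nonneg _)]
  rw [l2norm, H₂, ← ENNReal.rpow_natCast, ← ENNReal.rpow_mul]
  norm_num

theorem L2.exists_fc_eq (c : ℤ → ℂ) (h : l2norm (fun l => ‖c l‖ₑ) < ∞) :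
    ∃ f : L2 L, ∀ l, fc f l = c l := by
  have hc : Memℓp c 2 := by
    rw [memℓp_gen_iff (by norm_num)]
    have h' : ∑' l, ‖c l‖ₑ ^ 2 < ∞ := by
      rw [← l2norm_sq]; exact ENNReal.pow_lt_top h
    have := ENNReal.summable_toReal h'.ne
    simpa using this
  refine ⟨fourierBasis.repr.symm ⟨c, hc⟩, fun l => ?_⟩
  rw [fc, ← fourierBasis_repr]
  simp

theorem hsNorm_eq_l2norm (s : ℝ) (f : L2 L) :
    hsNorm s f = ENNReal.ofReal (Real.sqrt (2 * L)) *
      l2norm fun l => ENNReal.ofReal (bracket L l ^ s) * ‖fc f l‖ₑ := by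
  rw [← l2norm_const_mul, hsNorm, l2norm, ← ENNReal.tsum_mul_left]
  congr 1
  refine tsum_congr fun l => ?_
  have := bracket_pos L l
  rw [rpow_bracket, mul_pow, mul_pow, ← ENNReal.ofReal_pow (by positivity),
    ← ENNReal.ofReal_pow (by positivity), Real.sq_sqrt hL.out.le]

theorem hsNorm_mono {s s' : ℝ} (h : s ≤ s') (f : L2 L) : hsNorm s f ≤ hsNorm s' f := by
  rw [hsNorm_eq_l2norm, hsNorm_eq_l2norm]
  gcongr
  refine l2norm_mono fun l => ?_
  gcongr
  exact one_le_bracket L l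

/-- The `l`-th Fourier coefficient of an element of `H¹(𝕋)`. -/
def coef (u : H1 L) (l : ℤ) : ℂ := fc u.toL2 l

theorem H1.toL2_injective : Function.Injective (H1.toL2 : H1 L → L2 L) := fun _ _ h =>
  Subtype.ext h

theorem H1.ext_coef {u v : H1 L} (h : ∀ l, coef u l = coef v l) : u = v :=
  H1.toL2_injective (L2.ext_fc h)

theorem coef_add (u v : H1 L) (l : ℤ) : coef (u + v) l = coef u l + coef v l := by
  simp only [coef, map_add, fc_add]

theorem coef_smul (c : ℂ) (u : H1 L) (l : ℤ) : coef (c • u) l = c * coef u l := by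
  simp only [coef, map_smul, fc_smul]

theorem coef_real_smul (c : ℝ) (u : H1 L) (l : ℤ) : coef (c • u) l = c * coef u l :=
  coef_smul (c : ℂ) u l

/-- The `H¹` norm of a sequence of Fourier coefficients, without the factor `√(2L)`. -/
def wl2 (L : ℝ) (c : ℤ → ℂ) : ℝ≥0∞ := l2norm fun l => ENNReal.ofReal (bracket L l) * ‖c l‖ₑ

theorem hsNorm_one_eq (f : L2 L) :
    hsNorm 1 f = ENNReal.ofReal (Real.sqrt (2 * L)) * wl2 L (fc f) := by
  simp [hsNorm_eq_l2norm, wl2]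

theorem H1.enorm_eq_hsNorm (u : H1 L) : ‖u‖ₑ = hsNorm 1 u.toL2 := by
  rw [← ofReal_norm, H1.norm_def, ENNReal.ofReal_toReal]
  exact (show hsNorm 1 u.toL2 < ∞ from u.2).ne

theorem H1.enorm_eq (u : H1 L) :
    ‖u‖ₑ = ENNReal.ofReal (Real.sqrt (2 * L)) * wl2 L (coef u) := by
  rw [H1.enorm_eq_hsNorm, hsNorm_one_eq]; rfl

theorem sqrt_two_mul_pos : 0 < Real.sqrt (2 * L) := Real.sqrt_pos.2 hL.out

theorem wl2_coef_lt_top (u : H1 L) : wl2 L (coef u) < ∞ := by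
  have h : ‖u‖ₑ < ∞ := enorm_lt_top
  rw [H1.enorm_eq] at h
  rcases ENNReal.mul_lt_top_iff.1 h with h | h | h
  · exact h.2
  · exact absurd h (by simpa using sqrt_two_mul_pos)
  · simp [h]

/-- Every `L²` function of finite `H¹` norm underlies an element of `H¹(𝕋)`. -/
theorem exists_toL2_eq {f : L2 L} (h : hsNorm 1 f < ∞) : ∃ u : H1 L, u.toL2 = f := ⟨⟨f, h⟩, rfl⟩

theorem exists_coef_eq (c : ℤ → ℂ) (h : wl2 L c < ∞) : ∃ u : H1 L, ∀ l, coef u l = c l := by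
  obtain ⟨f, hf⟩ := L2.exists_fc_eq (L := L) c (lt_of_le_of_lt (l2norm_mono fun l => by
    refine le_mul_of_one_le_left zero_le ?_
    exact ENNReal.one_le_ofReal.2 (one_le_bracket L l)) h)
  have : hsNorm 1 f < ∞ := by
    rw [hsNorm_one_eq, funext hf]
    exact ENNReal.mul_lt_top ENNReal.ofReal_lt_top h
  obtain ⟨u, hu⟩ := exists_toL2_eq this
  exact ⟨u, fun l => by rw [coef, hu, hf]⟩

open Classical in
/-- The element of `H¹(𝕋)` with given Fourier coefficients; `0` if there is none. -/
def ofCoeff (c : ℤ → ℂ) : H1 L := if h : ∃ u : H1 L, ∀ l, coef u l = c l then h.choose else 0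

theorem coef_ofCoeff {c : ℤ → ℂ} (h : wl2 L c < ∞) (l : ℤ) :
    coef (ofCoeff c : H1 L) l = c l := by
  have := exists_coef_eq c h
  rw [ofCoeff, dif_pos this]
  exact this.choose_spec l

theorem exists_bessel (u : H1 L) :
    ∃ f : L2 L, ∀ l, fc f l = ((Real.sqrt (2 * L) * bracket L l : ℝ) : ℂ) * coef u l := by
  refine L2.exists_fc_eq _ (lt_of_eq_of_lt ?_ (enorm_lt_top (x := u)))
  rw [H1.enorm_eq, wl2, ← l2norm_const_mul]
  congr 1
  funext l
  rw [enorm_mul, ← mul_assoc, ← ENNReal.ofReal_mul (Real.sqrt_nonneg _), ← ofReal_norm,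
    Complex.norm_real, Real.norm_of_nonneg (mul_nonneg (Real.sqrt_nonneg _) (bracket_pos L l).le)]

/-- The isometry of `H¹(𝕋)` onto `L²(𝕋)` which multiplies the `l`-th Fourier coefficient by
`√(2L) ⟨l⟩`. -/
def besselL : H1 L →ₗᵢ[ℂ] L2 L where
  toFun u := (exists_bessel u).choose
  map_add' u v := L2.ext_fc fun l => by
    rw [fc_add, (exists_bessel _).choose_spec, (exists_bessel u).choose_spec,
      (exists_bessel v).choose_spec, coef_add, mul_add]
  map_smul' c u := L2.ext_fc fun l => by
    rw [RingHom.id_apply, fc_smul, (exists_bessel _).choose_spec, (exists_bessel u).choose_spec,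
      coef_smul]
    ring
  norm_map' u := by
    have h : ‖(exists_bessel u).choose‖ₑ = ‖u‖ₑ := by
      rw [H1.enorm_eq, wl2, ← l2norm_const_mul, L2.enorm_eq]
      congr 1
      funext l
      rw [(exists_bessel u).choose_spec, enorm_mul, ← mul_assoc,
        ← ENNReal.ofReal_mul (Real.sqrt_nonneg _), ← ofReal_norm, Complex.norm_real,
        Real.norm_of_nonneg (mul_nonneg (Real.sqrt_nonneg _) (bracket_pos L l).le)]
    simpa using congrArg ENNReal.toReal h

theorem fc_besselL (u : H1 L) (l : ℤ) :
    fc (besselL u) l = ((Real.sqrt (2 * L) * bracket L l : ℝ) : ℂ) * coef u l :=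
  (exists_bessel u).choose_spec l

theorem besselL_surjective : Function.Surjective (besselL : H1 L →ₗᵢ[ℂ] L2 L) := by
  intro f
  have hs := sqrt_two_mul_pos (L := L)
  obtain ⟨u, hu⟩ := exists_coef_eq (L := L)
    (fun l => (((Real.sqrt (2 * L) * bracket L l : ℝ) : ℂ))⁻¹ * fc f l) (by
      have : wl2 L (fun l => (((Real.sqrt (2 * L) * bracket L l : ℝ) : ℂ))⁻¹ * fc f l) =
          l2norm fun l => ENNReal.ofReal (Real.sqrt (2 * L))⁻¹ * ‖fc f l‖ₑ := by
        rw [wl2]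
        congr 1
        funext l
        have hb := bracket_pos L l
        rw [enorm_mul, ← mul_assoc, ← ofReal_norm (E := ℂ) (_)⁻¹, ← ENNReal.ofReal_mul hb.le,
          norm_inv, Complex.norm_real, Real.norm_of_nonneg (by positivity)]
        congr 2
        field_simp
      rw [this, l2norm_const_mul, ← L2.enorm_eq]
      exact ENNReal.mul_lt_top ENNReal.ofReal_lt_top enorm_lt_top)
  refine ⟨u, L2.ext_fc fun l => ?_⟩
  have hb := bracket_pos L l
  rw [fc_besselL, hu, mul_inv_cancel_left₀]
  exact_mod_cast (by positivity)

instance : CompleteSpace (H1 L) :=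
  (besselL.isometry.isUniformInducing.completeSpace_congr besselL_surjective).2 inferInstance

/-- The constant in the embedding of `H¹(𝕋)` into the functions with summable Fourier
coefficients. -/
def embConst (L : ℝ) : ℝ := (Real.sqrt (2 * L))⁻¹ * Real.sqrt (∑' l : ℤ, (bracket L l ^ 2)⁻¹)

theorem embConst_pos : 0 < embConst L := by
  have hs := sqrt_two_mul_pos (L := L)
  refine mul_pos (by positivity) (Real.sqrt_pos.2 ?_)
  have := (summable_bracket_inv_sq (pos_of_fact (L := L)))
  refine this.tsum_pos (fun l => by positivity) 0 ?_
  have := bracket_pos L 0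
  positivity

/-- The `ℓ¹` norm of the Fourier coefficients. -/
def l1norm (u : H1 L) : ℝ≥0∞ := ∑' l, ‖coef u l‖ₑ

theorem l1norm_le (u : H1 L) : l1norm u ≤ ENNReal.ofReal (embConst L * ‖u‖) := by
  have hs := sqrt_two_mul_pos (L := L)
  have hsum := summable_bracket_inv_sq (pos_of_fact (L := L))
  have h1 : l1norm u ≤ l2norm (fun l => ENNReal.ofReal (bracket L l)⁻¹) * wl2 L (coef u) := by
    refine le_trans (le_of_eq ?_) (tsum_mul_le_l2norm _ _)
    refine tsum_congr fun l => ?_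
    have hb := bracket_pos L l
    rw [← mul_assoc, ← ENNReal.ofReal_mul (by positivity), inv_mul_cancel₀ hb.ne']
    simp
  have h2 : l2norm (fun l => ENNReal.ofReal (bracket L l)⁻¹) =
      ENNReal.ofReal (Real.sqrt (∑' l : ℤ, (bracket L l ^ 2)⁻¹)) := by
    rw [l2norm, Real.sqrt_eq_rpow, ← ENNReal.ofReal_rpow_of_nonneg
      (tsum_nonneg fun l => by positivity) (by norm_num),
      ENNReal.ofReal_tsum_of_nonneg (fun l => by positivity) hsum]
    congr 1
    refine tsum_congr fun l => ?_
    have hb := bracket_pos L l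
    rw [← ENNReal.ofReal_pow (by positivity), inv_pow]
  have h3 : wl2 L (coef u) = ENNReal.ofReal ((Real.sqrt (2 * L))⁻¹ * ‖u‖) := by
    rw [ENNReal.ofReal_mul (by positivity), ofReal_norm, H1.enorm_eq, ← mul_assoc,
      ← ENNReal.ofReal_mul (by positivity), inv_mul_cancel₀ hs.ne']
    simp
  rw [h2, h3, ← ENNReal.ofReal_mul (Real.sqrt_nonneg _)] at h1
  refine h1.trans (le_of_eq ?_)
  rw [embConst]; ring_nf

theorem l1norm_lt_top (u : H1 L) : l1norm u < ∞ := (l1norm_le u).trans_lt ENNReal.ofReal_lt_top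

theorem summable_coef (u : H1 L) : Summable (coef u) := by
  refine Summable.of_enorm ?_
  exact (l1norm_lt_top u).ne

theorem norm_coef_le (u : H1 L) (l : ℤ) : ‖coef u l‖ ≤ embConst L * ‖u‖ := by
  have h := (ENNReal.le_tsum (f := fun l => ‖coef u l‖ₑ) l).trans (l1norm_le u)
  rw [← ofReal_norm] at h
  exact (ENNReal.ofReal_le_ofReal_iff (mul_nonneg embConst_pos.le (norm_nonneg _))).1 h

/-- The `l`-th Fourier coefficient as a continuous real-linear map on `H¹(𝕋)`. -/
def coefL (l : ℤ) : H1 L →L[ℝ] ℂ :=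
  LinearMap.mkContinuous
    { toFun := fun u => coef u l
      map_add' := fun u v => coef_add u v l
      map_smul' := fun c u => by simp [coef_real_smul] } (embConst L)
    (fun u => norm_coef_le u l)

@[simp] theorem coefL_apply (l : ℤ) (u : H1 L) : coefL l u = coef u l := rfl

/-! ### Products and complex conjugates in `H¹` -/

/-- The continuous representative of an element of `H¹(𝕋)`. -/
def toC (u : H1 L) : C(AddCircle (2 * L), ℂ) := ∑' l, coef u l • fourier l

theorem hasSum_toC (u : H1 L) : HasSum (fun l => coef u l • fourier l) (toC u) := by
  refine Summable.hasSum (Summable.of_norm ?_)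
  simpa only [norm_smul, fourier_norm, mul_one] using (summable_coef u).norm

theorem toLp_toC (u : H1 L) :
    ContinuousMap.toLp (E := ℂ) 2 AddCircle.haarAddCircle ℂ (toC u) = u.toL2 := by
  refine HasSum.unique ?_ (hasSum_fourier_series_L2 u.toL2)
  have h := (hasSum_toC u).mapL (ContinuousMap.toLp (E := ℂ) 2 AddCircle.haarAddCircle ℂ)
  simp only [map_smul] at h
  exact h

theorem toL2_ae_eq (u : H1 L) : u.toL2 =ᵐ[AddCircle.haarAddCircle] toC u := by
  rw [← toLp_toC]
  exact ContinuousMap.coeFn_toLp _ _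

theorem fourierCoeff_toC (u : H1 L) (l : ℤ) : fourierCoeff (toC u) l = coef u l := by
  rw [← fourierCoeff_toLp, toLp_toC]; rfl

theorem toC_injective : Function.Injective (toC : H1 L → C(AddCircle (2 * L), ℂ)) := by
  intro u v h
  exact H1.ext_coef fun l => by rw [← fourierCoeff_toC, h, fourierCoeff_toC]

theorem toC_add (u v : H1 L) : toC (u + v) = toC u + toC v := by
  refine HasSum.unique (hasSum_toC _) ?_
  simpa only [coef_add, add_smul] using (hasSum_toC u).add (hasSum_toC v)

theorem toC_smul (c : ℂ) (u : H1 L) : toC (c • u) = c • toC u := by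
  refine HasSum.unique (hasSum_toC _) ?_
  simpa only [coef_smul, mul_smul] using (hasSum_toC u).const_smul c

theorem toC_real_smul (c : ℝ) (u : H1 L) : toC (c • u) = (c : ℂ) • toC u := toC_smul (c : ℂ) u

/-- The `l`-th Fourier coefficient as a continuous linear functional on `C(𝕋)`. -/
def fcC (l : ℤ) : C(AddCircle (2 * L), ℂ) →L[ℂ] ℂ :=
  (fcL l).comp (ContinuousMap.toLp (E := ℂ) 2 AddCircle.haarAddCircle ℂ)

theorem fcC_apply (l : ℤ) (f : C(AddCircle (2 * L), ℂ)) : fcC l f = fourierCoeff f l := by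
  rw [fcC, ContinuousLinearMap.comp_apply, fcL_apply, fc, fourierCoeff_toLp]

theorem fcC_fourier_mul (k l : ℤ) (f : C(AddCircle (2 * L), ℂ)) :
    fcC l (fourier k * f) = fcC (l - k) f := by
  rw [fcC_apply, fcC_apply, fourierCoeff, fourierCoeff]
  congr 1
  funext x
  rw [neg_sub, sub_eq_add_neg, add_comm k, fourier_add]
  simp [mul_assoc]

/-- The Fourier coefficients of a product are the convolution of the Fourier coefficients. -/
theorem hasSum_fcC_mul (u : H1 L) (f : C(AddCircle (2 * L), ℂ)) (l : ℤ) :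
    HasSum (fun k => coef u k * fcC (l - k) f) (fcC l (toC u * f)) := by
  have h := ((hasSum_toC u).mul_right f).mapL (fcC l)
  simpa only [smul_mul_assoc, map_smul, fcC_fourier_mul, smul_eq_mul] using h

theorem enorm_fcC_mul_le (u v : H1 L) (l : ℤ) :
    ‖fcC l (toC u * toC v)‖ₑ ≤ conv (fun k => ‖coef u k‖ₑ) (fun k => ‖coef v k‖ₑ) l := by
  have h := hasSum_fcC_mul u (toC v) l
  rw [← h.tsum_eq]
  refine enorm_tsum_le_tsum_enorm.trans (le_of_eq ?_)
  refine tsum_congr fun k => ?_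
  rw [enorm_mul, fcC_apply, fourierCoeff_toC]

end

section

variable {L : ℝ} [hL : Fact (0 < 2 * L)]

/-- The weighted norm `(∑ w_l² |û_l|²)^{1/2}`. -/
def wnorm (w : ℤ → ℝ) (u : H1 L) : ℝ≥0∞ := l2norm fun l => ENNReal.ofReal (w l) * ‖coef u l‖ₑ

theorem H1.enorm_eq_wnorm (u : H1 L) :
    ‖u‖ₑ = ENNReal.ofReal (Real.sqrt (2 * L)) * wnorm (bracket L) u := H1.enorm_eq u

theorem l2norm_fcC_mul_le {w : ℤ → ℝ} {C : ℝ} (hw0 : ∀ k, 0 ≤ w k)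
    (hw : ∀ k l, w (k + l) ≤ C * (w k + w l)) (hC : 0 ≤ C) (u v : H1 L) :
    l2norm (fun l => ENNReal.ofReal (w l) * ‖fcC l (toC u * toC v)‖ₑ) ≤
      ENNReal.ofReal C * (l1norm v * wnorm w u + l1norm u * wnorm w v) := by
  refine (l2norm_mono fun l => ?_).trans
    (l2norm_mul_conv_le (w := fun l => ENNReal.ofReal (w l)) (C := ENNReal.ofReal C)
      (fun k l => ?_) (fun k => ‖coef u k‖ₑ) (fun k => ‖coef v k‖ₑ))
  · gcongr
    exact enorm_fcC_mul_le u v l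
  · rw [← ENNReal.ofReal_add (hw0 k) (hw0 l), ← ENNReal.ofReal_mul hC]
    exact ENNReal.ofReal_le_ofReal (hw k l)

/-- The pointwise product of two elements of the algebra `H¹(𝕋)`. -/
instance : Mul (H1 L) := ⟨fun u v => ofCoeff fun l => fcC l (toC u * toC v)⟩

/-- The pointwise complex conjugate. -/
instance : Star (H1 L) := ⟨fun u => ofCoeff fun l => star (coef u (-l))⟩

theorem coef_mul (u v : H1 L) (l : ℤ) : coef (u * v) l = fcC l (toC u * toC v) := by
  refine coef_ofCoeff (lt_of_le_of_lt (l2norm_fcC_mul_le (C := 1)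
    (fun k => (bracket_pos L k).le) (fun k l => ?_) zero_le_one u v) ?_) l
  · rw [one_mul]
    exact bracket_add_le L k l
  · exact ENNReal.mul_lt_top ENNReal.ofReal_lt_top (ENNReal.add_lt_top.2
      ⟨ENNReal.mul_lt_top (l1norm_lt_top v) (wl2_coef_lt_top u),
        ENNReal.mul_lt_top (l1norm_lt_top u) (wl2_coef_lt_top v)⟩)

/-- The tame product estimate in `H¹(𝕋)` for weighted norms. -/
theorem wnorm_mul_le {w : ℤ → ℝ} {C : ℝ} (hw0 : ∀ k, 0 ≤ w k)
    (hw : ∀ k l, w (k + l) ≤ C * (w k + w l)) (hC : 0 ≤ C) (u v : H1 L) :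
    wnorm w (u * v) ≤ ENNReal.ofReal C * (l1norm v * wnorm w u + l1norm u * wnorm w v) := by
  rw [wnorm]
  simp only [coef_mul]
  exact l2norm_fcC_mul_le hw0 hw hC u v

theorem freq_neg (L : ℝ) (l : ℤ) : freq L (-l) = -freq L l := by
  simp only [freq]; push_cast; ring

theorem bracket_neg (L : ℝ) (l : ℤ) : bracket L (-l) = bracket L l := by
  simp [bracket, freq_neg]

theorem l2norm_comp_neg (a : ℤ → ℝ≥0∞) : l2norm (fun l => a (-l)) = l2norm a := by
  rw [l2norm, l2norm, (Equiv.neg ℤ).tsum_eq (fun l => a l ^ 2) |>.symm]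
  rfl

theorem coef_star (u : H1 L) (l : ℤ) : coef (star u) l = star (coef u (-l)) := by
  refine coef_ofCoeff (c := fun l => star (coef u (-l))) (lt_of_eq_of_lt ?_ (wl2_coef_lt_top u)) l
  rw [wl2, wl2, ← l2norm_comp_neg]
  simp [bracket_neg]

theorem wnorm_star {w : ℤ → ℝ} (hw : ∀ k, w (-k) = w k) (u : H1 L) :
    wnorm w (star u) = wnorm w u := by
  rw [wnorm, wnorm, ← l2norm_comp_neg]
  simp [coef_star, hw]

theorem l1norm_star (u : H1 L) : l1norm (star u) = l1norm u := by
  rw [l1norm, l1norm, ← (Equiv.neg ℤ).tsum_eq]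
  simp [coef_star]

theorem H1.norm_star (u : H1 L) : ‖star u‖ = ‖u‖ := by
  have : ‖star u‖ₑ = ‖u‖ₑ := by
    rw [H1.enorm_eq_wnorm, H1.enorm_eq_wnorm, wnorm_star (bracket_neg L)]
  simpa using congrArg ENNReal.toReal this

theorem toC_ext {u : H1 L} {f : C(AddCircle (2 * L), ℂ)} (h : ∀ l, coef u l = fcC l f) :
    toC u = f := by
  have : ContinuousMap.toLp (E := ℂ) 2 AddCircle.haarAddCircle ℂ (toC u) =
      ContinuousMap.toLp (E := ℂ) 2 AddCircle.haarAddCircle ℂ f := by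
    refine L2.ext_fc fun l => ?_
    rw [fc, fc, fourierCoeff_toLp, fourierCoeff_toLp, fourierCoeff_toC, h, fcC_apply]
  exact ContinuousMap.toLp_injective (𝕜 := ℂ) AddCircle.haarAddCircle this

theorem toC_mul (u v : H1 L) : toC (u * v) = toC u * toC v := toC_ext (coef_mul u v)

theorem toC_star (u : H1 L) : toC (star u) = star (toC u) := by
  refine toC_ext fun l => ?_
  rw [coef_star, fcC_apply, ← fourierCoeff_toC, fourierCoeff, fourierCoeff, Complex.star_def,
    ← integral_conj]
  congr 1
  funext x
  simp

theorem norm_mul_le_l1norm (u v : H1 L) :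
    ‖u * v‖ₑ ≤ l1norm v * ‖u‖ₑ + l1norm u * ‖v‖ₑ := by
  have h := wnorm_mul_le (C := 1) (fun k => (bracket_pos L k).le)
    (fun k l => by rw [one_mul]; exact bracket_add_le L k l) zero_le_one u v
  simp only [H1.enorm_eq_wnorm]
  calc _ ≤ _ := mul_le_mul_right h _
    _ = _ := by simp; ring

/-- The constant of the algebra property of `H¹(𝕋)`. -/
def algConst (L : ℝ) : ℝ := 2 * embConst L

theorem algConst_pos : 0 < algConst L := mul_pos two_pos embConst_pos

/-- `H¹(𝕋)` is an algebra. -/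
theorem H1.norm_mul_le (u v : H1 L) : ‖u * v‖ ≤ algConst L * ‖u‖ * ‖v‖ := by
  have hK := embConst_pos (L := L)
  have h : ‖u * v‖ₑ ≤ ENNReal.ofReal (algConst L * ‖u‖ * ‖v‖) := by
    refine (norm_mul_le_l1norm u v).trans ?_
    calc l1norm v * ‖u‖ₑ + l1norm u * ‖v‖ₑ
        ≤ ENNReal.ofReal (embConst L * ‖v‖) * ENNReal.ofReal ‖u‖ +
          ENNReal.ofReal (embConst L * ‖u‖) * ENNReal.ofReal ‖v‖ := by
          rw [ofReal_norm, ofReal_norm]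
          gcongr <;> exact l1norm_le _
      _ = _ := by
          rw [← ENNReal.ofReal_mul (by positivity), ← ENNReal.ofReal_mul (by positivity),
            ← ENNReal.ofReal_add (by positivity) (by positivity), algConst]
          ring_nf
  rw [← ofReal_norm] at h
  have := algConst_pos (L := L)
  exact (ENNReal.ofReal_le_ofReal_iff (by positivity)).1 h

/-- Multiplication in `H¹(𝕋)` as a bounded bilinear map over the real numbers. -/
def mulL : H1 L →L[ℝ] H1 L →L[ℝ] H1 L :=
  LinearMap.mkContinuous₂
    (LinearMap.mk₂ ℝ (fun u v => u * v)
      (fun u u' v => toC_injective (by simp only [toC_mul, toC_add]; ring))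
      (fun c u v => toC_injective (by simp only [toC_mul, toC_real_smul, smul_mul_assoc]))
      (fun u v v' => toC_injective (by simp only [toC_mul, toC_add]; ring))
      (fun c u v => toC_injective (by simp only [toC_mul, toC_real_smul, mul_smul_comm])))
    (algConst L) H1.norm_mul_le

@[simp] theorem mulL_apply (u v : H1 L) : mulL u v = u * v := rfl

/-- Complex conjugation as a real-linear isometry of `H¹(𝕋)`. -/
def starL : H1 L →ₗᵢ[ℝ] H1 L where
  toFun u := star u
  map_add' u v := toC_injective (by simp only [toC_star, toC_add, star_add])
  map_smul' c u := toC_injective (by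
    simp only [toC_star, toC_real_smul, RingHom.id_apply, star_smul, Complex.star_def,
      Complex.conj_ofReal])
  norm_map' := H1.norm_star

/-- The nonlinearity `V u + α |u|² u`. -/
def nonlin (α : ℝ) (V u : H1 L) : H1 L := V * u + α • (u * star u * u)

theorem fc_equation_eq (α : ℝ) (V u : H1 L) (l : ℤ) :
    fc (fun x => V.toL2 x * u.toL2 x + α * ‖u.toL2 x‖ ^ 2 * u.toL2 x) l =
      coef (nonlin α V u) l := by
  rw [fc, ← fourierCoeff_toC]
  refine congrFun (fourierCoeff_congr_ae ?_) l
  filter_upwards [toL2_ae_eq V, toL2_ae_eq u] with x hV hu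
  rw [hV, hu, nonlin, toC_add, toC_mul, toC_real_smul, toC_mul, toC_mul, toC_star]
  simp only [ContinuousMap.coe_add, ContinuousMap.coe_mul, ContinuousMap.coe_smul,
    ContinuousMap.coe_star, Pi.add_apply, Pi.mul_apply, Pi.smul_apply, Pi.star_apply, smul_eq_mul,
    Complex.star_def, Complex.mul_conj, Complex.normSq_eq_norm_sq]
  push_cast
  ring

instance : ContinuousStar (H1 L) := ⟨starL.continuous⟩

instance : ContinuousMul (H1 L) := ⟨mulL.continuous₂⟩

theorem continuous_nonlin (α : ℝ) (V : H1 L) : Continuous (nonlin α V) := by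
  have h1 : Continuous fun u : H1 L => V * u := continuous_const.mul continuous_id
  have h2 : Continuous fun u : H1 L => u * star u * u :=
    (continuous_id.mul continuous_id.star).mul continuous_id
  exact h1.add (h2.const_smul α)

theorem norm_nonlin_le (α : ℝ) (V u : H1 L) :
    ‖nonlin α V u‖ ≤ algConst L * ‖V‖ * ‖u‖ + |α| * (algConst L ^ 2 * ‖u‖ ^ 3) := by
  have hK := algConst_pos (L := L)
  refine (norm_add_le _ _).trans (add_le_add (H1.norm_mul_le _ _) ?_)
  rw [norm_smul, Real.norm_eq_abs]
  gcongr
  calc ‖u * star u * u‖ ≤ algConst L * ‖u * star u‖ * ‖u‖ := H1.norm_mul_le _ _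
    _ ≤ algConst L * (algConst L * ‖u‖ * ‖star u‖) * ‖u‖ := by
        gcongr; exact H1.norm_mul_le _ _
    _ = _ := by rw [H1.norm_star]; ring

theorem sub_mul_H1 (u u' v : H1 L) : (u - u') * v = u * v - u' * v := by
  simp [← mulL_apply]

theorem mul_sub_H1 (u v v' : H1 L) : u * (v - v') = u * v - u * v' := by
  simp [← mulL_apply]

theorem star_sub_H1 (u v : H1 L) : star (u - v) = star u - star v := starL.map_sub u v

theorem norm_nonlin_sub_le (α : ℝ) (V u v : H1 L) {R : ℝ} (hu : ‖u‖ ≤ R) (hv : ‖v‖ ≤ R) :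
    ‖nonlin α V u - nonlin α V v‖ ≤
      (algConst L * ‖V‖ + |α| * (3 * (algConst L ^ 2 * R ^ 2))) * ‖u - v‖ := by
  have hK := algConst_pos (L := L)
  have hR : 0 ≤ R := (norm_nonneg u).trans hu
  have e : nonlin α V u - nonlin α V v = V * (u - v) +
      α • ((u - v) * star u * u + v * star (u - v) * u + v * star v * (u - v)) := by
    rw [mul_sub_H1, sub_mul_H1, star_sub_H1, mul_sub_H1, mul_sub_H1, sub_mul_H1, sub_mul_H1,
      nonlin, nonlin, sub_add_sub_cancel, sub_add_sub_cancel, smul_sub]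
    abel
  have h3 : ∀ {x y z : H1 L} {a b c : ℝ}, ‖x‖ ≤ a → ‖y‖ ≤ b → ‖z‖ ≤ c →
      ‖x * y * z‖ ≤ algConst L ^ 2 * (a * b * c) := by
    intro x y z a b c hx hy hz
    have ha := (norm_nonneg x).trans hx
    have hb := (norm_nonneg y).trans hy
    have hc := (norm_nonneg z).trans hz
    calc ‖x * y * z‖ ≤ algConst L * ‖x * y‖ * ‖z‖ := H1.norm_mul_le _ _
      _ ≤ algConst L * (algConst L * ‖x‖ * ‖y‖) * ‖z‖ := by
          gcongr; exact H1.norm_mul_le _ _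
      _ ≤ algConst L * (algConst L * a * b) * c := by gcongr
      _ = _ := by ring
  have hsu : ‖star u‖ ≤ R := by rwa [H1.norm_star]
  have hsv : ‖star v‖ ≤ R := by rwa [H1.norm_star]
  have hsw : ‖star (u - v)‖ ≤ ‖u - v‖ := by rw [H1.norm_star]
  rw [e]
  refine (norm_add_le _ _).trans ?_
  rw [add_mul]
  refine add_le_add (H1.norm_mul_le _ _) ?_
  rw [norm_smul, Real.norm_eq_abs, mul_assoc |α|]
  gcongr
  calc _ ≤ algConst L ^ 2 * (‖u - v‖ * R * R) + algConst L ^ 2 * (R * ‖u - v‖ * R) +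
        algConst L ^ 2 * (R * R * ‖u - v‖) :=
        (norm_add_le _ _).trans (add_le_add ((norm_add_le _ _).trans
          (add_le_add (h3 le_rfl hsu hu) (h3 hv hsw hu))) (h3 hv hsv le_rfl))
    _ = _ := by ring

end

section

variable {L : ℝ} [hL : Fact (0 < 2 * L)]

/-! ### Inner products and convergence in terms of Fourier coefficients -/

theorem L2.hasSum_inner (f g : L2 L) :
    HasSum (fun l => star (fc f l) * fc g l) (inner ℂ f g) := by
  have h := (fourierBasis (T := 2 * L)).hasSum_inner_mul_inner f g
  have e : ∀ (f : L2 L) l, inner ℂ (fourierBasis (T := 2 * L) l) f = fc f l := fun f l => by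
    rw [← HilbertBasis.repr_apply_apply, fourierBasis_repr]; rfl
  have e' : ∀ l, inner ℂ f (fourierBasis (T := 2 * L) l) = star (fc f l) := fun l => by
    rw [← e, ← inner_conj_symm]; rfl
  simp only [e, e'] at h
  exact h

theorem L2.hasSum_norm_sq (f : L2 L) : HasSum (fun l => ‖fc f l‖ ^ 2) (‖f‖ ^ 2) := by
  have : HasSum (fun i => ‖fourierBasis.repr f i‖ ^ 2) (‖fourierBasis.repr f‖ ^ 2) := by
    apply_mod_cast lp.hasSum_norm ?_ (fourierBasis.repr f)
    simp
  simp only [fourierBasis_repr, LinearIsometryEquiv.norm_map] at this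
  exact this

/-- The inner product of `L²(𝕋)`, with respect to the normalized measure, on `H¹(𝕋)`. -/
def ip (u v : H1 L) : ℂ := inner ℂ u.toL2 v.toL2

/-- The inner product of `H¹(𝕋)`. -/
def ipB (u v : H1 L) : ℂ := inner ℂ (besselL u) (besselL v)

theorem hasSum_ip (u v : H1 L) : HasSum (fun l => star (coef u l) * coef v l) (ip u v) :=
  L2.hasSum_inner _ _

theorem hasSum_ipB (u v : H1 L) :
    HasSum (fun l => (2 * L * (1 + freq L l ^ 2) : ℝ) * (star (coef u l) * coef v l))
      (ipB u v) := by
  have h := L2.hasSum_inner (besselL u) (besselL v)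
  refine h.congr_fun fun l => ?_
  have e : ((Real.sqrt (2 * L) : ℝ) : ℂ) ^ 2 = ((2 * L : ℝ) : ℂ) := by
    rw [← Complex.ofReal_pow, Real.sq_sqrt hL.out.le]
  rw [fc_besselL, fc_besselL, ← bracket_sq, Complex.ofReal_mul (2 * L), ← e]
  simp only [star_mul', Complex.star_def, Complex.conj_ofReal]
  push_cast
  ring

theorem ip_self (u : H1 L) : ip u u = (‖u.toL2‖ ^ 2 : ℝ) := by
  rw [ip, inner_self_eq_norm_sq_to_K]; norm_cast

theorem ipB_self (u : H1 L) : ipB u u = (‖u‖ ^ 2 : ℝ) := by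
  rw [ipB, inner_self_eq_norm_sq_to_K, LinearIsometry.norm_map]; norm_cast

theorem hasSum_norm_sq (u : H1 L) :
    HasSum (fun l => 2 * L * bracket L l ^ 2 * ‖coef u l‖ ^ 2) (‖u‖ ^ 2) := by
  have h := L2.hasSum_norm_sq (besselL u)
  rw [LinearIsometry.norm_map] at h
  convert h using 2 with l
  have := bracket_pos L l
  rw [fc_besselL, norm_mul, Complex.norm_real, Real.norm_of_nonneg (by positivity), mul_pow,
    mul_pow,
    Real.sq_sqrt hL.out.le]

theorem ip_conj_symm (u v : H1 L) : star (ip u v) = ip v u := inner_conj_symm _ _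

theorem ipB_conj_symm (u v : H1 L) : star (ipB u v) = ipB v u := inner_conj_symm _ _

theorem ip_eq_coef (u v : H1 L) : ip u v = coef (star u * v) 0 := by
  rw [ip, ← toLp_toC, ← toLp_toC, ContinuousMap.inner_toLp, ← fourierCoeff_toC, fourierCoeff,
    toC_mul, toC_star]
  congr 1
  funext x
  simp [mul_comm]

/-- Dominated convergence in `H¹(𝕋)`: coefficientwise convergence with a common bound. -/
theorem tendsto_of_coef {ι : Type*} {F : Filter ι} {f : ι → H1 L} {u v : H1 L}
    (hb : ∀ i k, ‖coef (f i) k‖ ≤ ‖coef v k‖)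
    (h : ∀ k, Filter.Tendsto (fun i => coef (f i) k) F (nhds (coef u k))) :
    Filter.Tendsto f F (nhds u) := by
  rcases F.eq_or_neBot with rfl | hF
  · exact Filter.tendsto_bot
  rw [tendsto_iff_norm_sub_tendsto_zero]
  have hu : ∀ k, ‖coef u k‖ ≤ ‖coef v k‖ := fun k =>
    le_of_tendsto (h k).norm (Filter.Eventually.of_forall fun i => hb i k)
  have hsub : ∀ i k, coef (f i - u) k = coef (f i) k - coef u k := fun i k =>
    (coefL k).map_sub (f i) u
  have h2 : Filter.Tendsto (fun i => ‖f i - u‖ ^ 2) F (nhds 0) := by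
    have := tendsto_tsum_of_dominated_convergence (𝓕 := F)
      (f := fun i l => 2 * L * bracket L l ^ 2 * ‖coef (f i - u) l‖ ^ 2) (g := fun _ => (0 : ℝ))
      (bound := fun l => 4 * (2 * L * bracket L l ^ 2 * ‖coef v l‖ ^ 2))
      ((hasSum_norm_sq v).summable.mul_left 4) (fun k => ?_) (Filter.Eventually.of_forall ?_)
    · simpa only [(hasSum_norm_sq _).tsum_eq, tsum_zero] using this
    · have h1 : Filter.Tendsto (fun i => ‖coef (f i - u) k‖) F (nhds 0) := by
        simpa only [hsub] using tendsto_iff_norm_sub_tendsto_zero.1 (h k)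
      simpa using (h1.pow 2).const_mul (2 * L * bracket L k ^ 2)
    · intro i k
      have h0 := hL.out
      have hn : ‖coef (f i - u) k‖ ≤ 2 * ‖coef v k‖ := by
        rw [hsub]
        refine (norm_sub_le _ _).trans ?_
        linarith [hb i k, hu k]
      rw [Real.norm_of_nonneg (by positivity)]
      calc 2 * L * bracket L k ^ 2 * ‖coef (f i - u) k‖ ^ 2
          ≤ 2 * L * bracket L k ^ 2 * (2 * ‖coef v k‖) ^ 2 := by gcongr
        _ = _ := by ring
  have h3 := h2.sqrt
  simpa [Real.sqrt_sq (norm_nonneg _)] using h3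

/-! ### The free Schrödinger group and the frequency cut-offs -/

theorem wl2_mul_le {m : ℤ → ℂ} (hm : ∀ l, ‖m l‖ = 1) (u : H1 L) :
    wl2 L (fun l => m l * coef u l) = wl2 L (coef u) := by
  rw [wl2, wl2]
  congr 1
  funext l
  rw [enorm_mul, ← ofReal_norm (m l), hm]
  simp

/-- The symbol of the free Schrödinger group. -/
def symb (L t : ℝ) (l : ℤ) : ℂ := Complex.exp ((-(freq L l ^ 2 / 2 * t) : ℝ) * Complex.I)

theorem norm_symb (L t : ℝ) (l : ℤ) : ‖symb L t l‖ = 1 := Complex.norm_exp_ofReal_mul_I _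

theorem symb_add (L s t : ℝ) (l : ℤ) : symb L (s + t) l = symb L s l * symb L t l := by
  rw [symb, symb, symb, ← Complex.exp_add]
  congr 1
  push_cast
  ring

theorem symb_zero (L : ℝ) (l : ℤ) : symb L 0 l = 1 := by simp [symb]

theorem symb_mul_symb_neg (L t : ℝ) (l : ℤ) : symb L t l * symb L (-t) l = 1 := by
  rw [← symb_add, add_neg_cancel, symb_zero]

theorem hasDerivAt_symb (L t : ℝ) (l : ℤ) :
    HasDerivAt (fun τ => symb L τ l) (-Complex.I * (freq L l ^ 2 / 2 : ℝ) * symb L t l) t := by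
  have h : HasDerivAt (fun τ : ℝ => ((-(freq L l ^ 2 / 2 * τ) : ℝ) : ℂ) * Complex.I)
      ((-(freq L l ^ 2 / 2) : ℝ) * Complex.I) t := by
    refine HasDerivAt.mul_const (HasDerivAt.ofReal_comp ?_) _
    simpa using ((hasDerivAt_id t).const_mul (freq L l ^ 2 / 2)).fun_neg
  refine HasDerivAt.congr_deriv (f := fun τ => symb L τ l) h.cexp ?_
  rw [show symb L t l = Complex.exp ((-(freq L l ^ 2 / 2 * t) : ℝ) * Complex.I) from rfl]
  push_cast
  ring

/-- The free Schrödinger group `exp (i t ∂ₓ² / 2)` on `H¹(𝕋)`. -/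
def schr (t : ℝ) : H1 L →ₗᵢ[ℂ] H1 L where
  toFun u := ofCoeff fun l => symb L t l * coef u l
  map_add' u v := H1.ext_coef fun l => by
    have h : ∀ w : H1 L, wl2 L (fun l => symb L t l * coef w l) < ∞ := fun w => by
      rw [wl2_mul_le (norm_symb L t)]; exact wl2_coef_lt_top w
    rw [coef_add, coef_ofCoeff (h _), coef_ofCoeff (h _), coef_ofCoeff (h _), coef_add, mul_add]
  map_smul' c u := H1.ext_coef fun l => by
    have h : ∀ w : H1 L, wl2 L (fun l => symb L t l * coef w l) < ∞ := fun w => by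
      rw [wl2_mul_le (norm_symb L t)]; exact wl2_coef_lt_top w
    rw [RingHom.id_apply, coef_smul, coef_ofCoeff (h _), coef_ofCoeff (h _), coef_smul]
    ring
  norm_map' u := by
    have h : ∀ w : H1 L, wl2 L (fun l => symb L t l * coef w l) < ∞ := fun w => by
      rw [wl2_mul_le (norm_symb L t)]; exact wl2_coef_lt_top w
    have : ‖(ofCoeff fun l => symb L t l * coef u l : H1 L)‖ₑ = ‖u‖ₑ := by
      rw [H1.enorm_eq, H1.enorm_eq, ← wl2_mul_le (norm_symb L t) u]
      congr 2
      funext l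
      exact coef_ofCoeff (h u) l
    simpa using congrArg ENNReal.toReal this

theorem coef_schr (t : ℝ) (u : H1 L) (l : ℤ) : coef (schr t u) l = symb L t l * coef u l :=
  coef_ofCoeff (c := fun l => symb L t l * coef u l)
    (by rw [wl2_mul_le (norm_symb L t)]; exact wl2_coef_lt_top u) l

theorem schr_schr (s t : ℝ) (u : H1 L) : schr s (schr t u) = schr (s + t) u :=
  H1.ext_coef fun l => by rw [coef_schr, coef_schr, coef_schr, symb_add, mul_assoc]

theorem schr_zero (u : H1 L) : schr 0 u = u :=
  H1.ext_coef fun l => by rw [coef_schr, symb_zero, one_mul]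

theorem schr_neg_cancel (t : ℝ) (u : H1 L) : schr (-t) (schr t u) = u := by
  rw [schr_schr, neg_add_cancel, schr_zero]

/-- Strong continuity of the free Schrödinger group. -/
theorem continuous_schr_left (u : H1 L) : Continuous fun t => schr t u := by
  refine continuous_iff_continuousAt.2 fun t => tendsto_of_coef (v := u) (fun s k => ?_) fun k => ?_
  · rw [coef_schr, norm_mul, norm_symb, one_mul]
  · simp only [coef_schr]
    exact (hasDerivAt_symb L t k).continuousAt.mul_const _

theorem continuous_schr : Continuous fun p : ℝ × H1 L => schr p.1 p.2 := by
  refine continuous_iff_continuousAt.2 fun ⟨t, u⟩ => ?_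
  have h1 : Filter.Tendsto (fun p : ℝ × H1 L => schr p.1 (p.2 - u)) (nhds (t, u)) (nhds 0) := by
    rw [tendsto_zero_iff_norm_tendsto_zero]
    simp only [LinearIsometry.norm_map]
    have : Continuous fun p : ℝ × H1 L => ‖p.2 - u‖ := (continuous_snd.sub continuous_const).norm
    simpa using this.tendsto (t, u)
  have h2 : Filter.Tendsto (fun p : ℝ × H1 L => schr p.1 u) (nhds (t, u)) (nhds (schr t u)) :=
    ((continuous_schr_left u).comp continuous_fst).tendsto (t, u)
  have := h1.add h2
  simp only [map_sub, sub_add_cancel, zero_add] at this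
  exact this

theorem ip_schr (t : ℝ) (u v : H1 L) : ip (schr t u) (schr t v) = ip u v := by
  refine (hasSum_ip _ _).unique ?_
  convert hasSum_ip u v using 2 with l
  have h := norm_symb L t l
  have h' : star (symb L t l) * symb L t l = 1 := by
    rw [Complex.star_def, Complex.conj_mul', h]; norm_num
  rw [coef_schr, coef_schr, star_mul']
  linear_combination (star (coef u l) * coef v l) * h'

theorem ipB_schr (t : ℝ) (u v : H1 L) : ipB (schr t u) (schr t v) = ipB u v := by
  refine (hasSum_ipB _ _).unique ?_
  convert hasSum_ipB u v using 2 with l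
  have h := norm_symb L t l
  have h' : star (symb L t l) * symb L t l = 1 := by
    rw [Complex.star_def, Complex.conj_mul', h]; norm_num
  rw [coef_schr, coef_schr, star_mul']
  linear_combination ((2 * L * (1 + freq L l ^ 2) : ℝ) * star (coef u l) * coef v l) * h'

/-- The mode `x ↦ exp (i π k x / L)`. -/
def mode (k : ℤ) : H1 L := ofCoeff fun l => if l = k then 1 else 0

theorem coef_mode (k l : ℤ) : coef (mode k : H1 L) l = if l = k then 1 else 0 := by
  refine coef_ofCoeff (c := fun l => if l = k then 1 else 0) ?_ l
  have : ∑' l, (ENNReal.ofReal (bracket L l) * ‖(if l = k then 1 else 0 : ℂ)‖ₑ) ^ 2 < ∞ := by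
    rw [tsum_eq_single k (by intro l hl; simp [hl])]
    simp
  exact ENNReal.rpow_lt_top_of_nonneg (by norm_num) this.ne

/-- The function with the Fourier coefficients `c l`, `|l| ≤ N`. -/
def trig (N : ℕ) (c : ℤ → ℂ) : H1 L := ∑ k ∈ Finset.Icc (-N : ℤ) N, c k • mode k

theorem coef_trig (N : ℕ) (c : ℤ → ℂ) (l : ℤ) :
    coef (trig N c : H1 L) l = if l ∈ Finset.Icc (-N : ℤ) N then c l else 0 := by
  have h := map_sum (coefL (L := L) l) (fun k => c k • mode k) (Finset.Icc (-N : ℤ) N)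
  rw [coefL_apply] at h
  rw [trig, h]
  simp only [coefL_apply, coef_smul, coef_mode, mul_ite, mul_one, mul_zero, Finset.sum_ite_eq]

theorem norm_coef_trig_le (N : ℕ) (c : ℤ → ℂ) (l : ℤ) :
    ‖coef (trig N c : H1 L) l‖ ≤ ‖c l‖ := by
  rw [coef_trig]
  split_ifs <;> simp

theorem norm_trig_le (N : ℕ) (u : H1 L) : ‖(trig N (coef u) : H1 L)‖ ≤ ‖u‖ := by
  have h0 := hL.out
  refine (pow_le_pow_iff_left₀ (norm_nonneg _) (norm_nonneg _) two_ne_zero).1 ?_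
  refine hasSum_le (fun l => ?_) (hasSum_norm_sq _) (hasSum_norm_sq u)
  gcongr
  exact norm_coef_trig_le N _ l

theorem tendsto_trig (u : H1 L) :
    Filter.Tendsto (fun N : ℕ => (trig N (coef u) : H1 L)) Filter.atTop (nhds u) := by
  refine tendsto_of_coef (v := u) (fun N k => norm_coef_trig_le N _ k) fun k => ?_
  refine tendsto_const_nhds.congr' ?_
  filter_upwards [Filter.eventually_ge_atTop k.natAbs] with N hN
  rw [coef_trig, if_pos]
  rw [Finset.mem_Icc]
  omega

end

section

variable {L : ℝ} [hL : Fact (0 < 2 * L)]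

/-! ### Mild solutions -/

/-- The time derivative of `exp (-i t ∂ₓ² / 2) u(t)` along a solution `u`. -/
def drift (α : ℝ) (V : H1 L) (u : ℝ → H1 L) (τ : ℝ) : H1 L :=
  schr (-τ) ((-Complex.I) • nonlin α V (u τ))

/-- The function `u₀ + ∫₀ᵗ drift`, which is `exp (-i t ∂ₓ² / 2) u(t)` for a mild solution `u`. -/
def profile (α : ℝ) (V u₀ : H1 L) (u : ℝ → H1 L) (t : ℝ) : H1 L :=
  u₀ + ∫ τ in 0..t, drift α V u τ

/-- Mild solutions on `[0, T]`: Duhamel's formula holds there. It is convenient to have `u`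
continuous on all of `ℝ`; nothing is required of its values outside `[0, T]`. -/
structure IsMild (α : ℝ) (V u₀ : H1 L) (T : ℝ) (u : ℝ → H1 L) : Prop where
  cont : Continuous u
  eq : ∀ t ∈ Icc 0 T, u t = schr t (profile α V u₀ u t)

variable {α : ℝ} {V u₀ : H1 L} {u w : ℝ → H1 L} {T : ℝ}

theorem continuous_drift (α : ℝ) (V : H1 L) (hu : Continuous u) :
    Continuous (drift α V u) := by
  have h : Continuous fun τ => (-Complex.I) • nonlin α V (u τ) :=
    (((continuous_nonlin α V).comp hu).const_smul (-Complex.I) :)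
  exact continuous_schr.comp (continuous_neg.prodMk h)

theorem hasDerivAt_profile (α : ℝ) (V u₀ : H1 L) (hu : Continuous u) (t : ℝ) :
    HasDerivAt (profile α V u₀ u) (drift α V u t) t :=
  ((continuous_drift α V hu).integral_hasStrictDerivAt 0 t).hasDerivAt.const_add u₀

theorem continuous_profile (α : ℝ) (V u₀ : H1 L) (hu : Continuous u) :
    Continuous (profile α V u₀ u) :=
  continuous_iff_continuousAt.2 fun t => (hasDerivAt_profile α V u₀ hu t).continuousAt

theorem profile_zero (α : ℝ) (V u₀ : H1 L) (u : ℝ → H1 L) : profile α V u₀ u 0 = u₀ := by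
  simp [profile]

theorem norm_drift_sub (α : ℝ) (V : H1 L) (u w : ℝ → H1 L) (t : ℝ) :
    ‖drift α V u t - drift α V w t‖ = ‖nonlin α V (u t) - nonlin α V (w t)‖ := by
  rw [drift, drift, ← map_sub, ← smul_sub, LinearIsometry.norm_map, norm_smul]; simp

theorem IsMild.mono {T' : ℝ} (h : IsMild α V u₀ T u) (hT : T' ≤ T) : IsMild α V u₀ T' u :=
  ⟨h.cont, fun t ht => h.eq t ⟨ht.1, ht.2.trans hT⟩⟩

theorem IsMild.norm_eq (h : IsMild α V u₀ T u) {t : ℝ} (ht : t ∈ Icc 0 T) :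
    ‖u t‖ = ‖profile α V u₀ u t‖ := by
  rw [h.eq t ht, LinearIsometry.norm_map]

theorem exists_bound_Icc (hu : Continuous u) (T : ℝ) : ∃ R, 0 ≤ R ∧ ∀ t ∈ Icc 0 T, ‖u t‖ ≤ R := by
  obtain ⟨R, hR⟩ := (isCompact_Icc (a := (0 : ℝ)) (b := T)).exists_bound_of_continuousOn
    hu.continuousOn
  exact ⟨max R 0, le_max_right _ _, fun t ht => (hR t ht).trans (le_max_left _ _)⟩

theorem IsMild.unique (hu : IsMild α V u₀ T u) (hw : IsMild α V u₀ T w) :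
    EqOn u w (Icc 0 T) := by
  obtain ⟨R₁, h0, hR₁⟩ := exists_bound_Icc hu.cont T
  obtain ⟨R₂, -, hR₂⟩ := exists_bound_Icc hw.cont T
  have key := eq_zero_of_abs_deriv_le_mul_abs_self_of_eq_zero_right
    (f := fun t => profile α V u₀ u t - profile α V u₀ w t)
    (f' := fun t => drift α V u t - drift α V w t)
    (K := algConst L * ‖V‖ + |α| * (3 * (algConst L ^ 2 * (max R₁ R₂) ^ 2))) (a := 0) (b := T)
    ((continuous_profile _ _ _ hu.cont).sub (continuous_profile _ _ _ hw.cont)).continuousOn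
    (fun t _ => ((hasDerivAt_profile _ _ _ hu.cont t).sub
      (hasDerivAt_profile _ _ _ hw.cont t)).hasDerivWithinAt)
    (by simp [profile_zero]) (fun t ht => ?_)
  · intro t ht
    rw [hu.eq t ht, hw.eq t ht, sub_eq_zero.1 (key t ht)]
  · have ht' : t ∈ Icc 0 T := ⟨ht.1, ht.2.le⟩
    rw [norm_drift_sub]
    refine (norm_nonlin_sub_le α V _ _ ((hR₁ t ht').trans (le_max_left _ _))
      ((hR₂ t ht').trans (le_max_right _ _))).trans (le_of_eq ?_)
    rw [hu.eq t ht', hw.eq t ht', ← map_sub, LinearIsometry.norm_map]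

theorem coef_drift (α : ℝ) (V : H1 L) (u : ℝ → H1 L) (t : ℝ) (l : ℤ) :
    coef (drift α V u t) l = symb L (-t) l * (-Complex.I * coef (nonlin α V (u t)) l) := by
  rw [drift, coef_schr, coef_smul]

theorem coef_profile (α : ℝ) (V u₀ : H1 L) (hu : Continuous u) (t : ℝ) (l : ℤ) :
    coef (profile α V u₀ u t) l = coef u₀ l + ∫ τ in 0..t, coef (drift α V u τ) l := by
  rw [profile, coef_add]
  congr 1
  exact ((coefL l).intervalIntegral_comp_comm
    ((continuous_drift α V hu).intervalIntegrable 0 t)).symm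

/-- A solution in the sense of distributions is a mild solution. -/
theorem isMild_of_isNLSSolution (h : IsNLSSolution α V.toL2 u₀.toL2 w) (T : ℝ) :
    IsMild α V u₀ T fun t => w (max t 0) := by
  have hc : Continuous fun t => w (max t 0) := by
    refine h.continuousOn.comp_continuous (f := fun t : ℝ => max t 0)
      (continuous_id.max continuous_const) fun t => ?_
    exact le_max_right t 0
  refine ⟨hc, fun t ht => H1.ext_coef fun l => ?_⟩
  have hd : ∀ τ ∈ Ioo 0 t, HasDerivAt (fun τ => symb L (-τ) l * coef (w τ) l)
      (coef (drift α V (fun t => w (max t 0)) τ) l) τ := by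
    intro τ hτ
    obtain ⟨d, hd, he⟩ := h.equation τ hτ.1 l
    rw [fc_equation_eq] at he
    have h1 := (hasDerivAt_symb L (-τ) l).scomp τ (hasDerivAt_neg τ)
    refine (h1.mul hd).congr_deriv ?_
    have h2 : d = -Complex.I * ((freq L l ^ 2 / 2 : ℝ) * fc (w τ).toL2 l +
        coef (nonlin α V (w τ)) l) := by
      rw [← he, ← mul_assoc]; simp
    rw [coef_drift, h2, max_eq_left hτ.1.le]
    simp only [neg_smul, one_smul, Function.comp]
    ring
  have hcc : ContinuousOn (fun τ => symb L (-τ) l * coef (w τ) l) (Icc 0 t) := by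
    have h1 : Continuous fun τ => symb L τ l :=
      continuous_iff_continuousAt.2 fun t => (hasDerivAt_symb L t l).continuousAt
    refine (h1.comp continuous_neg).continuousOn.mul ?_
    exact (coefL l).continuous.comp_continuousOn
      (h.continuousOn.mono fun x hx => hx.1)
  have hint := intervalIntegral.integral_eq_sub_of_hasDerivAt_of_le ht.1 hcc hd
    (((coefL l).continuous.comp (continuous_drift α V hc)).intervalIntegrable 0 t)
  have h0 : coef (w 0) l = coef u₀ l := by rw [coef, h.initial]; rfl
  rw [coef_schr, coef_profile _ _ _ hc, hint, neg_zero, symb_zero, one_mul, h0, add_sub_cancel,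
    ← mul_assoc, symb_mul_symb_neg, one_mul, max_eq_left ht.1]

/-- A mild solution is a solution in the sense of distributions. -/
theorem isNLSSolution_of_isMild (h : ∀ T, IsMild α V u₀ T u) :
    IsNLSSolution α V.toL2 u₀.toL2 u := by
  have hc := (h 0).cont
  refine ⟨hc.continuousOn, ?_, fun t ht l => ?_⟩
  · rw [(h 0).eq 0 ⟨le_rfl, le_rfl⟩, profile_zero, schr_zero]
  · rw [fc_equation_eq]
    have h1 : HasDerivAt (fun τ => symb L τ l * coef (profile α V u₀ u τ) l)
        (-Complex.I * (freq L l ^ 2 / 2 : ℝ) * symb L t l * coef (profile α V u₀ u t) l +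
          symb L t l * coef (drift α V u t) l) t :=
      (hasDerivAt_symb L t l).mul
        ((coefL l).hasFDerivAt.comp_hasDerivAt t (hasDerivAt_profile α V u₀ hc t))
    have h2 : (fun τ => fc (u τ).toL2 l) =ᶠ[nhds t]
        fun τ => symb L τ l * coef (profile α V u₀ u τ) l := by
      filter_upwards [lt_mem_nhds ht] with τ hτ
      have := (h τ).eq τ ⟨hτ.le, le_rfl⟩
      rw [← coef_schr, ← this]; rfl
    refine ⟨_, h1.congr_of_eventuallyEq h2, ?_⟩
    have h3 : fc (u t).toL2 l = symb L t l * coef (profile α V u₀ u t) l := h2.self_of_nhds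
    rw [coef_drift, h3, mul_add, ← mul_assoc (symb L t l), symb_mul_symb_neg]
    linear_combination (-(freq L l ^ 2 / 2 : ℝ) * symb L t l * coef (profile α V u₀ u t) l -
      coef (nonlin α V (u t)) l) * Complex.I_mul_I

end

section

variable {L : ℝ} [hL : Fact (0 < 2 * L)]

/-! ### Conservation of mass and energy -/

theorem enorm_toL2_le (u : H1 L) : ENNReal.ofReal (Real.sqrt (2 * L)) * ‖u.toL2‖ₑ ≤ ‖u‖ₑ := by
  rw [H1.enorm_eq, L2.enorm_eq]
  gcongr
  refine l2norm_mono fun l => le_mul_of_one_le_left zero_le ?_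
  exact ENNReal.one_le_ofReal.2 (one_le_bracket L l)

theorem norm_toL2_le (u : H1 L) : ‖u.toL2‖ ≤ (Real.sqrt (2 * L))⁻¹ * ‖u‖ := by
  have hs := sqrt_two_mul_pos (L := L)
  have h := enorm_toL2_le u
  rw [← ofReal_norm, ← ofReal_norm, ← ENNReal.ofReal_mul hs.le,
    ENNReal.ofReal_le_ofReal_iff (norm_nonneg _)] at h
  rw [← div_eq_inv_mul, le_div_iff₀ hs]
  linarith

/-- The embedding of `H¹(𝕋)` into `L²(𝕋)` as a continuous linear map. -/
def toL2L : H1 L →L[ℂ] L2 L := LinearMap.mkContinuous H1.toL2 (Real.sqrt (2 * L))⁻¹ norm_toL2_le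

theorem norm_ip_le (u v : H1 L) : ‖ip u v‖ ≤ (2 * L)⁻¹ * (‖u‖ * ‖v‖) := by
  have hs := sqrt_two_mul_pos (L := L)
  calc ‖ip u v‖ ≤ ‖u.toL2‖ * ‖v.toL2‖ := norm_inner_le_norm _ _
    _ ≤ ((Real.sqrt (2 * L))⁻¹ * ‖u‖) * ((Real.sqrt (2 * L))⁻¹ * ‖v‖) := by
        gcongr <;> exact norm_toL2_le _
    _ = ((Real.sqrt (2 * L)) ^ 2)⁻¹ * (‖u‖ * ‖v‖) := by ring
    _ = _ := by rw [Real.sq_sqrt hL.out.le]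

theorem norm_ipB_le (u v : H1 L) : ‖ipB u v‖ ≤ ‖u‖ * ‖v‖ := by
  refine (norm_inner_le_norm (𝕜 := ℂ) (besselL u) (besselL v)).trans (le_of_eq ?_)
  rw [LinearIsometry.norm_map, LinearIsometry.norm_map]

theorem _root_.HasDerivAt.ip {f g : ℝ → H1 L} {f' g' : H1 L} {t : ℝ} (hf : HasDerivAt f f' t)
    (hg : HasDerivAt g g' t) :
    HasDerivAt (fun τ => QmcNLS.ip (f τ) (g τ))
      (QmcNLS.ip (f t) g' + QmcNLS.ip f' (g t)) t :=
  HasDerivAt.inner ℂ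
    ((toL2L.restrictScalars ℝ).hasFDerivAt.comp_hasDerivAt t hf)
    ((toL2L.restrictScalars ℝ).hasFDerivAt.comp_hasDerivAt t hg)

theorem _root_.HasDerivAt.ipB {f g : ℝ → H1 L} {f' g' : H1 L} {t : ℝ} (hf : HasDerivAt f f' t)
    (hg : HasDerivAt g g' t) :
    HasDerivAt (fun τ => QmcNLS.ipB (f τ) (g τ))
      (QmcNLS.ipB (f t) g' + QmcNLS.ipB f' (g t)) t :=
  HasDerivAt.inner ℂ
    ((besselL.toContinuousLinearMap.restrictScalars ℝ).hasFDerivAt.comp_hasDerivAt t hf)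
    ((besselL.toContinuousLinearMap.restrictScalars ℝ).hasFDerivAt.comp_hasDerivAt t hg)

theorem _root_.HasDerivAt.mul_h1 {f g : ℝ → H1 L} {f' g' : H1 L} {t : ℝ} (hf : HasDerivAt f f' t)
    (hg : HasDerivAt g g' t) :
    HasDerivAt (fun τ => f τ * g τ) (f t * g' + f' * g t) t :=
  mulL.hasDerivAt_of_bilinear (fun _ => hf) (fun _ => hg)

theorem _root_.HasDerivAt.star_h1 {f : ℝ → H1 L} {f' : H1 L} {t : ℝ} (hf : HasDerivAt f f' t) :
    HasDerivAt (fun τ => star (f τ)) (star f') t :=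
  starL.toContinuousLinearMap.hasFDerivAt.comp_hasDerivAt t hf

theorem ip_smul_right (c : ℂ) (u v : H1 L) : ip u (c • v) = c * ip u v := by
  rw [ip, map_smul, inner_smul_right]; rfl

theorem ip_smul_left (c : ℂ) (u v : H1 L) : ip (c • u) v = star c * ip u v := by
  rw [ip, map_smul, inner_smul_left]; rfl

theorem ipB_smul_right (c : ℂ) (u v : H1 L) : ipB u (c • v) = c * ipB u v := by
  rw [ipB, map_smul, inner_smul_right]; rfl

theorem ipB_smul_left (c : ℂ) (u v : H1 L) : ipB (c • u) v = star c * ipB u v := by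
  rw [ipB, map_smul, inner_smul_left]; rfl

theorem conj_toC_of_star_eq {V : H1 L} (hV : star V = V) (x : AddCircle (2 * L)) :
    starRingEnd ℂ (toC V x) = toC V x := by
  conv_rhs => rw [← hV, toC_star]
  rfl

/-- For a real potential, the nonlinearity pairs with `u` to a real number. -/
theorem im_ip_nonlin (α : ℝ) {V : H1 L} (hV : star V = V) (u : H1 L) :
    (ip u (nonlin α V u)).im = 0 := by
  have h : star (star u * nonlin α V u) = star u * nonlin α V u := by
    refine toC_injective (ContinuousMap.ext fun x => ?_)
    simp only [toC_star, toC_mul, nonlin, toC_add, toC_real_smul, ContinuousMap.star_apply,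
      ContinuousMap.mul_apply, ContinuousMap.add_apply, ContinuousMap.smul_apply, smul_eq_mul,
      Complex.star_def, map_mul, map_add, Complex.conj_ofReal, Complex.conj_conj,
      conj_toC_of_star_eq hV]
    ring
  have h2 : star (ip u (nonlin α V u)) = ip u (nonlin α V u) := by
    rw [ip_eq_coef]
    conv_rhs => rw [← h]
    rw [coef_star, neg_zero]
  exact Complex.conj_eq_iff_im.1 h2

/-- The potential part `∫ V |u|² + (α / 2) |u|⁴` of the energy. -/
def potEnergy (α : ℝ) (V u : H1 L) : ℝ :=
  (coef (V * (u * star u) + (α / 2) • ((u * star u) * (u * star u))) 0).re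

theorem continuous_potEnergy (α : ℝ) (V : H1 L) : Continuous (potEnergy α V) := by
  have h2 : Continuous fun u : H1 L => u * star u := continuous_id.mul continuous_id.star
  have h3 : Continuous fun u : H1 L => V * (u * star u) := continuous_const.mul h2
  exact Complex.continuous_re.comp
    ((coefL 0).continuous.comp (h3.add ((h2.mul h2).const_smul (α / 2))))

/-- The gradient of the potential energy is twice the nonlinearity. -/
theorem hasDerivAt_potEnergy (α : ℝ) {V : H1 L} (hV : star V = V) {c : ℝ → H1 L} {c' : H1 L}
    {t : ℝ} (hc : HasDerivAt c c' t) :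
    HasDerivAt (fun τ => potEnergy α V (c τ)) (2 * (ip (nonlin α V (c t)) c').re) t := by
  have hm := hc.mul_h1 hc.star_h1
  have h1 := ((hasDerivAt_const t V).mul_h1 hm).add ((hm.mul_h1 hm).const_smul (α / 2))
  have h2 : HasDerivAt (fun τ => potEnergy α V (c τ)) _ t :=
    Complex.reCLM.hasFDerivAt.comp_hasDerivAt t ((coefL 0).hasFDerivAt.comp_hasDerivAt t h1)
  refine h2.congr_deriv ?_
  set F := nonlin α V (c t) with hF
  have key : V * (c t * star c' + c' * star (c t)) + 0 * (c t * star (c t)) +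
      (α / 2) • (c t * star (c t) * (c t * star c' + c' * star (c t)) +
        (c t * star c' + c' * star (c t)) * (c t * star (c t))) =
      star F * c' + star (star F * c') := by
    have h0 : toC (0 : H1 L) = 0 := by simpa using toC_smul (0 : ℂ) (0 : H1 L)
    refine toC_injective (ContinuousMap.ext fun x => ?_)
    simp only [hF, toC_star, toC_mul, nonlin, toC_add, toC_real_smul, ContinuousMap.star_apply,
      ContinuousMap.mul_apply, ContinuousMap.add_apply, ContinuousMap.smul_apply, smul_eq_mul,
      Complex.star_def, map_mul, map_add, Complex.conj_ofReal, Complex.conj_conj, h0,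
      ContinuousMap.zero_apply, conj_toC_of_star_eq hV]
    push_cast
    ring
  rw [key, coefL_apply, coef_add, coef_star, ip_eq_coef]
  simp
  ring

theorem continuous_trig (N : ℕ) {f : ℝ → H1 L} (hf : Continuous f) :
    Continuous fun t => (trig N (coef (f t)) : H1 L) :=
  continuous_finsetSum _ fun k _ => ((coefL k).continuous.comp hf).smul continuous_const

/-- The pairing with the truncated right-hand side of the equation, in terms of the inner products
of `L²` and `H¹`. -/
theorem ip_trig_rhs (N : ℕ) (f u F : H1 L) :
    ip f (trig N fun l => -Complex.I * ((freq L l ^ 2 / 2 : ℝ) * coef u l + coef F l)) =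
      -Complex.I * (((4 * L : ℝ) : ℂ)⁻¹ * ipB f (trig N (coef u)) -
        2⁻¹ * ip f (trig N (coef u)) + ip f (trig N (coef F))) := by
  have hL0 : (L : ℂ) ≠ 0 := by exact_mod_cast (pos_of_fact (L := L)).ne'
  refine (hasSum_ip _ _).unique ?_
  have h := ((((hasSum_ipB f (trig N (coef u))).mul_left (((4 * L : ℝ) : ℂ)⁻¹)).sub
    ((hasSum_ip f (trig N (coef u))).mul_left (2⁻¹ : ℂ))).add
    (hasSum_ip f (trig N (coef F)))).mul_left (-Complex.I)
  refine h.congr_fun fun l => ?_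
  simp only [coef_trig]
  split_ifs
  · push_cast
    field_simp
    ring
  · simp

variable {α : ℝ} {V u₀ : H1 L} {u w : ℝ → H1 L} {T : ℝ}

/-- Conservation of mass. -/
theorem IsMild.norm_toL2_eq (hV : star V = V) (h : IsMild α V u₀ T u) {t : ℝ} (ht : t ∈ Icc 0 T) :
    ‖(u t).toL2‖ = ‖u₀.toL2‖ := by
  have key := constant_of_has_deriv_right_zero
    (f := fun t => ip (profile α V u₀ u t) (profile α V u₀ u t)) (a := 0) (b := T)
    (continuous_iff_continuousAt.2 fun t => ((hasDerivAt_profile α V u₀ h.cont t).ip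
      (hasDerivAt_profile α V u₀ h.cont t)).continuousAt).continuousOn
    (fun t ht => by
      refine (((hasDerivAt_profile α V u₀ h.cont t).ip
        (hasDerivAt_profile α V u₀ h.cont t)).congr_deriv ?_).hasDerivWithinAt
      have hp : profile α V u₀ u t = schr (-t) (u t) := by
        rw [h.eq t ⟨ht.1, ht.2.le⟩, schr_neg_cancel]
      rw [hp, drift, ip_schr, ip_schr, ip_smul_right, ip_smul_left,
        ← ip_conj_symm (u t) (nonlin α V (u t))]
      apply Complex.ext <;> simp [im_ip_nonlin α hV])
  have h1 : ip (u t) (u t) = ip u₀ u₀ := by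
    have := key t ht
    simp only [profile_zero] at this
    rw [h.eq t ht, ip_schr, this]
  rw [ip_self, ip_self] at h1
  have h2 : ‖(u t).toL2‖ ^ 2 = ‖u₀.toL2‖ ^ 2 := by exact_mod_cast h1
  exact (pow_left_inj₀ (norm_nonneg _) (norm_nonneg _) two_ne_zero).1 h2

/-- Conservation of energy. A mild solution has no time derivative in `H¹`, but the kinetic part is
a norm of the profile, which does; in the potential part the solution is truncated to the
frequencies `|l| ≤ N`, and the error made in this way tends to `0` as `N → ∞`. -/
theorem IsMild.energy_eq (hV : star V = V) (h : IsMild α V u₀ T u) {t : ℝ} (ht : t ∈ Icc 0 T) :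
    ‖u t‖ ^ 2 / (4 * L) + potEnergy α V (u t) = ‖u₀‖ ^ 2 / (4 * L) + potEnergy α V u₀ := by
  have hL0 := pos_of_fact (L := L)
  have hc := h.cont
  set p := profile α V u₀ u with hp
  set F : ℝ → H1 L := fun τ => nonlin α V (u τ) with hF
  have hFc : Continuous F := (continuous_nonlin α V).comp hc
  set c : ℕ → ℝ → H1 L := fun N τ => trig N (coef (u τ)) with hcdef
  have hcc : ∀ N, Continuous (c N) := fun N => continuous_trig N hc
  -- The derivative of the energy in which the potential part is frequency-truncated.
  set r : ℕ → ℝ → ℝ := fun N τ => ((ipB (u τ) (F τ)).im +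
    (ipB (nonlin α V (c N τ)) (c N τ)).im) / (2 * L) +
    2 * (ip (nonlin α V (c N τ)) (trig N (coef (F τ)))).im with hr
  have hrc : ∀ N, Continuous (r N) := by
    intro N
    have hn : Continuous fun τ => nonlin α V (c N τ) := (continuous_nonlin α V).comp (hcc N)
    have hB : ∀ {f g : ℝ → H1 L}, Continuous f → Continuous g →
        Continuous fun τ => (ipB (f τ) (g τ)).im := fun hf hg =>
      Complex.continuous_im.comp ((besselL.continuous.comp hf).inner (besselL.continuous.comp hg))
    have hI : ∀ {f g : ℝ → H1 L}, Continuous f → Continuous g →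
        Continuous fun τ => (ip (f τ) (g τ)).im := fun hf hg =>
      Complex.continuous_im.comp ((toL2L.continuous.comp hf).inner (toL2L.continuous.comp hg))
    exact (((hB hc hFc).add (hB hn (hcc N))).div_const _).add
      ((hI hn (continuous_trig N hFc)).const_mul 2)
  have hpu : ∀ τ ∈ Icc 0 T, schr τ (p τ) = u τ := fun τ hτ => (h.eq τ hτ).symm
  have hpu' : ∀ τ ∈ Icc 0 T, p τ = schr (-τ) (u τ) := fun τ hτ => by
    rw [h.eq τ hτ, schr_neg_cancel]
  have hkin : ∀ τ ∈ Icc 0 T, HasDerivAt (fun τ => ‖p τ‖ ^ 2 / (4 * L))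
      ((ipB (u τ) (F τ)).im / (2 * L)) τ := by
    intro τ hτ
    have h1 := (hasDerivAt_profile α V u₀ hc τ).ipB (hasDerivAt_profile α V u₀ hc τ)
    have h2 : HasDerivAt (fun τ => (ipB (p τ) (p τ)).re) _ τ :=
      Complex.reCLM.hasFDerivAt.comp_hasDerivAt τ h1
    have h3 : (fun τ => (ipB (p τ) (p τ)).re) = fun τ => ‖p τ‖ ^ 2 := by
      funext τ
      rw [ipB_self, Complex.ofReal_re]
    rw [h3] at h2
    refine (h2.div_const (4 * L)).congr_deriv ?_
    rw [← hp, hpu' τ hτ, drift, ipB_schr, ipB_schr, ipB_smul_right, ipB_smul_left,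
      ← ipB_conj_symm (u τ) (nonlin α V (u τ))]
    simp
    field_simp
    ring
  have hpot : ∀ N, ∀ τ ∈ Icc 0 T,
      HasDerivAt (fun τ => potEnergy α V (trig N (coef (schr τ (p τ)))))
        ((ipB (nonlin α V (c N τ)) (c N τ)).im / (2 * L) +
          2 * (ip (nonlin α V (c N τ)) (trig N (coef (F τ)))).im) τ := by
    intro N τ hτ
    have h1 : ∀ k, HasDerivAt (fun τ => coef (schr τ (p τ)) k)
        (-Complex.I * ((freq L k ^ 2 / 2 : ℝ) * coef (u τ) k + coef (F τ) k)) τ := by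
      intro k
      simp only [coef_schr]
      have h2 := (hasDerivAt_symb L τ k).mul
        ((coefL k).hasFDerivAt.comp_hasDerivAt τ (hasDerivAt_profile α V u₀ hc τ))
      refine h2.congr_deriv ?_
      simp only [coefL_apply, Function.comp]
      rw [← hpu τ hτ, coef_schr, coef_drift]
      linear_combination (-Complex.I * coef (F τ) k) * symb_mul_symb_neg L τ k
    have h3 : HasDerivAt (fun τ => (trig N (coef (schr τ (p τ))) : H1 L))
        (trig N fun l =>
          -Complex.I * ((freq L l ^ 2 / 2 : ℝ) * coef (u τ) l + coef (F τ) l)) τ := by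
      simp only [trig]
      exact HasDerivAt.fun_sum fun k _ => (h1 k).smul_const _
    refine (hasDerivAt_potEnergy α hV h3).congr_deriv ?_
    rw [hpu τ hτ, ip_trig_rhs, ← ip_conj_symm (trig N (coef (u τ)))]
    have h4 := im_ip_nonlin α hV (trig N (coef (u τ)) : H1 L)
    simp only [Complex.mul_re, Complex.neg_re, Complex.I_re, Complex.neg_im, Complex.I_im,
      Complex.add_im, Complex.sub_im, Complex.mul_im, ← Complex.ofReal_inv, Complex.ofReal_re,
      Complex.ofReal_im, Complex.star_def, Complex.conj_im, Complex.conj_re, h4, hcdef]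
    norm_num
    field_simp
    ring
  set E : ℕ → ℝ → ℝ := fun N τ =>
    ‖p τ‖ ^ 2 / (4 * L) + potEnergy α V (trig N (coef (schr τ (p τ)))) with hE
  have hint : ∀ N, ∫ τ in 0..t, r N τ = E N t - E N 0 := by
    intro N
    refine intervalIntegral.integral_eq_sub_of_hasDerivAt (fun τ hτ => ?_)
      ((hrc N).intervalIntegrable 0 t)
    rw [uIcc_of_le ht.1] at hτ
    have hτ' : τ ∈ Icc 0 T := ⟨hτ.1, hτ.2.trans ht.2⟩
    refine ((hkin τ hτ').add (hpot N τ hτ')).congr_deriv ?_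
    rw [hr]
    ring
  obtain ⟨R, hR0, hR⟩ := exists_bound_Icc hc T
  have hK := algConst_pos (L := L)
  set M := algConst L * ‖V‖ * R + |α| * (algConst L ^ 2 * R ^ 3) with hM
  have hnl : ∀ v : H1 L, ‖v‖ ≤ R → ‖nonlin α V v‖ ≤ M := fun v hv =>
    (norm_nonlin_le α V v).trans (by rw [hM]; gcongr)
  have hM0 : 0 ≤ M := by positivity
  have hlim0 : Filter.Tendsto (fun N => ∫ τ in 0..t, r N τ) Filter.atTop
      (nhds (∫ τ in 0..t, (0 : ℝ))) := by
    refine intervalIntegral.tendsto_integral_filter_of_dominated_convergence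
      (fun _ => (R * M + M * R) / (2 * L) + 2 * ((2 * L)⁻¹ * (M * M)))
      (Filter.Eventually.of_forall fun N => (hrc N).aestronglyMeasurable)
      (Filter.Eventually.of_forall fun N => Filter.Eventually.of_forall fun τ hτ => ?_)
      intervalIntegrable_const (Filter.Eventually.of_forall fun τ hτ => ?_)
    · rw [uIoc_of_le ht.1] at hτ
      have hu := hR τ ⟨hτ.1.le, hτ.2.trans ht.2⟩
      have hcu : ‖c N τ‖ ≤ R := (norm_trig_le N (u τ)).trans hu
      have h1 : |(ipB (u τ) (F τ)).im| ≤ R * M :=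
        (Complex.abs_im_le_norm _).trans ((norm_ipB_le _ _).trans
          (mul_le_mul hu (hnl _ hu) (norm_nonneg _) hR0))
      have h2 : |(ipB (nonlin α V (c N τ)) (c N τ)).im| ≤ M * R :=
        (Complex.abs_im_le_norm _).trans ((norm_ipB_le _ _).trans
          (mul_le_mul (hnl _ hcu) hcu (norm_nonneg _) hM0))
      have h3 : |(ip (nonlin α V (c N τ)) (trig N (coef (F τ)))).im| ≤ (2 * L)⁻¹ * (M * M) :=
        (Complex.abs_im_le_norm _).trans ((norm_ip_le _ _).trans (by
          gcongr
          · exact hnl _ hcu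
          · exact (norm_trig_le N (F τ)).trans (hnl _ hu)))
      rw [Real.norm_eq_abs, hr]
      refine (abs_add_le _ _).trans (add_le_add ?_ ?_)
      · rw [abs_div, abs_of_pos hL.out]
        gcongr
        exact (abs_add_le _ _).trans (add_le_add h1 h2)
      · rw [abs_mul, abs_two]
        gcongr
    · have hcN : Filter.Tendsto (fun N => c N τ) Filter.atTop (nhds (u τ)) := tendsto_trig (u τ)
      have hFN : Filter.Tendsto (fun N => nonlin α V (c N τ)) Filter.atTop (nhds (F τ)) :=
        ((continuous_nonlin α V).tendsto (u τ)).comp hcN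
      have hPF : Filter.Tendsto (fun N => (trig N (coef (F τ)) : H1 L)) Filter.atTop
          (nhds (F τ)) := tendsto_trig (F τ)
      have h1 : Filter.Tendsto (fun N => (ipB (nonlin α V (c N τ)) (c N τ)).im) Filter.atTop
          (nhds (ipB (F τ) (u τ)).im) :=
        (Complex.continuous_im.tendsto _).comp
          (((besselL.continuous.tendsto _).comp hFN).inner
            ((besselL.continuous.tendsto _).comp hcN))
      have h2 : Filter.Tendsto (fun N => (ip (nonlin α V (c N τ)) (trig N (coef (F τ)))).im)
          Filter.atTop (nhds (ip (F τ) (F τ)).im) :=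
        (Complex.continuous_im.tendsto _).comp
          (((toL2L.continuous.tendsto _).comp hFN).inner ((toL2L.continuous.tendsto _).comp hPF))
      have h3 := ((h1.const_add (ipB (u τ) (F τ)).im).div_const (2 * L)).add (h2.const_mul 2)
      have h4 : ((ipB (u τ) (F τ)).im + (ipB (F τ) (u τ)).im) / (2 * L) +
          2 * (ip (F τ) (F τ)).im = 0 := by
        rw [← ipB_conj_symm (F τ) (u τ), ip_self, Complex.ofReal_im, Complex.star_def,
          Complex.conj_im]
        simp
      rw [h4] at h3
      exact h3
  have hE' : ∀ τ ∈ Icc 0 T, Filter.Tendsto (fun N => E N τ) Filter.atTop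
      (nhds (‖u τ‖ ^ 2 / (4 * L) + potEnergy α V (u τ))) := by
    intro τ hτ
    simp only [hE, hpu τ hτ]
    rw [h.norm_eq hτ]
    exact (((continuous_potEnergy α V).tendsto _).comp (tendsto_trig (u τ))).const_add _
  have h0 : (0 : ℝ) ∈ Icc 0 T := ⟨le_rfl, ht.1.trans ht.2⟩
  have hu0 : u 0 = u₀ := by rw [h.eq 0 h0, profile_zero, schr_zero]
  have hlim1 := (hE' t ht).sub (hE' 0 h0)
  simp only [← hint, hu0] at hlim1
  have := tendsto_nhds_unique hlim1 hlim0
  rw [intervalIntegral.integral_zero] at this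
  linarith

end

section

variable {L : ℝ} [hL : Fact (0 < 2 * L)]

/-! ### The a priori bound in `H¹` -/

theorem enorm_toL2_mul_le (u v : H1 L) : ‖(u * v).toL2‖ₑ ≤ l1norm u * ‖v.toL2‖ₑ := by
  rw [L2.enorm_eq, L2.enorm_eq]
  refine (l2norm_mono fun l => ?_).trans
    (l2norm_conv_le (fun k => ‖coef u k‖ₑ) (fun k => ‖coef v k‖ₑ))
  have := enorm_fcC_mul_le u v l
  rwa [← coef_mul] at this

theorem norm_toL2_mul_le (u v : H1 L) :
    ‖(u * v).toL2‖ ≤ (l1norm u).toReal * ‖v.toL2‖ := by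
  have h := ENNReal.toReal_mono (ENNReal.mul_lt_top (l1norm_lt_top u) enorm_lt_top).ne
    (enorm_toL2_mul_le u v)
  simpa using h

theorem l1norm_toReal_le (u : H1 L) : (l1norm u).toReal ≤ embConst L * ‖u‖ :=
  ENNReal.toReal_le_of_le_ofReal (mul_nonneg embConst_pos.le (norm_nonneg _)) (l1norm_le u)

theorem norm_toL2_star (u : H1 L) : ‖(star u).toL2‖ = ‖u.toL2‖ := by
  have : ‖(star u).toL2‖ₑ = ‖u.toL2‖ₑ := by
    rw [L2.enorm_eq, L2.enorm_eq, ← l2norm_comp_neg]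
    congr 1
    funext l
    have := coef_star u (-l)
    rw [neg_neg, coef, coef] at this
    rw [this]
    simp
  simpa using congrArg ENNReal.toReal this

theorem abs_potEnergy_le (α : ℝ) (V u : H1 L) :
    |potEnergy α V u| ≤ ((l1norm V).toReal + |α| / 2 * (l1norm u).toReal ^ 2) * ‖u.toL2‖ ^ 2 := by
  have h1 : ‖coef (V * (u * star u)) 0‖ ≤ (l1norm V).toReal * ‖u.toL2‖ ^ 2 := by
    have e : V * (u * star u) = star u * (V * u) :=
      toC_injective (by simp only [toC_mul]; ring)
    rw [e, ← ip_eq_coef]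
    calc _ ≤ ‖u.toL2‖ * ‖(V * u).toL2‖ := norm_inner_le_norm _ _
      _ ≤ ‖u.toL2‖ * ((l1norm V).toReal * ‖u.toL2‖) := by
          gcongr; exact norm_toL2_mul_le _ _
      _ = _ := by ring
  have h2 : ‖coef ((u * star u) * (u * star u)) 0‖ ≤ (l1norm u).toReal ^ 2 * ‖u.toL2‖ ^ 2 := by
    have e : u * star u = star (u * star u) :=
      toC_injective (by simp only [toC_mul, toC_star, star_mul', star_star]; ring)
    conv_lhs => rw [e, ← e]
    rw [show coef (u * star u * (u * star u)) 0 = coef (star (u * star u) * (u * star u)) 0 by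
      rw [← e], ← ip_eq_coef]
    have h : ‖(u * star u).toL2‖ ≤ (l1norm u).toReal * ‖u.toL2‖ := by
      rw [← norm_toL2_star u]
      exact norm_toL2_mul_le _ _
    calc _ ≤ ‖(u * star u).toL2‖ * ‖(u * star u).toL2‖ := norm_inner_le_norm _ _
      _ ≤ ((l1norm u).toReal * ‖u.toL2‖) * ((l1norm u).toReal * ‖u.toL2‖) := by gcongr
      _ = _ := by ring
  refine (Complex.abs_re_le_norm _).trans ?_
  rw [coef_add, coef_real_smul]
  refine (norm_add_le _ _).trans ?_
  rw [norm_mul, Complex.norm_real, Real.norm_eq_abs, abs_div, abs_two]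
  calc _ ≤ (l1norm V).toReal * ‖u.toL2‖ ^ 2 +
        |α| / 2 * ((l1norm u).toReal ^ 2 * ‖u.toL2‖ ^ 2) := by gcongr
    _ = _ := by ring

/-- A Gagliardo–Nirenberg inequality: the square of the `ℓ¹` norm of the Fourier coefficients, and
hence of the sup norm, is controlled by the `H¹` norm with an arbitrarily small constant. -/
theorem exists_l1norm_sq_le {ε : ℝ} (hε : 0 < ε) :
    ∃ A : ℝ, 0 ≤ A ∧ ∀ u : H1 L, (l1norm u).toReal ^ 2 ≤ A * ‖u.toL2‖ ^ 2 + ε * ‖u‖ ^ 2 := by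
  have h2L := hL.out
  -- By dominated convergence, the weights `A + 2 L ε ⟨l⟩²` have a small sum of reciprocals for
  -- large `A`.
  obtain ⟨A, hA0, hA⟩ : ∃ A : ℝ, 0 ≤ A ∧
      ∑' l : ℤ, (A + 2 * L * ε * bracket L l ^ 2)⁻¹ ≤ 1 := by
    have hlim : Filter.Tendsto (fun A : ℝ => ∑' l : ℤ, (max A 0 + 2 * L * ε * bracket L l ^ 2)⁻¹)
        Filter.atTop (nhds (∑' _ : ℤ, (0 : ℝ))) := by
      refine tendsto_tsum_of_dominated_convergence
        (bound := fun l => (2 * L * ε)⁻¹ * (bracket L l ^ 2)⁻¹)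
        ((summable_bracket_inv_sq (pos_of_fact (L := L))).mul_left _) (fun l => ?_)
        (Filter.Eventually.of_forall fun A l => ?_)
      · refine Filter.Tendsto.inv_tendsto_atTop (Filter.tendsto_atTop_add_const_right _ _ ?_)
        exact Filter.tendsto_atTop_mono (fun A => le_max_left A 0) Filter.tendsto_id
      · have hb := bracket_pos L l
        have hm := le_max_right A 0
        rw [Real.norm_of_nonneg (by positivity), ← mul_inv]
        apply inv_anti₀ (by positivity)
        linarith
    rw [tsum_zero] at hlim
    obtain ⟨A, hA⟩ := (hlim.eventually (ge_mem_nhds one_pos)).exists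
    exact ⟨max A 0, le_max_right _ _, hA⟩
  refine ⟨A, hA0, fun u => ?_⟩
  set W : ℤ → ℝ := fun l => A + 2 * L * ε * bracket L l ^ 2 with hW
  have hWpos : ∀ l, 0 < W l := fun l => by
    have := bracket_pos L l
    positivity
  have hsum : HasSum (fun l => W l * ‖coef u l‖ ^ 2) (A * ‖u.toL2‖ ^ 2 + ε * ‖u‖ ^ 2) := by
    refine (((L2.hasSum_norm_sq u.toL2).mul_left A).add ((hasSum_norm_sq u).mul_left ε)).congr_fun
      fun l => ?_
    rw [hW, coef]
    ring
  have hsumW : Summable fun l => (W l)⁻¹ := by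
    refine Summable.of_nonneg_of_le (fun l => (inv_pos.2 (hWpos l)).le) (fun l => ?_)
      ((summable_bracket_inv_sq (pos_of_fact (L := L))).mul_left (2 * L * ε)⁻¹)
    have := bracket_pos L l
    rw [← mul_inv]
    apply inv_anti₀ (by positivity)
    rw [hW]
    linarith
  have hcs : l1norm u ^ 2 ≤ ENNReal.ofReal (A * ‖u.toL2‖ ^ 2 + ε * ‖u‖ ^ 2) := by
    have h1 : l1norm u ≤ l2norm (fun l => ENNReal.ofReal (Real.sqrt (W l))⁻¹) *
        l2norm (fun l => ENNReal.ofReal (Real.sqrt (W l)) * ‖coef u l‖ₑ) := by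
      refine le_trans (le_of_eq ?_) (tsum_mul_le_l2norm _ _)
      refine tsum_congr fun l => ?_
      have := Real.sqrt_pos.2 (hWpos l)
      rw [← mul_assoc, ← ENNReal.ofReal_mul (by positivity), inv_mul_cancel₀ this.ne']
      simp
    have h2 : l2norm (fun l => ENNReal.ofReal (Real.sqrt (W l))⁻¹) ^ 2 ≤ 1 := by
      rw [l2norm_sq, ← ENNReal.ofReal_one]
      refine le_trans (le_of_eq ?_) (ENNReal.ofReal_le_ofReal hA)
      rw [ENNReal.ofReal_tsum_of_nonneg (fun l => (inv_pos.2 (hWpos l)).le) hsumW]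
      refine tsum_congr fun l => ?_
      have := Real.sqrt_pos.2 (hWpos l)
      rw [← ENNReal.ofReal_pow (by positivity), inv_pow, Real.sq_sqrt (hWpos l).le]
    have h3 : l2norm (fun l => ENNReal.ofReal (Real.sqrt (W l)) * ‖coef u l‖ₑ) ^ 2 =
        ENNReal.ofReal (A * ‖u.toL2‖ ^ 2 + ε * ‖u‖ ^ 2) := by
      rw [l2norm_sq, ← hsum.tsum_eq, ENNReal.ofReal_tsum_of_nonneg
        (fun l => mul_nonneg (hWpos l).le (by positivity)) hsum.summable]
      refine tsum_congr fun l => ?_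
      rw [mul_pow, ← ENNReal.ofReal_pow (by positivity), Real.sq_sqrt (hWpos l).le,
        ENNReal.ofReal_mul (hWpos l).le, ENNReal.ofReal_pow (norm_nonneg _), ofReal_norm]
    calc l1norm u ^ 2 ≤ _ := pow_le_pow_left₀ zero_le h1 2
      _ ≤ 1 * _ := by rw [mul_pow]; gcongr
      _ = _ := by rw [one_mul, h3]
  rw [← ENNReal.toReal_pow]
  exact ENNReal.toReal_le_of_le_ofReal (by positivity) hcs

/-- Conservation of mass and energy bound the `H¹` norm of a solution, uniformly in time and for
potentials in a bounded set. -/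
theorem exists_apriori_bound (α : ℝ) (u₀ : H1 L) (B : ℝ) :
    ∃ R : ℝ, 0 ≤ R ∧ ∀ (V : H1 L) (T : ℝ) (u : ℝ → H1 L), star V = V → ‖V‖ ≤ B →
      IsMild α V u₀ T u → ∀ t ∈ Icc 0 T, ‖u t‖ ≤ R := by
  have hL0 := pos_of_fact (L := L)
  set m := ‖u₀.toL2‖ with hm
  -- With this `ε` the quartic part of the energy takes up at most half of the kinetic part, also in
  -- the focusing case `α < 0`.
  obtain ⟨A, hA0, hA⟩ := exists_l1norm_sq_le (L := L) (ε := (4 * L * |α| * m ^ 2 + 1)⁻¹)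
    (by positivity)
  set ε := (4 * L * |α| * m ^ 2 + 1)⁻¹ with hε
  set D := ‖u₀‖ ^ 2 / (4 * L) + (embConst L * B + |α| / 2 * (l1norm u₀).toReal ^ 2) * m ^ 2 +
    embConst L * B * m ^ 2 + |α| / 2 * A * m ^ 4 with hD
  refine ⟨Real.sqrt (8 * L * D), Real.sqrt_nonneg _, fun V T u hV hVB h t ht => ?_⟩
  have hen := h.energy_eq hV ht
  have hmass := h.norm_toL2_eq hV ht
  have h1 := abs_potEnergy_le α V (u t)
  have h0 := abs_potEnergy_le α V u₀
  rw [hmass, ← hm] at h1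
  rw [← hm] at h0
  have hVB' : (l1norm V).toReal ≤ embConst L * B := (l1norm_toReal_le V).trans
    (mul_le_mul_of_nonneg_left hVB embConst_pos.le)
  have hA' := hA (u t)
  rw [hmass, ← hm] at hA'
  have hεm : 4 * L * |α| * m ^ 2 * ε ≤ 1 := by
    rw [hε, ← div_eq_mul_inv, div_le_one (by positivity)]
    linarith
  have h1' : -potEnergy α V (u t) ≤ embConst L * B * m ^ 2 + |α| / 2 * A * m ^ 4 +
      |α| / 2 * m ^ 2 * ε * ‖u t‖ ^ 2 := by
    calc -potEnergy α V (u t) ≤ ((l1norm V).toReal + |α| / 2 * (l1norm (u t)).toReal ^ 2) * m ^ 2 :=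
          (neg_le_abs _).trans h1
      _ ≤ (embConst L * B + |α| / 2 * (A * m ^ 2 + ε * ‖u t‖ ^ 2)) * m ^ 2 := by gcongr
      _ = _ := by ring
  have h0' : potEnergy α V u₀ ≤
      (embConst L * B + |α| / 2 * (l1norm u₀).toReal ^ 2) * m ^ 2 :=
    (le_abs_self _).trans (h0.trans (by gcongr))
  have h2 : |α| / 2 * m ^ 2 * ε * ‖u t‖ ^ 2 ≤ ‖u t‖ ^ 2 / (8 * L) := by
    rw [le_div_iff₀ (by positivity)]
    calc |α| / 2 * m ^ 2 * ε * ‖u t‖ ^ 2 * (8 * L) =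
        (4 * L * |α| * m ^ 2 * ε) * ‖u t‖ ^ 2 := by ring
      _ ≤ 1 * ‖u t‖ ^ 2 := by gcongr
      _ = _ := one_mul _
  have h3 : ‖u t‖ ^ 2 / (4 * L) = ‖u t‖ ^ 2 / (8 * L) + ‖u t‖ ^ 2 / (8 * L) := by
    field_simp; ring
  have h4 : ‖u t‖ ^ 2 / (8 * L) ≤ D := by
    rw [hD]; linarith
  rw [div_le_iff₀ (by positivity)] at h4
  exact Real.le_sqrt_of_sq_le (by linarith)

end

section

/-! ### Global existence -/

section Abstract

variable {E : Type*} [NormedAddCommGroup E] [NormedSpace ℝ E]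

/-- A bounded, globally Lipschitz field has integral curves on every interval `[0, T]`. -/
theorem exists_integral_curve_of_bounded_lipschitz [CompleteSpace E] {f : ℝ → E → E} {T M K : ℝ}
    (hT : 0 ≤ T) (hM : 0 ≤ M) (hK : 0 ≤ K) (hc : Continuous fun p : ℝ × E => f p.1 p.2)
    (hb : ∀ t x, ‖f t x‖ ≤ M) (hl : ∀ t x y, ‖f t x - f t y‖ ≤ K * ‖x - y‖) (x₀ : E) :
    ∃ b : ℝ → E, Continuous b ∧ ∀ t ∈ Icc 0 T, b t = x₀ + ∫ τ in 0..t, f τ (b τ) := by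
  lift M to NNReal using hM
  lift K to NNReal using hK
  lift T to NNReal using hT
  have hpl : IsPicardLindelof f (⟨0, ⟨le_rfl, T.2⟩⟩ : Icc (0 : ℝ) T) x₀ (M * T) 0 M K := by
    refine ⟨fun t _ => ?_, fun x _ => ?_, fun t _ x _ => hb t x, ?_⟩
    · refine LipschitzOnWith.of_dist_le_mul fun x _ y _ => ?_
      rw [dist_eq_norm, dist_eq_norm]
      exact hl t x y
    · exact (hc.comp (continuous_id.prodMk continuous_const)).continuousOn
    · simp
  obtain ⟨β, hβ0, hβ⟩ := hpl.exists_eq_forall_mem_Icc_hasDerivWithinAt₀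
  have hβc : ContinuousOn β (Icc 0 (T : ℝ)) := fun t ht => (hβ t ht).continuousWithinAt
  set b : ℝ → E := IccExtend T.coe_nonneg ((Icc (0 : ℝ) T).domRestrict β) with hb'
  have hbβ : ∀ t ∈ Icc (0 : ℝ) T, b t = β t := fun t ht => by
    rw [hb', IccExtend_of_mem _ _ ht]; rfl
  have hbc : Continuous b := (continuousOn_iff_continuous_domRestrict.1 hβc).Icc_extend'
  refine ⟨b, hbc, fun t ht => ?_⟩
  have h := intervalIntegral.integral_eq_sub_of_hasDerivAt_of_le (f := β) ht.1
    (hβc.mono (Icc_subset_Icc le_rfl ht.2)) (f' := fun τ => f τ (b τ)) (fun τ hτ => ?_)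
    ((hc.comp (continuous_id.prodMk hbc)).intervalIntegrable 0 t)
  · have h0 : β 0 = x₀ := hβ0
    rw [h, hbβ t ht, h0]
    abel
  · have hτ' : τ ∈ Icc (0 : ℝ) T := ⟨hτ.1.le, hτ.2.le.trans ht.2⟩
    rw [hbβ τ hτ']
    exact (hβ τ hτ').hasDerivAt (Icc_mem_nhds hτ.1 (hτ.2.trans_le ht.2))

/-- A cut-off function equal to `1` on `r ≤ R` and to `0` on `2 R ≤ r`. -/
def cutoff (R r : ℝ) : ℝ := max 0 (min 1 (2 - r / R))

theorem cutoff_nonneg (R r : ℝ) : 0 ≤ cutoff R r := le_max_left _ _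

theorem cutoff_le_one (R r : ℝ) : cutoff R r ≤ 1 := max_le zero_le_one (min_le_left _ _)

theorem cutoff_eq_one {R r : ℝ} (hR : 0 < R) (h : r ≤ R) : cutoff R r = 1 := by
  have : r / R ≤ 1 := (div_le_one hR).2 h
  rw [cutoff, min_eq_left (by linarith), max_eq_right zero_le_one]

theorem cutoff_eq_zero {R r : ℝ} (hR : 0 < R) (h : 2 * R ≤ r) : cutoff R r = 0 := by
  have : 2 ≤ r / R := (le_div_iff₀ hR).2 h
  exact max_eq_left ((min_le_right _ _).trans (by linarith))

theorem abs_cutoff_sub_le {R : ℝ} (hR : 0 < R) (r r' : ℝ) :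
    |cutoff R r - cutoff R r'| ≤ |r - r'| / R := by
  calc |cutoff R r - cutoff R r'| ≤ |min 1 (2 - r / R) - min 1 (2 - r' / R)| := by
        simpa [cutoff] using abs_max_sub_max_le_max 0 (min 1 (2 - r / R)) 0 (min 1 (2 - r' / R))
    _ ≤ |(2 - r / R) - (2 - r' / R)| := by
        simpa using abs_min_sub_min_le_max 1 (2 - r / R) 1 (2 - r' / R)
    _ = |r - r'| / R := by
        rw [← abs_of_pos hR, ← abs_div, abs_of_pos hR, ← abs_neg]
        congr 1
        ring

theorem continuous_cutoff (R : ℝ) : Continuous (cutoff R) := by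
  unfold cutoff
  fun_prop

theorem norm_cutoff_smul_le {g : E → E} {R M : ℝ} (hR : 0 < R) (hM : 0 ≤ M)
    (hb : ∀ x, ‖x‖ ≤ 2 * R → ‖g x‖ ≤ M) (x : E) : ‖cutoff R ‖x‖ • g x‖ ≤ M := by
  rcases le_total ‖x‖ (2 * R) with h | h
  · rw [norm_smul, Real.norm_of_nonneg (cutoff_nonneg _ _)]
    exact (mul_le_of_le_one_left (norm_nonneg _) (cutoff_le_one _ _)).trans (hb x h)
  · rw [cutoff_eq_zero hR h]
    simpa using hM

theorem norm_cutoff_smul_sub_le {g : E → E} {R M K : ℝ} (hR : 0 < R) (hM : 0 ≤ M) (hK : 0 ≤ K)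
    (hb : ∀ x, ‖x‖ ≤ 2 * R → ‖g x‖ ≤ M)
    (hl : ∀ x y, ‖x‖ ≤ 2 * R → ‖y‖ ≤ 2 * R → ‖g x - g y‖ ≤ K * ‖x - y‖) (x y : E) :
    ‖cutoff R ‖x‖ • g x - cutoff R ‖y‖ • g y‖ ≤ (K + M / R) * ‖x - y‖ := by
  have hθ : ∀ x y : E, |cutoff R ‖x‖ - cutoff R ‖y‖| ≤ ‖x - y‖ / R := fun x y =>
    (abs_cutoff_sub_le hR _ _).trans (by gcongr; exact abs_norm_sub_norm_le x y)
  -- Outside the ball the other term vanishes, so that only the cut-off function varies.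
  have hout : ∀ x y : E, ‖x‖ ≤ 2 * R → 2 * R ≤ ‖y‖ →
      ‖cutoff R ‖x‖ • g x - cutoff R ‖y‖ • g y‖ ≤ (K + M / R) * ‖x - y‖ := by
    intro x y hx hy
    have h := hθ x y
    rw [cutoff_eq_zero hR hy, sub_zero] at h
    rw [cutoff_eq_zero hR hy, zero_smul, sub_zero, norm_smul, Real.norm_eq_abs]
    calc |cutoff R ‖x‖| * ‖g x‖ ≤ ‖x - y‖ / R * M := by
          gcongr
          exact hb x hx
      _ = 0 * ‖x - y‖ + M / R * ‖x - y‖ := by ring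
      _ ≤ K * ‖x - y‖ + M / R * ‖x - y‖ := by gcongr
      _ = _ := by ring
  rcases le_total ‖x‖ (2 * R) with hx | hx <;> rcases le_total ‖y‖ (2 * R) with hy | hy
  · have e : cutoff R ‖x‖ • g x - cutoff R ‖y‖ • g y =
        cutoff R ‖x‖ • (g x - g y) + (cutoff R ‖x‖ - cutoff R ‖y‖) • g y := by module
    rw [e]
    refine (norm_add_le _ _).trans ?_
    rw [norm_smul, norm_smul, Real.norm_of_nonneg (cutoff_nonneg _ _), Real.norm_eq_abs]
    calc _ ≤ 1 * (K * ‖x - y‖) + ‖x - y‖ / R * M := by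
          gcongr
          · exact cutoff_le_one _ _
          · exact hl x y hx hy
          · exact hθ x y
          · exact hb y hy
      _ = _ := by ring
  · exact hout x y hx hy
  · rw [norm_sub_rev, norm_sub_rev x y]
    exact hout y x hy hx
  · rw [cutoff_eq_zero hR hx, cutoff_eq_zero hR hy]
    simp only [zero_smul, sub_zero, norm_zero]
    positivity

end Abstract

variable {L : ℝ} [hL : Fact (0 < 2 * L)] {α : ℝ} {V u₀ : H1 L} {u w : ℝ → H1 L} {T : ℝ}

theorem profile_congr (α : ℝ) (V u₀ : H1 L) {t : ℝ} (ht : 0 ≤ t) (h : EqOn u w (Icc 0 t)) :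
    profile α V u₀ u t = profile α V u₀ w t := by
  have e : ∫ τ in 0..t, drift α V u τ = ∫ τ in 0..t, drift α V w τ := by
    refine intervalIntegral.integral_congr fun τ hτ => ?_
    rw [uIcc_of_le ht] at hτ
    rw [drift, drift, h hτ]
  rw [profile, profile, e]

theorem IsMild.congr (h : IsMild α V u₀ T u) (hw : Continuous w) (huw : EqOn u w (Icc 0 T)) :
    IsMild α V u₀ T w :=
  ⟨hw, fun t ht => by
    rw [← huw ht, h.eq t ht, profile_congr α V u₀ ht.1 (huw.mono (Icc_subset_Icc le_rfl ht.2))]⟩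

/-- The time-dependent field on `H¹(𝕋)` whose integral curves are the functions
`exp (-i t ∂ₓ² / 2) u(t)` for solutions `u`. -/
def field (α : ℝ) (V : H1 L) (t : ℝ) (x : H1 L) : H1 L :=
  schr (-t) ((-Complex.I) • nonlin α V (schr t x))

theorem norm_field (α : ℝ) (V : H1 L) (t : ℝ) (x : H1 L) :
    ‖field α V t x‖ = ‖nonlin α V (schr t x)‖ := by
  rw [field, LinearIsometry.norm_map, norm_smul]; simp

theorem norm_field_sub (α : ℝ) (V : H1 L) (t : ℝ) (x y : H1 L) :
    ‖field α V t x - field α V t y‖ = ‖nonlin α V (schr t x) - nonlin α V (schr t y)‖ := by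
  rw [field, field, ← map_sub, ← smul_sub, LinearIsometry.norm_map, norm_smul]; simp

theorem continuous_field (α : ℝ) (V : H1 L) :
    Continuous fun p : ℝ × H1 L => field α V p.1 p.2 := by
  have h1 : Continuous fun p : ℝ × H1 L => (-Complex.I) • nonlin α V (schr p.1 p.2) :=
    (((continuous_nonlin α V).comp continuous_schr).const_smul (-Complex.I) :)
  exact continuous_schr.comp (continuous_fst.neg.prodMk h1)

/-- Integral curves of the cut-off field. -/
theorem exists_cutoff_curve (α : ℝ) (V u₀ : H1 L) (hT : 0 ≤ T) {R : ℝ} (hR : 0 < R) :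
    ∃ b : ℝ → H1 L, Continuous b ∧
      ∀ t ∈ Icc 0 T, b t = u₀ + ∫ τ in 0..t, cutoff R ‖b τ‖ • field α V τ (b τ) := by
  have hK := algConst_pos (L := L)
  have hgb : ∀ t x, ‖x‖ ≤ 2 * R → ‖field α V t x‖ ≤
      algConst L * ‖V‖ * (2 * R) + |α| * (algConst L ^ 2 * (2 * R) ^ 3) := fun t x hx => by
    rw [norm_field]
    refine (norm_nonlin_le α V _).trans ?_
    rw [LinearIsometry.norm_map]
    gcongr
  have hgl : ∀ t x y, ‖x‖ ≤ 2 * R → ‖y‖ ≤ 2 * R → ‖field α V t x - field α V t y‖ ≤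
      (algConst L * ‖V‖ + |α| * (3 * (algConst L ^ 2 * (2 * R) ^ 2))) * ‖x - y‖ :=
    fun t x y hx hy => by
      rw [norm_field_sub]
      refine (norm_nonlin_sub_le α V _ _ (R := 2 * R) ?_ ?_).trans (le_of_eq ?_)
      · rwa [LinearIsometry.norm_map]
      · rwa [LinearIsometry.norm_map]
      · rw [← map_sub, LinearIsometry.norm_map]
  have hM0 : 0 ≤ algConst L * ‖V‖ * (2 * R) + |α| * (algConst L ^ 2 * (2 * R) ^ 3) := by
    positivity
  have hK0 : 0 ≤ algConst L * ‖V‖ + |α| * (3 * (algConst L ^ 2 * (2 * R) ^ 2)) := by positivity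
  have hc : Continuous fun p : ℝ × H1 L => cutoff R ‖p.2‖ • field α V p.1 p.2 :=
    ((continuous_cutoff R).comp continuous_snd.norm).smul (continuous_field α V)
  exact exists_integral_curve_of_bounded_lipschitz (f := fun t x => cutoff R ‖x‖ • field α V t x)
    hT hM0 (by positivity) hc
    (fun t x => norm_cutoff_smul_le hR hM0 (hgb t) x)
    (fun t x y => norm_cutoff_smul_sub_le hR hM0 hK0 (hgb t) (hgl t) x y) u₀

/-- Solutions exist on every bounded interval: the a priori bound shows that the solution of a
cut-off equation never leaves the ball in which the cut-off is inactive. -/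
theorem exists_isMild (α : ℝ) (u₀ : H1 L) (hV : star V = V) (hT : 0 ≤ T) :
    ∃ u, IsMild α V u₀ T u := by
  obtain ⟨R', hR'0, hR'⟩ := exists_apriori_bound α u₀ ‖V‖
  set R := R' + 1 with hRdef
  have hR : 0 < R := by positivity
  obtain ⟨b, hbc, hb⟩ := exists_cutoff_curve α V u₀ hT hR
  set u : ℝ → H1 L := fun t => schr t (b t) with hu
  have huc : Continuous u := continuous_schr.comp (continuous_id.prodMk hbc)
  have hmild : ∀ t₁ ∈ Icc 0 T, (∀ t ∈ Icc 0 t₁, ‖b t‖ ≤ R) → IsMild α V u₀ t₁ u := by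
    intro t₁ ht₁ hbd
    refine ⟨huc, fun t ht => ?_⟩
    change schr t (b t) = _
    have e : ∫ τ in 0..t, cutoff R ‖b τ‖ • field α V τ (b τ) = ∫ τ in 0..t, drift α V u τ := by
      refine intervalIntegral.integral_congr fun τ hτ => ?_
      rw [uIcc_of_le ht.1] at hτ
      rw [cutoff_eq_one hR (hbd τ ⟨hτ.1, hτ.2.trans ht.2⟩), one_smul]
      rfl
    rw [hb t ⟨ht.1, ht.2.trans ht₁.2⟩, profile, e]
  have hnu : ∀ t, ‖u t‖ = ‖b t‖ := fun t => LinearIsometry.norm_map _ _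
  have hapr : ∀ t₁ ∈ Icc 0 T, (∀ t ∈ Icc 0 t₁, ‖b t‖ ≤ R) → ‖b t₁‖ ≤ R' := fun t₁ ht₁ hbd => by
    rw [← hnu]
    exact hR' V t₁ u hV le_rfl (hmild t₁ ht₁ hbd) t₁ ⟨ht₁.1, le_rfl⟩
  have hb0 : ‖b 0‖ ≤ R' := by
    have e : b 0 = u₀ := by simpa using hb 0 ⟨le_rfl, hT⟩
    have h0 : IsMild α V u₀ 0 fun _ => u₀ := by
      refine ⟨continuous_const, fun t ht => ?_⟩
      obtain rfl : t = 0 := le_antisymm ht.2 ht.1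
      rw [profile_zero, schr_zero]
    rw [e]
    exact hR' V 0 _ hV le_rfl h0 0 ⟨le_rfl, le_rfl⟩
  -- There is no first exit from the ball of radius `R`.
  have hlt : ∀ t ∈ Icc 0 T, ‖b t‖ < R := by
    by_contra! hcon
    obtain ⟨t₁, ht₁, ht₁R⟩ := hcon
    have hS : IsCompact {t | t ∈ Icc 0 T ∧ R ≤ ‖b t‖} :=
      isCompact_Icc.inter_right (isClosed_le continuous_const hbc.norm)
    obtain ⟨s, hs, hsmin⟩ := hS.exists_isLeast ⟨t₁, ht₁, ht₁R⟩
    have hbelow : ∀ t ∈ Icc 0 s, ‖b t‖ ≤ R := by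
      intro t ht
      by_contra! hgt
      obtain ⟨t', ht', hR''⟩ := intermediate_value_Icc ht.1 hbc.norm.continuousOn
        (show R ∈ Icc ‖b 0‖ ‖b t‖ from ⟨by linarith, hgt.le⟩)
      have h1 : s ≤ t' := hsmin ⟨⟨ht'.1, ht'.2.trans (ht.2.trans hs.1.2)⟩, hR''.ge⟩
      have h2 : t' = t := le_antisymm ht'.2 (ht.2.trans h1)
      rw [h2] at hR''
      exact hgt.ne' hR''
    have := hapr s hs.1 hbelow
    linarith [hs.2]
  exact ⟨u, hmild T ⟨hT, le_rfl⟩ fun t ht => (hlt t ht).le⟩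

/-- Global existence of mild solutions. -/
theorem exists_isMild_global (α : ℝ) (u₀ : H1 L) (hV : star V = V) :
    ∃ u, ∀ T, IsMild α V u₀ T u := by
  choose U hU using fun n : ℕ => exists_isMild α u₀ hV (Nat.cast_nonneg (α := ℝ) n)
  set u : ℝ → H1 L := fun t => U (⌊max t 0⌋₊ + 1) (max t 0) with hu
  have huU : ∀ (n : ℕ) (t : ℝ), t < n → u t = U n (max t 0) := by
    intro n t ht
    rcases Nat.eq_zero_or_pos n with rfl | hn
    · have h0 : max t 0 = 0 := max_eq_right (by exact_mod_cast ht.le)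
      simp only [hu, h0]
      rw [(hU _).eq 0 ⟨le_rfl, Nat.cast_nonneg _⟩, (hU _).eq 0 ⟨le_rfl, Nat.cast_nonneg _⟩,
        profile_zero, profile_zero]
    · have hn' : (0 : ℝ) < n := by exact_mod_cast hn
      have h1 : max t 0 ≤ (⌊max t 0⌋₊ + 1 : ℕ) := by
        push_cast; exact (Nat.lt_floor_add_one _).le
      have h2 : max t 0 ≤ n := max_le ht.le hn'.le
      have h3 : IsMild α V u₀ (max t 0) (U n) := (hU n).mono h2
      exact ((hU _).mono h1).unique h3 ⟨le_max_right _ _, le_rfl⟩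
  have huc : Continuous u := by
    refine continuous_iff_continuousAt.2 fun t => ?_
    obtain ⟨n, hn⟩ := exists_nat_gt t
    have h1 : Continuous fun t => U n (max t 0) :=
      (hU n).cont.comp (continuous_id.max continuous_const)
    refine h1.continuousAt.congr ?_
    filter_upwards [gt_mem_nhds hn] with τ hτ using (huU n τ hτ).symm
  refine ⟨u, fun T => ?_⟩
  obtain ⟨n, hn⟩ := exists_nat_gt T
  refine ((hU n).mono hn.le).congr huc fun t ht => ?_
  rw [huU n t (ht.2.trans_lt hn), max_eq_left ht.1]

end

section

/-! ### Persistence of `H^s` regularity -/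

theorem gronwallBound_le {δ K ε x : ℝ} (hK : 0 ≤ K) (hε : 0 ≤ ε) :
    gronwallBound δ K ε x ≤ (δ + ε * x) * Real.exp (K * x) := by
  rcases hK.eq_or_lt with rfl | hK
  · simp [gronwallBound_K0]
  · rw [gronwallBound_of_K_ne_0 hK.ne', add_mul]
    refine add_le_add le_rfl ?_
    have h1 := Real.add_one_le_exp (-(K * x))
    have h2 : Real.exp (K * x) - 1 ≤ K * x * Real.exp (K * x) := by
      have h3 : Real.exp (-(K * x)) * Real.exp (K * x) = 1 := by rw [← Real.exp_add]; simp
      nlinarith [Real.exp_pos (K * x)]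
    calc ε / K * (Real.exp (K * x) - 1) ≤ ε / K * (K * x * Real.exp (K * x)) := by gcongr
      _ = _ := by field_simp

variable {L : ℝ} [hL : Fact (0 < 2 * L)]

theorem wnorm_le_of_bounded {w : ℤ → ℝ} {C : ℝ} (hw : ∀ l, |w l| ≤ C) (u : H1 L) :
    l2norm (fun l => ‖(w l : ℂ) * coef u l‖ₑ) ≤ ENNReal.ofReal (C * ‖u.toL2‖) := by
  have hC : 0 ≤ C := (abs_nonneg _).trans (hw 0)
  rw [ENNReal.ofReal_mul hC, ofReal_norm, L2.enorm_eq, ← l2norm_const_mul]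
  refine l2norm_mono fun l => ?_
  rw [enorm_mul, ← ofReal_norm, Complex.norm_real, Real.norm_eq_abs]
  exact mul_le_mul_left (ENNReal.ofReal_le_ofReal (hw l)) _

theorem exists_weighted {w : ℤ → ℝ} {C : ℝ} (hw : ∀ l, |w l| ≤ C) (u : H1 L) :
    ∃ f : L2 L, ∀ l, fc f l = (w l : ℂ) * coef u l :=
  L2.exists_fc_eq _ ((wnorm_le_of_bounded hw u).trans_lt ENNReal.ofReal_lt_top)

/-- The Fourier multiplier with a bounded weight, as a continuous linear map from `H¹(𝕋)` to
`L²(𝕋)`. -/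
def weightL {w : ℤ → ℝ} {C : ℝ} (hw : ∀ l, |w l| ≤ C) : H1 L →L[ℝ] L2 L :=
  LinearMap.mkContinuous
    { toFun := fun u => (exists_weighted hw u).choose
      map_add' := fun u v => L2.ext_fc fun l => by
        rw [fc_add, (exists_weighted hw _).choose_spec, (exists_weighted hw u).choose_spec,
          (exists_weighted hw v).choose_spec, coef_add, mul_add]
      map_smul' := fun c u => L2.ext_fc fun l => by
        have := fc_smul (c : ℂ) (exists_weighted hw u).choose l
        rw [(exists_weighted hw u).choose_spec] at this
        refine Eq.trans ?_ this.symm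
        rw [(exists_weighted hw _).choose_spec, coef_real_smul]
        ring }
    (C * (Real.sqrt (2 * L))⁻¹) (fun u => by
      have hC : 0 ≤ C := (abs_nonneg _).trans (hw 0)
      have h : ‖(exists_weighted hw u).choose‖ₑ ≤ ENNReal.ofReal (C * ‖u.toL2‖) := by
        rw [L2.enorm_eq]
        simp only [(exists_weighted hw u).choose_spec]
        exact wnorm_le_of_bounded hw u
      rw [← ofReal_norm, ENNReal.ofReal_le_ofReal_iff (by positivity)] at h
      refine h.trans ?_
      rw [mul_assoc]
      gcongr
      exact norm_toL2_le u)

theorem fc_weightL {w : ℤ → ℝ} {C : ℝ} (hw : ∀ l, |w l| ≤ C) (u : H1 L) (l : ℤ) :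
    fc (weightL hw u) l = (w l : ℂ) * coef u l := (exists_weighted hw u).choose_spec l

theorem enorm_weightL {w : ℤ → ℝ} {C : ℝ} (hw : ∀ l, |w l| ≤ C) (hw0 : ∀ l, 0 ≤ w l) (u : H1 L) :
    ‖weightL hw u‖ₑ = wnorm w u := by
  rw [L2.enorm_eq, wnorm]
  congr 1
  funext l
  rw [fc_weightL, enorm_mul, ← ofReal_norm, Complex.norm_real, Real.norm_of_nonneg (hw0 l)]

theorem norm_weightL_mul_le {w : ℤ → ℝ} {C A : ℝ} (hw : ∀ l, |w l| ≤ C) (hw0 : ∀ l, 0 ≤ w l)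
    (hA : 0 ≤ A) (hadd : ∀ k l, w (k + l) ≤ A * (w k + w l)) (u v : H1 L) :
    ‖weightL hw (u * v)‖ ≤
      A * ((l1norm v).toReal * ‖weightL hw u‖ + (l1norm u).toReal * ‖weightL hw v‖) := by
  have h := wnorm_mul_le hw0 hadd hA u v
  simp only [← enorm_weightL hw hw0] at h
  have h1 : l1norm v * ‖weightL hw u‖ₑ < ∞ := ENNReal.mul_lt_top (l1norm_lt_top v) enorm_lt_top
  have h2 : l1norm u * ‖weightL hw v‖ₑ < ∞ := ENNReal.mul_lt_top (l1norm_lt_top u) enorm_lt_top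
  have h3 := ENNReal.toReal_mono (ENNReal.mul_lt_top ENNReal.ofReal_lt_top
    (ENNReal.add_lt_top.2 ⟨h1, h2⟩)).ne h
  rw [ENNReal.toReal_mul, ENNReal.toReal_add h1.ne h2.ne, ENNReal.toReal_ofReal hA] at h3
  simpa using h3

theorem norm_weightL_star {w : ℤ → ℝ} {C : ℝ} (hw : ∀ l, |w l| ≤ C) (hw0 : ∀ l, 0 ≤ w l)
    (heven : ∀ l, w (-l) = w l) (u : H1 L) : ‖weightL hw (star u)‖ = ‖weightL hw u‖ := by
  have h : ‖weightL hw (star u)‖ₑ = ‖weightL hw u‖ₑ := by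
    rw [enorm_weightL hw hw0, enorm_weightL hw hw0, wnorm_star heven]
  simpa using congrArg ENNReal.toReal h

theorem norm_weightL_nonlin_le {w : ℤ → ℝ} {C A : ℝ} (hw : ∀ l, |w l| ≤ C) (hw0 : ∀ l, 0 ≤ w l)
    (heven : ∀ l, w (-l) = w l) (hA : 0 ≤ A) (hadd : ∀ k l, w (k + l) ≤ A * (w k + w l)) (α : ℝ)
    {V u : H1 L} {a b c : ℝ} (ha : (l1norm u).toReal ≤ a) (hb : (l1norm V).toReal ≤ b)
    (hc : (l1norm (u * star u)).toReal ≤ c) :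
    ‖weightL hw (nonlin α V u)‖ ≤
      (A * b + |α| * (2 * A ^ 2 * a ^ 2 + A * c)) * ‖weightL hw u‖ + A * a * ‖weightL hw V‖ := by
  have ha0 : 0 ≤ a := ENNReal.toReal_nonneg.trans ha
  have h1 : ‖weightL hw (V * u)‖ ≤ A * (a * ‖weightL hw V‖ + b * ‖weightL hw u‖) :=
    (norm_weightL_mul_le hw hw0 hA hadd V u).trans (by gcongr)
  have h2 : ‖weightL hw (u * star u)‖ ≤ A * (a * ‖weightL hw u‖ + a * ‖weightL hw u‖) := by
    refine (norm_weightL_mul_le hw hw0 hA hadd u (star u)).trans ?_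
    rw [norm_weightL_star hw hw0 heven, l1norm_star]
    gcongr
  have h3 : ‖weightL hw (u * star u * u)‖ ≤
      A * (a * (A * (a * ‖weightL hw u‖ + a * ‖weightL hw u‖)) + c * ‖weightL hw u‖) :=
    (norm_weightL_mul_le hw hw0 hA hadd (u * star u) u).trans (by gcongr)
  rw [nonlin, map_add, map_smul]
  refine (norm_add_le _ _).trans ?_
  rw [norm_smul, Real.norm_eq_abs]
  calc _ ≤ A * (a * ‖weightL hw V‖ + b * ‖weightL hw u‖) +
      |α| * (A * (a * (A * (a * ‖weightL hw u‖ + a * ‖weightL hw u‖)) + c * ‖weightL hw u‖)) := by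
        gcongr
    _ = _ := by ring

theorem norm_weightL_schr {w : ℤ → ℝ} {C : ℝ} (hw : ∀ l, |w l| ≤ C) (t : ℝ) (u : H1 L) :
    ‖weightL hw (schr t u)‖ = ‖weightL hw u‖ := by
  have h : ‖weightL hw (schr t u)‖ₑ = ‖weightL hw u‖ₑ := by
    rw [L2.enorm_eq, L2.enorm_eq]
    congr 1
    funext l
    rw [fc_weightL, fc_weightL, coef_schr, enorm_mul, enorm_mul, enorm_mul, ← ofReal_norm
      (symb L t l), norm_symb]
    simp
  simpa using congrArg ENNReal.toReal h

theorem norm_weightL_I {w : ℤ → ℝ} {C : ℝ} (hw : ∀ l, |w l| ≤ C) (u : H1 L) :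
    ‖weightL hw ((-Complex.I) • u)‖ = ‖weightL hw u‖ := by
  have h : ‖weightL hw ((-Complex.I) • u)‖ₑ = ‖weightL hw u‖ₑ := by
    rw [L2.enorm_eq, L2.enorm_eq]
    congr 1
    funext l
    rw [fc_weightL, fc_weightL, coef_smul, enorm_mul, enorm_mul, enorm_mul, ← ofReal_norm
      (-Complex.I)]
    simp
  simpa using congrArg ENNReal.toReal h

/-- The weight `⟨l⟩^s`, truncated at height `N` so that it is bounded. -/
def truncWeight (L s : ℝ) (N : ℕ) (l : ℤ) : ℝ := min (bracket L l ^ s) N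

theorem truncWeight_nonneg (L s : ℝ) (N : ℕ) (l : ℤ) : 0 ≤ truncWeight L s N l := by
  have := bracket_pos L l
  exact le_min (by positivity) (Nat.cast_nonneg N)

theorem abs_truncWeight_le (L s : ℝ) (N : ℕ) (l : ℤ) : |truncWeight L s N l| ≤ N := by
  rw [abs_of_nonneg (truncWeight_nonneg L s N l)]
  exact min_le_right _ _

theorem truncWeight_neg (L s : ℝ) (N : ℕ) (l : ℤ) :
    truncWeight L s N (-l) = truncWeight L s N l := by
  rw [truncWeight, truncWeight, bracket_neg]

/-- The truncated weights are subadditive up to a constant which does not depend on the height of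
the truncation. -/
theorem truncWeight_add_le (L : ℝ) {s : ℝ} (hs : 0 ≤ s) (N : ℕ) (k l : ℤ) :
    truncWeight L s N (k + l) ≤ 2 ^ s * (truncWeight L s N k + truncWeight L s N l) := by
  have h1 : (1 : ℝ) ≤ 2 ^ s := Real.one_le_rpow one_le_two hs
  have hk := truncWeight_nonneg L s N k
  have hl := truncWeight_nonneg L s N l
  have hN : truncWeight L s N (k + l) ≤ N := min_le_right _ _
  by_cases h : bracket L k ^ s ≤ N ∧ bracket L l ^ s ≤ N
  · have := bracket_rpow_add_le L hs k l
    rw [truncWeight, truncWeight, truncWeight, min_eq_left h.1, min_eq_left h.2]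
    exact (min_le_left _ _).trans this
  · have h2 : (N : ℝ) ≤ truncWeight L s N k + truncWeight L s N l := by
      rw [not_and_or, not_le, not_le] at h
      rcases h with h | h
      · have : truncWeight L s N k = N := min_eq_right h.le
        linarith
      · have : truncWeight L s N l = N := min_eq_right h.le
        linarith
    calc truncWeight L s N (k + l) ≤ 1 * (truncWeight L s N k + truncWeight L s N l) := by linarith
      _ ≤ _ := by gcongr

theorem hsNorm_le_of_truncWeight {s : ℝ} {D : ℝ≥0∞} (u : H1 L)
    (h : ∀ N, wnorm (truncWeight L s N) u ≤ D) :
    hsNorm s u.toL2 ≤ ENNReal.ofReal (Real.sqrt (2 * L)) * D := by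
  rw [hsNorm_eq_l2norm]
  gcongr
  rw [← ENNReal.pow_le_pow_left_iff two_ne_zero, l2norm_sq, ENNReal.tsum_eq_iSup_sum]
  refine iSup_le fun F => ?_
  obtain ⟨N, hN⟩ : ∃ N : ℕ, ∀ l ∈ F, bracket L l ^ s ≤ N := by
    obtain ⟨B, hB⟩ := (F.image fun l => bracket L l ^ s).bddAbove
    obtain ⟨N, hN⟩ := exists_nat_ge B
    exact ⟨N, fun l hl => (hB (by simpa using ⟨l, hl, rfl⟩)).trans hN⟩
  calc ∑ l ∈ F, (ENNReal.ofReal (bracket L l ^ s) * ‖fc u.toL2 l‖ₑ) ^ 2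
      = ∑ l ∈ F, (ENNReal.ofReal (truncWeight L s N l) * ‖coef u l‖ₑ) ^ 2 := by
        refine Finset.sum_congr rfl fun l hl => ?_
        rw [truncWeight, min_eq_left (hN l hl)]
        rfl
    _ ≤ wnorm (truncWeight L s N) u ^ 2 := by
        rw [wnorm, l2norm_sq]
        exact ENNReal.sum_le_tsum F
    _ ≤ D ^ 2 := pow_le_pow_left₀ zero_le (h N) 2

theorem wnorm_truncWeight_le (s : ℝ) (N : ℕ) (u : H1 L) :
    ENNReal.ofReal (Real.sqrt (2 * L)) * wnorm (truncWeight L s N) u ≤ hsNorm s u.toL2 := by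
  rw [hsNorm_eq_l2norm]
  gcongr
  refine l2norm_mono fun l => ?_
  exact mul_le_mul_left (ENNReal.ofReal_le_ofReal (min_le_left _ _)) _

/-- The `H^s` norm of a solution is bounded on bounded time intervals, uniformly for potentials in a
bounded subset of `H^s`. By the tame product estimate, the nonlinearity grows linearly in the
`H^s` norm once the `H¹` norm is bounded. The Grönwall argument is applied to the norms with
truncated weights, which are finite on `H¹`, and its constants do not depend on the truncation. -/
theorem exists_hsNorm_bound (α : ℝ) (u₀ : H1 L) {s : ℝ} (hs : 1 ≤ s) (hu₀ : hsNorm s u₀.toL2 < ∞)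
    (B T : ℝ) : ∃ D : ℝ≥0∞, D < ∞ ∧ ∀ (V : H1 L) (u : ℝ → H1 L), star V = V →
      hsNorm s V.toL2 ≤ ENNReal.ofReal B → IsMild α V u₀ T u →
        ∀ t ∈ Icc 0 T, hsNorm s (u t).toL2 ≤ D := by
  obtain ⟨R, hR0, hR⟩ := exists_apriori_bound α u₀ (max B 0)
  have hκ := embConst_pos (L := L)
  have hC := algConst_pos (L := L)
  have hsq := sqrt_two_mul_pos (L := L)
  set a := embConst L * R with ha
  set b := embConst L * max B 0 with hb
  set c := embConst L * (algConst L * R * R) with hc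
  set A : ℝ := 2 ^ s with hA
  have hA0 : 0 ≤ A := by positivity
  set K := A * b + |α| * (2 * A ^ 2 * a ^ 2 + A * c) with hK
  set ε := A * a * ((Real.sqrt (2 * L))⁻¹ * max B 0) with hε
  set δ := (Real.sqrt (2 * L))⁻¹ * (hsNorm s u₀.toL2).toReal with hδ
  have hb0 : 0 ≤ b := by positivity
  have hK0 : 0 ≤ K := by positivity
  have hε0 : 0 ≤ ε := by positivity
  refine ⟨ENNReal.ofReal (Real.sqrt (2 * L)) *
    ENNReal.ofReal ((δ + ε * T) * Real.exp (K * T)),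
    ENNReal.mul_lt_top ENNReal.ofReal_lt_top ENNReal.ofReal_lt_top,
    fun V u hV hVB h t ht => hsNorm_le_of_truncWeight _ fun N => ?_⟩
  have hVn : ‖V‖ ≤ max B 0 := by
    have h1 : ‖V‖ₑ ≤ ENNReal.ofReal (max B 0) := by
      rw [H1.enorm_eq_hsNorm]
      exact (hsNorm_mono hs _).trans (hVB.trans (ENNReal.ofReal_le_ofReal (le_max_left _ _)))
    rwa [← ofReal_norm, ENNReal.ofReal_le_ofReal_iff (le_max_right _ _)] at h1
  have hun := hR V T u hV hVn h
  have hw := abs_truncWeight_le L s N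
  have hw0 := truncWeight_nonneg L s N
  have hreal : ∀ v : H1 L, ∀ β : ℝ, 0 ≤ β → hsNorm s v.toL2 ≤ ENNReal.ofReal β →
      ‖weightL hw v‖ ≤ (Real.sqrt (2 * L))⁻¹ * β := by
    intro v β hβ hv
    have h1 := (wnorm_truncWeight_le s N v).trans hv
    rw [← enorm_weightL hw hw0, ← ofReal_norm, ← ENNReal.ofReal_mul hsq.le,
      ENNReal.ofReal_le_ofReal_iff hβ] at h1
    rw [← div_eq_inv_mul, le_div_iff₀ hsq]
    linarith
  have hwV : ‖weightL hw V‖ ≤ (Real.sqrt (2 * L))⁻¹ * max B 0 :=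
    hreal V _ (le_max_right _ _) (hVB.trans (ENNReal.ofReal_le_ofReal (le_max_left _ _)))
  have hwu₀ : ‖weightL hw u₀‖ ≤ δ :=
    hreal u₀ _ ENNReal.toReal_nonneg (by rw [ENNReal.ofReal_toReal hu₀.ne])
  have key := norm_le_gronwallBound_of_norm_deriv_right_le
    (f := fun t => weightL hw (profile α V u₀ u t)) (f' := fun t => weightL hw (drift α V u t))
    (δ := δ) (K := K) (ε := ε) (a := 0) (b := T)
    ((weightL hw).continuous.comp (continuous_profile α V u₀ h.cont)).continuousOn
    (fun t _ => ((weightL hw).hasFDerivAt.comp_hasDerivAt t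
      (hasDerivAt_profile α V u₀ h.cont t)).hasDerivWithinAt)
    (by rw [profile_zero]; exact hwu₀) (fun t ht => ?_) t ht
  · rw [sub_zero] at key
    have e : weightL hw (u t) = weightL hw (schr t (profile α V u₀ u t)) := by
      rw [← h.eq t ht]
    rw [← enorm_weightL hw hw0, ← ofReal_norm, e, norm_weightL_schr]
    refine ENNReal.ofReal_le_ofReal (key.trans ((gronwallBound_le hK0 hε0).trans ?_))
    have hδ0 : 0 ≤ δ := by positivity
    have ht2 := ht.2
    have hT := ht.1.trans ht.2
    have hnn : 0 ≤ δ + ε * T := by positivity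
    gcongr
  · have ht' : t ∈ Icc 0 T := ⟨ht.1, ht.2.le⟩
    have hut := hun t ht'
    have e : ‖weightL hw (profile α V u₀ u t)‖ = ‖weightL hw (u t)‖ := by
      conv_rhs => rw [h.eq t ht', norm_weightL_schr]
    rw [e, drift, norm_weightL_schr, norm_weightL_I]
    refine (norm_weightL_nonlin_le hw hw0 (truncWeight_neg L s N) hA0
      (truncWeight_add_le L (by linarith) N) α (a := a) (b := b) (c := c) ?_ ?_ ?_).trans ?_
    · exact (l1norm_toReal_le _).trans (mul_le_mul_of_nonneg_left hut hκ.le)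
    · exact (l1norm_toReal_le _).trans (mul_le_mul_of_nonneg_left hVn hκ.le)
    · refine (l1norm_toReal_le _).trans ?_
      rw [hc]
      gcongr
      refine (H1.norm_mul_le _ _).trans ?_
      rw [H1.norm_star]
      gcongr
    · exact add_le_add le_rfl (mul_le_mul_of_nonneg_left hwV (by positivity))

end

section

/-! ### Volterra operators -/

open scoped ContDiff

/-- A bounded operator on a space of continuous functions on `[0, T]` which is dominated by an
integral up to the current time differs from the identity by an invertible operator: the norm of
its `n`-th power is at most `(K T)ⁿ / n!`. -/
theorem isInvertible_one_sub_of_volterra {E : Type*} [NormedAddCommGroup E] [NormedSpace ℝ E]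
    [CompleteSpace E] {T K : ℝ} (hT : 0 ≤ T) (hK : 0 ≤ K)
    (A : C(Icc (0 : ℝ) T, E) →L[ℝ] C(Icc (0 : ℝ) T, E))
    (hA : ∀ X t, ‖A X t‖ ≤ K * ∫ τ in 0..(t : ℝ), ‖X (projIcc 0 T hT τ)‖) :
    (ContinuousLinearMap.id ℝ C(Icc (0 : ℝ) T, E) - A).IsInvertible := by
  have hpow : ∀ (n : ℕ) X t, ‖(A ^ n) X t‖ ≤ (K * t) ^ n / n.factorial * ‖X‖ := by
    intro n
    induction n with
    | zero => intro X t; simpa using X.norm_coe_le_norm t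
    | succ n ih =>
      intro X t
      have ht := t.2.1
      rw [pow_succ', mul_apply_eq_comp]
      refine (hA _ t).trans ?_
      have h1 : ∫ τ in 0..(t : ℝ), ‖(A ^ n) X (projIcc 0 T hT τ)‖ ≤
          ∫ τ in 0..(t : ℝ), (K ^ n / n.factorial * ‖X‖) * τ ^ n := by
        refine intervalIntegral.integral_mono_on ht ?_ ?_ fun τ hτ => ?_
        · exact ((ContinuousMap.continuous _).comp continuous_projIcc).norm.intervalIntegrable _ _
        · exact (continuous_const.mul (continuous_pow n)).intervalIntegrable _ _
        · have h2 : τ ∈ Icc 0 T := ⟨hτ.1, hτ.2.trans t.2.2⟩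
          rw [projIcc_of_mem hT h2]
          refine (ih X ⟨τ, h2⟩).trans (le_of_eq ?_)
          simp only [mul_pow]
          ring
      refine (mul_le_mul_of_nonneg_left h1 hK).trans (le_of_eq ?_)
      rw [intervalIntegral.integral_const_mul, integral_pow, Nat.factorial_succ]
      push_cast
      field_simp
      ring
  obtain ⟨n, hn⟩ : ∃ n : ℕ, ‖A ^ n‖ < 1 := by
    have h0 := FloorSemiring.tendsto_pow_div_factorial_atTop (K * T)
    obtain ⟨n, hn⟩ := (h0.eventually (gt_mem_nhds one_pos)).exists
    refine ⟨n, lt_of_le_of_lt ?_ hn⟩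
    refine ContinuousLinearMap.opNorm_le_bound _ (by positivity) fun X => ?_
    refine (ContinuousMap.norm_le _ (by positivity)).2 fun t => (hpow n X t).trans ?_
    have ht := t.2.1
    have ht' := t.2.2
    gcongr
  have hu : IsUnit (1 - A) := by
    have h1 : IsUnit (1 - A ^ n) := (Units.oneSub (A ^ n) hn).isUnit
    have hcomm : Commute (1 - A) (∑ i ∈ Finset.range n, A ^ i) := by
      rw [Commute, SemiconjBy, mul_neg_geom_sum, geom_sum_mul_neg]
    rw [← mul_neg_geom_sum] at h1
    exact (hcomm.isUnit_mul_iff.1 h1).1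
  obtain ⟨U, hU⟩ := hu
  refine ContinuousLinearMap.IsInvertible.of_inverse (g := (U⁻¹ : _ˣ)) ?_ ?_
  · change (1 - A) * _ = 1
    rw [← hU, Units.mul_inv]
  · change _ * (1 - A) = 1
    rw [← hU, Units.inv_mul]

/-! ### Smooth dependence of solutions on parameters -/

variable {L : ℝ} [hL : Fact (0 < 2 * L)] {T : ℝ}

/-- Continuous paths on `[0, T]` in `H¹(𝕋)`. -/
abbrev Path (L : ℝ) [Fact (0 < 2 * L)] (T : ℝ) : Type := C(Icc (0 : ℝ) T, H1 L)

/-- The integrand of Duhamel's formula. -/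
def duhamelIntegrand (hT : 0 ≤ T) (F : Path L T) (τ : ℝ) : H1 L :=
  schr (-τ) ((-Complex.I) • F (projIcc 0 T hT τ))

theorem continuous_duhamelIntegrand (hT : 0 ≤ T) (F : Path L T) :
    Continuous (duhamelIntegrand hT F) := by
  have h : Continuous fun τ => (-Complex.I) • F (projIcc 0 T hT τ) :=
    ((F.continuous.comp continuous_projIcc).const_smul (-Complex.I) :)
  exact continuous_schr.comp (continuous_neg.prodMk h)

theorem norm_duhamelIntegrand (hT : 0 ≤ T) (F : Path L T) (τ : ℝ) :
    ‖duhamelIntegrand hT F τ‖ = ‖F (projIcc 0 T hT τ)‖ := by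
  rw [duhamelIntegrand, LinearIsometry.norm_map, norm_smul]; simp

theorem hasDerivAt_integral_duhamelIntegrand (hT : 0 ≤ T) (F : Path L T) (t : ℝ) :
    HasDerivAt (fun t => ∫ τ in 0..t, duhamelIntegrand hT F τ) (duhamelIntegrand hT F t) t :=
  ((continuous_duhamelIntegrand hT F).integral_hasStrictDerivAt 0 t).hasDerivAt

/-- The value at time `t` of the Duhamel integral. -/
def duhamelFun (hT : 0 ≤ T) (F : Path L T) (t : ℝ) : H1 L :=
  schr t (∫ τ in 0..t, duhamelIntegrand hT F τ)

theorem continuous_duhamelFun (hT : 0 ≤ T) (F : Path L T) : Continuous (duhamelFun hT F) := by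
  have h : Continuous fun t => ∫ τ in 0..t, duhamelIntegrand hT F τ :=
    continuous_iff_continuousAt.2 fun t =>
      (hasDerivAt_integral_duhamelIntegrand hT F t).continuousAt
  exact continuous_schr.comp (continuous_id.prodMk h)

theorem norm_duhamelFun_le (hT : 0 ≤ T) (F : Path L T) {t : ℝ} (ht : 0 ≤ t) :
    ‖duhamelFun hT F t‖ ≤ ∫ τ in 0..t, ‖F (projIcc 0 T hT τ)‖ := by
  rw [duhamelFun, LinearIsometry.norm_map]
  refine (intervalIntegral.norm_integral_le_integral_norm ht).trans (le_of_eq ?_)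
  simp only [norm_duhamelIntegrand]

theorem schr_real_smul (t c : ℝ) (u : H1 L) : schr t (c • u) = c • schr t u :=
  (schr t).map_smul (c : ℂ) u

/-- The Duhamel integral `F ↦ -i ∫₀ᵗ exp (i (t - τ) ∂ₓ² / 2) F(τ) dτ` on paths. -/
def duhamel (hT : 0 ≤ T) : Path L T →L[ℝ] Path L T :=
  LinearMap.mkContinuous
    { toFun := fun F => ⟨fun t => duhamelFun hT F t,
        (continuous_duhamelFun hT F).comp continuous_subtype_val⟩
      map_add' := fun F G => by
        ext1 t
        have e : ∫ τ in 0..(t : ℝ), duhamelIntegrand hT (F + G) τ =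
            (∫ τ in 0..(t : ℝ), duhamelIntegrand hT F τ) +
              ∫ τ in 0..(t : ℝ), duhamelIntegrand hT G τ := by
          rw [← intervalIntegral.integral_add
            ((continuous_duhamelIntegrand hT F).intervalIntegrable _ _)
            ((continuous_duhamelIntegrand hT G).intervalIntegrable _ _)]
          congr 1
          funext τ
          simp only [duhamelIntegrand, ContinuousMap.add_apply, smul_add, map_add]
        change schr _ _ = schr _ _ + schr _ _
        rw [e, map_add]
      map_smul' := fun c F => by
        ext1 t
        have e : ∫ τ in 0..(t : ℝ), duhamelIntegrand hT (c • F) τ =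
            c • ∫ τ in 0..(t : ℝ), duhamelIntegrand hT F τ := by
          rw [← intervalIntegral.integral_smul]
          congr 1
          funext τ
          simp only [duhamelIntegrand, ContinuousMap.smul_apply]
          rw [smul_comm, schr_real_smul]
        change schr _ _ = c • schr _ _
        rw [e, schr_real_smul] }
    T (fun F => by
      refine (ContinuousMap.norm_le _ (by positivity)).2 fun t => ?_
      refine (norm_duhamelFun_le hT F t.2.1).trans ?_
      calc ∫ τ in 0..(t : ℝ), ‖F (projIcc 0 T hT τ)‖ ≤ ∫ τ in 0..(t : ℝ), ‖F‖ := by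
            refine intervalIntegral.integral_mono_on t.2.1 ?_ intervalIntegrable_const
              fun τ _ => F.norm_coe_le_norm _
            exact (F.continuous.comp continuous_projIcc).norm.intervalIntegrable _ _
        _ = t * ‖F‖ := by simp
        _ ≤ T * ‖F‖ := by gcongr; exact t.2.2)

theorem duhamel_apply (hT : 0 ≤ T) (F : Path L T) (t : Icc (0 : ℝ) T) :
    duhamel hT F t = duhamelFun hT F t := rfl

/-- Pointwise multiplication of paths. -/
def mulP : Path L T →L[ℝ] Path L T →L[ℝ] Path L T :=
  LinearMap.mkContinuous₂
    (LinearMap.mk₂ ℝ (fun X Y => (⟨fun t => X t * Y t, X.continuous.mul Y.continuous⟩ : Path L T))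
      (fun X X' Y => by ext1 t; exact congrArg (fun f => f (Y t)) (mulL.map_add (X t) (X' t)))
      (fun c X Y => by ext1 t; exact congrArg (fun f => f (Y t)) (mulL.map_smul c (X t)))
      (fun X Y Y' => by ext1 t; exact (mulL (X t)).map_add (Y t) (Y' t))
      (fun c X Y => by ext1 t; exact (mulL (X t)).map_smul c (Y t)))
    (algConst L) (fun X Y => by
      have := algConst_pos (L := L)
      refine (ContinuousMap.norm_le _ (by positivity)).2 fun t => ?_
      refine (H1.norm_mul_le _ _).trans ?_
      gcongr <;> exact ContinuousMap.norm_coe_le_norm _ _)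

@[simp] theorem mulP_apply (X Y : Path L T) (t : Icc (0 : ℝ) T) : mulP X Y t = X t * Y t := rfl

/-- Pointwise conjugation of paths. -/
def starP : Path L T →L[ℝ] Path L T :=
  LinearMap.mkContinuous
    { toFun := fun X => ⟨fun t => star (X t), starL.continuous.comp X.continuous⟩
      map_add' := fun X Y => by ext1 t; exact starL.map_add (X t) (Y t)
      map_smul' := fun c X => by ext1 t; exact starL.map_smul c (X t) } 1
    (fun X => by
      rw [one_mul]
      refine (ContinuousMap.norm_le _ (norm_nonneg _)).2 fun t => ?_
      exact (H1.norm_star _).trans_le (X.norm_coe_le_norm t))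

@[simp] theorem starP_apply (X : Path L T) (t : Icc (0 : ℝ) T) : starP X t = star (X t) := rfl

/-- Constant paths. -/
def constP : H1 L →L[ℝ] Path L T :=
  LinearMap.mkContinuous
    { toFun := fun V => ContinuousMap.const _ V
      map_add' := fun _ _ => rfl
      map_smul' := fun _ _ => rfl } 1
    (fun V => by
      rw [one_mul]
      exact (ContinuousMap.norm_le _ (norm_nonneg _)).2 fun t => le_rfl)

@[simp] theorem constP_apply (V : H1 L) (t : Icc (0 : ℝ) T) : constP V t = V := rfl

/-- The free evolution of the initial value. -/
def freeP (u₀ : H1 L) : Path L T :=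
  ⟨fun t => schr t u₀, (continuous_schr_left u₀).comp continuous_subtype_val⟩

/-- The nonlinearity on paths. -/
def nonlinP (α : ℝ) (V X : Path L T) : Path L T :=
  mulP V X + α • mulP (mulP X (starP X)) X

theorem nonlinP_apply (α : ℝ) (V X : Path L T) (t : Icc (0 : ℝ) T) :
    nonlinP α V X t = nonlin α (V t) (X t) := by
  simp only [nonlinP, nonlin, ContinuousMap.add_apply, ContinuousMap.smul_apply, mulP_apply,
    starP_apply]

/-- The linearization of the nonlinearity on paths. -/
def linP (α : ℝ) (V X : Path L T) : Path L T →L[ℝ] Path L T :=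
  mulP V + α • (mulP (mulP X (starP X)) +
    (mulP.flip X).comp ((mulP X).comp starP + mulP.flip (starP X)))

theorem linP_apply (α : ℝ) (V X Y : Path L T) (t : Icc (0 : ℝ) T) :
    linP α V X Y t = V t * Y t + α • (X t * star (X t) * Y t +
      (X t * star (Y t) + Y t * star (X t)) * X t) := by
  simp only [linP, _root_.add_apply, _root_.smul_apply,
    ContinuousLinearMap.comp_apply, ContinuousLinearMap.flip_apply, ContinuousMap.add_apply,
    ContinuousMap.smul_apply, mulP_apply, starP_apply]

theorem hasFDerivAt_nonlinP (α : ℝ) (V X : Path L T) :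
    HasFDerivAt (nonlinP α V) (linP α V X) X := by
  have h1 : HasFDerivAt (fun X : Path L T => mulP V X) (mulP V) X := (mulP V).hasFDerivAt
  have h2 := mulP.hasFDerivAt_of_bilinear (hasFDerivAt_id X) (starP.hasFDerivAt (x := X))
  have h3 := mulP.hasFDerivAt_of_bilinear h2 (hasFDerivAt_id X)
  refine (h1.add (h3.const_smul α)).congr_fderiv ?_
  ext1 Y
  ext1 t
  rw [linP_apply]
  simp only [_root_.add_apply, _root_.smul_apply,
    ContinuousLinearMap.precompR_apply, ContinuousLinearMap.precompL_apply,
    ContinuousLinearMap.compL_apply,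
    ContinuousLinearMap.comp_apply, ContinuousLinearMap.coe_id', id, ContinuousMap.add_apply,
    ContinuousMap.smul_apply, mulP_apply, starP_apply]

theorem norm_linP_apply_le (α : ℝ) (V X Y : Path L T) (t : Icc (0 : ℝ) T) :
    ‖linP α V X Y t‖ ≤
      (algConst L * ‖V t‖ + 3 * |α| * algConst L ^ 2 * ‖X t‖ ^ 2) * ‖Y t‖ := by
  have hK := algConst_pos (L := L)
  have h3 : ∀ x y z : H1 L, ‖x * y * z‖ ≤ algConst L ^ 2 * (‖x‖ * ‖y‖ * ‖z‖) := fun x y z => by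
    calc ‖x * y * z‖ ≤ algConst L * ‖x * y‖ * ‖z‖ := H1.norm_mul_le _ _
      _ ≤ algConst L * (algConst L * ‖x‖ * ‖y‖) * ‖z‖ := by
          gcongr; exact H1.norm_mul_le _ _
      _ = _ := by ring
  have e : (X t * star (Y t) + Y t * star (X t)) * X t =
      X t * star (Y t) * X t + Y t * star (X t) * X t :=
    congrArg (fun f => f (X t)) (mulL.map_add _ _)
  rw [linP_apply, e]
  refine (norm_add_le _ _).trans ?_
  rw [norm_smul, Real.norm_eq_abs]
  calc _ ≤ algConst L * ‖V t‖ * ‖Y t‖ + |α| * (algConst L ^ 2 * (‖X t‖ * ‖star (X t)‖ * ‖Y t‖) +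
        (algConst L ^ 2 * (‖X t‖ * ‖star (Y t)‖ * ‖X t‖) +
          algConst L ^ 2 * (‖Y t‖ * ‖star (X t)‖ * ‖X t‖))) := by
        gcongr
        · exact H1.norm_mul_le _ _
        · refine (norm_add_le _ _).trans (add_le_add (h3 _ _ _) ?_)
          exact (norm_add_le _ _).trans (add_le_add (h3 _ _ _) (h3 _ _ _))
    _ = _ := by rw [H1.norm_star, H1.norm_star]; ring

/-- The linearized Duhamel equation is uniquely solvable. -/
theorem isInvertible_linearized (hT : 0 ≤ T) (α : ℝ) (V X : Path L T) :
    (ContinuousLinearMap.id ℝ (Path L T) - (duhamel hT).comp (linP α V X)).IsInvertible := by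
  have hK := algConst_pos (L := L)
  refine isInvertible_one_sub_of_volterra hT
    (K := algConst L * ‖V‖ + 3 * |α| * algConst L ^ 2 * ‖X‖ ^ 2) (by positivity) _ fun Y t => ?_
  rw [ContinuousLinearMap.comp_apply, duhamel_apply]
  refine (norm_duhamelFun_le hT _ t.2.1).trans ?_
  rw [← intervalIntegral.integral_const_mul]
  refine intervalIntegral.integral_mono_on t.2.1 ?_ ?_ fun τ _ => ?_
  · exact ((ContinuousMap.continuous _).comp continuous_projIcc).norm.intervalIntegrable _ _
  · exact (((Y.continuous.comp continuous_projIcc).norm).const_mul _).intervalIntegrable _ _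
  · refine (norm_linP_apply_le α V X Y _).trans ?_
    gcongr <;> exact ContinuousMap.norm_coe_le_norm _ _

end

section

/-! ### Mixed first partial derivatives of smooth functions -/

section MixedPartials

open scoped ContDiff

variable {m : ℕ} {E F G : Type*} [NormedAddCommGroup E] [NormedSpace ℝ E]
  [NormedAddCommGroup F] [NormedSpace ℝ F] [NormedAddCommGroup G] [NormedSpace ℝ G]

/-- The partial derivative in the `j`-th direction of a function on `ℝᵐ`. -/
def pd (j : Fin m) (f : (Fin m → ℝ) → E) (ξ : Fin m → ℝ) : E := fderiv ℝ f ξ (Pi.single j 1)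

theorem contDiff_pd (j : Fin m) {f : (Fin m → ℝ) → E} (hf : ContDiff ℝ ∞ f) :
    ContDiff ℝ ∞ (pd j f) :=
  (hf.fderiv_right (by simp)).clm_apply contDiff_const

theorem pd_comm (i j : Fin m) {f : (Fin m → ℝ) → E} (hf : ContDiff ℝ ∞ f) :
    pd i (pd j f) = pd j (pd i f) := by
  funext ξ
  have h : ∀ v : Fin m → ℝ, HasFDerivAt (fun η => fderiv ℝ f η v)
      ((fderiv ℝ (fderiv ℝ f) ξ).flip v) ξ := fun v =>
    ((hf.fderiv_right (m := ∞) (by simp)).differentiable (by simp) ξ).hasFDerivAt.clm_apply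
      (hasFDerivAt_const v ξ) |>.congr_fderiv (by ext; simp)
  have hs : IsSymmSndFDerivAt ℝ f ξ := hf.contDiffAt.isSymmSndFDerivAt (by
    simpa using (WithTop.coe_le_coe.2 (le_top : (2 : ℕ∞) ≤ ⊤)))
  change fderiv ℝ (fun η => fderiv ℝ f η _) ξ _ = fderiv ℝ (fun η => fderiv ℝ f η _) ξ _
  rw [(h _).fderiv, (h _).fderiv]
  exact hs _ _

/-- The composition of the partial derivatives in the directions `j ∈ S`, taken in the order of the
indices; for smooth functions the order is immaterial by `md_insert`. -/
def md (S : Finset (Fin m)) (f : (Fin m → ℝ) → E) : (Fin m → ℝ) → E :=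
  (List.finRange m).foldr (fun j g => if j ∈ S then pd j g else g) f

theorem contDiff_foldr_pd (S : Finset (Fin m)) (l : List (Fin m)) {f : (Fin m → ℝ) → E}
    (hf : ContDiff ℝ ∞ f) :
    ContDiff ℝ ∞ (l.foldr (fun j g => if j ∈ S then pd j g else g) f) := by
  induction l with
  | nil => exact hf
  | cons i l ih =>
    rw [List.foldr_cons]
    split_ifs
    exacts [contDiff_pd i ih, ih]

theorem contDiff_md (S : Finset (Fin m)) {f : (Fin m → ℝ) → E} (hf : ContDiff ℝ ∞ f) :
    ContDiff ℝ ∞ (md S f) :=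
  contDiff_foldr_pd S _ hf

@[simp] theorem md_empty (f : (Fin m → ℝ) → E) : md ∅ f = f := by
  simp only [md, Finset.notMem_empty, if_false]
  induction List.finRange m with
  | nil => rfl
  | cons i l ih => exact ih

theorem md_insert {S : Finset (Fin m)} {j : Fin m} (hj : j ∉ S) {f : (Fin m → ℝ) → E}
    (hf : ContDiff ℝ ∞ f) : md (insert j S) f = pd j (md S f) := by
  have key : ∀ l : List (Fin m), l.Nodup →
      l.foldr (fun i g => if i ∈ insert j S then pd i g else g) f =
        if j ∈ l then pd j (l.foldr (fun i g => if i ∈ S then pd i g else g) f)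
        else l.foldr (fun i g => if i ∈ S then pd i g else g) f := by
    intro l hl
    induction l with
    | nil => simp
    | cons i l ih =>
      obtain ⟨hi, hl'⟩ := List.nodup_cons.1 hl
      rw [List.foldr_cons, List.foldr_cons, ih hl']
      by_cases hij : i = j
      · subst hij
        simp [hi, hj]
      · have hij' : j ≠ i := Ne.symm hij
        by_cases hjl : j ∈ l <;> by_cases hiS : i ∈ S <;>
          simp only [List.mem_cons, Finset.mem_insert, hij, hij', hjl, hiS, or_true, or_false,
            if_true, if_false]
        exact pd_comm i j (contDiff_foldr_pd S l hf)
  rw [md, key _ (List.nodup_finRange m), if_pos (List.mem_finRange j)]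
  rfl

theorem pd_clm_comp (A : E →L[ℝ] F) (j : Fin m) {f : (Fin m → ℝ) → E} (hf : ContDiff ℝ ∞ f) :
    pd j (fun ξ => A (f ξ)) = fun ξ => A (pd j f ξ) := by
  funext ξ
  have h := A.hasFDerivAt.comp ξ ((hf.differentiable (by simp)) ξ).hasFDerivAt
  change fderiv ℝ (A ∘ f) ξ _ = _
  rw [h.fderiv]
  rfl

theorem md_clm_comp (A : E →L[ℝ] F) (S : Finset (Fin m)) {f : (Fin m → ℝ) → E}
    (hf : ContDiff ℝ ∞ f) : md S (fun ξ => A (f ξ)) = fun ξ => A (md S f ξ) := by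
  induction S using Finset.induction_on with
  | empty => simp
  | insert j S hj ih =>
    rw [md_insert (f := fun ξ => A (f ξ)) hj (A.contDiff.comp hf), ih,
      pd_clm_comp A j (contDiff_md S hf), md_insert hj hf]

theorem pd_add (j : Fin m) {f g : (Fin m → ℝ) → E} (hf : ContDiff ℝ ∞ f)
    (hg : ContDiff ℝ ∞ g) : pd j (fun ξ => f ξ + g ξ) = fun ξ => pd j f ξ + pd j g ξ := by
  funext ξ
  have h := ((hf.differentiable (by simp)) ξ).hasFDerivAt.add
    ((hg.differentiable (by simp)) ξ).hasFDerivAt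
  change fderiv ℝ (f + g) ξ _ = _
  rw [h.fderiv]
  rfl

theorem md_add (S : Finset (Fin m)) {f g : (Fin m → ℝ) → E} (hf : ContDiff ℝ ∞ f)
    (hg : ContDiff ℝ ∞ g) : md S (fun ξ => f ξ + g ξ) = fun ξ => md S f ξ + md S g ξ := by
  induction S using Finset.induction_on with
  | empty => simp
  | insert j S hj ih =>
    rw [md_insert hj (hf.add hg), ih, pd_add j (contDiff_md S hf) (contDiff_md S hg),
      md_insert hj hf, md_insert hj hg]

theorem pd_sum {ι : Type*} (s : Finset ι) (j : Fin m) {f : ι → (Fin m → ℝ) → E}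
    (hf : ∀ i ∈ s, ContDiff ℝ ∞ (f i)) :
    pd j (fun ξ => ∑ i ∈ s, f i ξ) = fun ξ => ∑ i ∈ s, pd j (f i) ξ := by
  funext ξ
  have h := HasFDerivAt.fun_sum (u := s) fun i hi =>
    ((hf i hi).differentiable (by simp) ξ).hasFDerivAt
  rw [pd, h.fderiv, _root_.sum_apply]
  rfl

theorem md_const {S : Finset (Fin m)} (hS : S.Nonempty) (c : E) :
    md S (fun _ : Fin m → ℝ => c) = fun _ => 0 := by
  induction S using Finset.induction_on with
  | empty => exact absurd hS Finset.not_nonempty_empty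
  | insert j S hj ih =>
    rw [md_insert hj contDiff_const]
    have h0 : ∀ c : E, pd j (fun _ : Fin m → ℝ => c) = fun _ => 0 := fun c => by
      funext ξ
      simp [pd]
    rcases S.eq_empty_or_nonempty with rfl | hS'
    · rw [md_empty, h0]
    · rw [ih hS', h0]

theorem pd_bilin (B : E →L[ℝ] F →L[ℝ] G) (j : Fin m) {f : (Fin m → ℝ) → E}
    {g : (Fin m → ℝ) → F} (hf : ContDiff ℝ ∞ f) (hg : ContDiff ℝ ∞ g) :
    pd j (fun ξ => B (f ξ) (g ξ)) = fun ξ => B (f ξ) (pd j g ξ) + B (pd j f ξ) (g ξ) := by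
  funext ξ
  have h := B.hasFDerivAt_of_bilinear ((hf.differentiable (by simp)) ξ).hasFDerivAt
    ((hg.differentiable (by simp)) ξ).hasFDerivAt
  rw [pd, h.fderiv]
  rfl

theorem contDiff_bilin {P : Type*} [NormedAddCommGroup P] [NormedSpace ℝ P]
    (B : E →L[ℝ] F →L[ℝ] G) {f : P → E} {g : P → F} (hf : ContDiff ℝ ∞ f) (hg : ContDiff ℝ ∞ g) :
    ContDiff ℝ ∞ (fun ξ => B (f ξ) (g ξ)) :=
  (B.contDiff.comp hf).clm_apply hg

/-- The Leibniz rule. -/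
theorem md_bilin (B : E →L[ℝ] F →L[ℝ] G) (S : Finset (Fin m)) {f : (Fin m → ℝ) → E}
    {g : (Fin m → ℝ) → F} (hf : ContDiff ℝ ∞ f) (hg : ContDiff ℝ ∞ g) :
    md S (fun ξ => B (f ξ) (g ξ)) =
      fun ξ => ∑ R ∈ S.powerset, B (md R f ξ) (md (S \ R) g ξ) := by
  induction S using Finset.induction_on with
  | empty => simp
  | insert j S hj ih =>
    rw [md_insert hj (contDiff_bilin B hf hg), ih, pd_sum _ _ fun R _ =>
      contDiff_bilin B (contDiff_md R hf) (contDiff_md (S \ R) hg)]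
    funext ξ
    rw [Finset.sum_powerset_insert hj, ← Finset.sum_add_distrib]
    refine Finset.sum_congr rfl fun R hR => ?_
    have hjR : j ∉ R := fun h => hj (Finset.mem_powerset.1 hR h)
    have e1 : insert j S \ R = insert j (S \ R) := Finset.insert_sdiff_of_notMem _ hjR
    have e2 : insert j S \ insert j R = S \ R := by
      ext x
      simp only [Finset.mem_sdiff, Finset.mem_insert]
      grind
    have hjSR : j ∉ S \ R := fun h => hj (Finset.sdiff_subset h)
    rw [e1, e2, md_insert hjSR hg, md_insert hjR hf,
      pd_bilin B j (contDiff_md R hf) (contDiff_md (S \ R) hg)]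

/-- The Leibniz rule for a product whose first factor is an affine function. -/
theorem md_bilin_affine (B : E →L[ℝ] F →L[ℝ] G) (S : Finset (Fin m)) (a : E) (b : Fin m → E)
    {g : (Fin m → ℝ) → F} (hg : ContDiff ℝ ∞ g) :
    md S (fun ξ => B (a + ∑ j, ξ j • b j) (g ξ)) = fun ξ =>
      B (a + ∑ j, ξ j • b j) (md S g ξ) + ∑ j ∈ S, B (b j) (md (S.erase j) g ξ) := by
  have hf : ContDiff ℝ ∞ fun ξ : Fin m → ℝ => a + ∑ j, ξ j • b j := by fun_prop
  have hpf : ∀ i, pd i (fun ξ : Fin m → ℝ => a + ∑ j, ξ j • b j) = fun _ => b i := by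
    intro i
    funext ξ
    have h : HasFDerivAt (fun ξ : Fin m → ℝ => a + ∑ j, ξ j • b j)
        (∑ j, (ContinuousLinearMap.proj (R := ℝ) (φ := fun _ : Fin m => ℝ) j).smulRight (b j)) ξ :=
      (HasFDerivAt.fun_sum (u := Finset.univ) fun j _ =>
        ((ContinuousLinearMap.proj (R := ℝ) (φ := fun _ : Fin m => ℝ) j).hasFDerivAt
          (x := ξ)).smul_const (b j)).const_add a
    rw [pd, h.fderiv, _root_.sum_apply]
    rw [Finset.sum_eq_single i]
    · simp
    · intro j _ hji
      simp [hji]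
    · simp
  induction S using Finset.induction_on with
  | empty => simp
  | insert i S hi ih =>
    rw [md_insert hi (contDiff_bilin B hf hg), ih, pd_add i
      (contDiff_bilin B hf (contDiff_md S hg))
      (ContDiff.sum fun j _ => contDiff_bilin B contDiff_const (contDiff_md (S.erase j) hg)),
      pd_bilin B i hf (contDiff_md S hg), hpf,
      pd_sum _ _ fun j _ => contDiff_bilin B contDiff_const (contDiff_md (S.erase j) hg)]
    funext ξ
    rw [Finset.sum_insert hi, Finset.erase_insert hi, md_insert hi hg, add_assoc]
    refine congrArg₂ _ rfl (congrArg₂ _ rfl (Finset.sum_congr rfl fun j hj => ?_))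
    have hij : i ≠ j := fun h => hi (h ▸ hj)
    have hi' : i ∉ S.erase j := fun h => hi (Finset.mem_of_mem_erase h)
    rw [pd_clm_comp (B (b j)) i (contDiff_md (S.erase j) hg),
      Finset.erase_insert_of_ne hij, md_insert hi' hg]

theorem hasDerivAt_comp_update (j : Fin m) {f : (Fin m → ℝ) → E} (hf : ContDiff ℝ ∞ f)
    (ξ : Fin m → ℝ) :
    HasDerivAt (fun r => f (Function.update ξ j r)) (pd j f ξ) (ξ j) := by
  have h1 : HasFDerivAt f (fderiv ℝ f ξ) (Function.update ξ j (ξ j)) := by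
    rw [Function.update_eq_self]
    exact ((hf.differentiable (by simp)) ξ).hasFDerivAt
  exact h1.comp_hasDerivAt (ξ j) (hasDerivAt_update ξ j (ξ j))

theorem update_mem_Um {ξ : Fin m → ℝ} (hξ : ξ ∈ Um m) (j : Fin m) {r : ℝ}
    (hr : r ∈ Icc (-1 / 2 : ℝ) (1 / 2)) : Function.update ξ j r ∈ Um m := by
  intro i
  rcases eq_or_ne i j with rfl | h
  · simpa using hr
  · simpa [Function.update_of_ne h] using hξ i

theorem partialDeriv_eq_pd {f g : (Fin m → ℝ) → E} (hg : ContDiff ℝ ∞ g)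
    (hfg : EqOn f g (Um m)) (j : Fin m) : EqOn (partialDeriv j f) (pd j g) (Um m) := by
  intro ξ hξ
  have h1 := (hasDerivAt_comp_update j hg ξ).hasDerivWithinAt (s := Icc (-1 / 2) (1 / 2))
  have h2 := h1.congr (f₁ := fun r => f (Function.update ξ j r))
    (fun r hr => hfg (update_mem_Um hξ j hr)) (hfg (update_mem_Um hξ j (hξ j)))
  exact h2.derivWithin (uniqueDiffOn_Icc (by norm_num) _ (hξ j))

/-- On `U_m` the iterated one-sided derivatives of a function with a smooth extension to `ℝᵐ` are
the partial derivatives of the extension. -/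
theorem mixedDeriv_eq_md {f g : (Fin m → ℝ) → E} (hg : ContDiff ℝ ∞ g) (hfg : EqOn f g (Um m))
    {ν : Fin m → ℕ} (hν : ν ∈ Gam m) :
    EqOn (mixedDeriv ν f) (md {j | ν j = 1} g) (Um m) := by
  rw [mixedDeriv, md]
  induction List.finRange m with
  | nil => exact hfg
  | cons i l ih =>
    rw [List.foldr_cons, List.foldr_cons]
    rcases hν i with h | h
    · simpa [h] using ih
    · simpa [h] using partialDeriv_eq_pd (contDiff_foldr_pd _ l hg) ih i

theorem hasDerivWithinAt_mixedDeriv {f g : (Fin m → ℝ) → E} (hg : ContDiff ℝ ∞ g)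
    (hfg : EqOn f g (Um m)) {μ : Fin m → ℕ} (hμ : μ ∈ Gam m) {j : Fin m} (hj : μ j = 0)
    {ξ : Fin m → ℝ} (hξ : ξ ∈ Um m) :
    HasDerivWithinAt (fun r => mixedDeriv μ f (Function.update ξ j r))
      (mixedDeriv (Function.update μ j 1) f ξ) (Icc (-1 / 2) (1 / 2)) (ξ j) := by
  have hμ' : Function.update μ j 1 ∈ Gam m := by
    intro i
    rcases eq_or_ne i j with rfl | h
    · simp
    · simpa [Function.update_of_ne h] using hμ i
  have e : (Finset.univ.filter fun i => Function.update μ j 1 i = 1) =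
      insert j (Finset.univ.filter fun i => μ i = 1) := by
    ext i
    rcases eq_or_ne i j with rfl | h
    · simp
    · simp [h]
  have h := mixedDeriv_eq_md hg hfg hμ
  rw [mixedDeriv_eq_md hg hfg hμ' hξ, e, md_insert (by simp [hj]) hg]
  exact ((hasDerivAt_comp_update j (contDiff_md _ hg) ξ).hasDerivWithinAt).congr
    (fun r hr => h (update_mem_Um hξ j hr)) (h (update_mem_Um hξ j (hξ j)))

end MixedPartials

end

section

/-! ### The combinatorics of the bounds -/

/-- The exponent `(n + 2) (n - 1) / 2`, set to `0` for `n = 0`. -/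
def expo : ℕ → ℕ
  | 0 => 0
  | n + 1 => n * (n + 3) / 2

theorem two_mul_expo (n : ℕ) : 2 * expo (n + 1) = n * (n + 3) := by
  have h : 2 ∣ n * (n + 3) := by
    rcases Nat.even_or_odd n with h | h
    · exact (h.mul_right _).two_dvd
    · exact ((h.add_odd (by decide : Odd 3)).mul_left _).two_dvd
  rw [expo, Nat.mul_div_cancel' h]

theorem expo_succ (n : ℕ) : expo (n + 2) = expo (n + 1) + (n + 2) := by
  have h1 := two_mul_expo n
  have h2 := two_mul_expo (n + 1)
  nlinarith

theorem expo_add_le (a b : ℕ) : expo (a + 1) + expo (b + 1) ≤ expo (a + b + 1) := by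
  have h1 := two_mul_expo a
  have h2 := two_mul_expo b
  have h3 := two_mul_expo (a + b)
  nlinarith [Nat.zero_le (a * b)]

theorem expo_mono : Monotone expo := by
  refine monotone_nat_of_le_succ fun n => ?_
  cases n with
  | zero => simp [expo]
  | succ n => rw [expo_succ]; omega

theorem cast_expo {n : ℕ} (hn : n ≠ 0) : (expo n : ℝ) = ((n : ℝ) + 2) * ((n : ℝ) - 1) / 2 := by
  obtain ⟨k, rfl⟩ := Nat.exists_eq_succ_of_ne_zero hn
  have h : (2 : ℝ) * expo (k + 1) = k * (k + 3) := by exact_mod_cast two_mul_expo k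
  push_cast
  linarith

/-- The bound on an `n`-th order derivative in terms of `M` and `C`, without the norms of the
directions. For `n = 0` it is a bound on the solution itself. -/
def derivBound (C M : ℝ) (n : ℕ) : ℝ :=
  if n = 0 then M else 3 ^ expo n * C ^ (2 * n - 1)

theorem derivBound_nonneg {C M : ℝ} (hC : 1 ≤ C) (hM : 1 ≤ M) (n : ℕ) :
    0 ≤ derivBound C M n := by
  rw [derivBound]
  split_ifs <;> positivity

theorem derivBound_succ (C M : ℝ) (n : ℕ) :
    derivBound C M (n + 1) = 3 ^ expo (n + 1) * C ^ (2 * n + 1) := by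
  rw [derivBound, if_neg n.succ_ne_zero]; rfl

theorem derivBound_pred_le {C M : ℝ} (hC : 1 ≤ C) (hM : 1 ≤ M) (n : ℕ) :
    derivBound C M n ≤ M * (3 ^ expo n * C ^ (2 * n)) := by
  cases n with
  | zero => simp [derivBound, expo]
  | succ n =>
    rw [derivBound_succ]
    have h1 : C ^ (2 * n + 1) ≤ C ^ (2 * (n + 1)) := pow_le_pow_right₀ hC (by omega)
    calc (3 : ℝ) ^ expo (n + 1) * C ^ (2 * n + 1)
        ≤ 1 * (3 ^ expo (n + 1) * C ^ (2 * (n + 1))) := by rw [one_mul]; gcongr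
      _ ≤ _ := by gcongr

theorem derivBound_mul_le {C M : ℝ} (hC : 1 ≤ C) {a b : ℕ} :
    derivBound C M (a + 1) * derivBound C M (b + 1) ≤
      3 ^ expo (a + b + 1) * C ^ (2 * (a + b + 1)) := by
  rw [derivBound_succ, derivBound_succ]
  calc _ = (3 : ℝ) ^ (expo (a + 1) + expo (b + 1)) * C ^ (2 * (a + b + 1)) := by
        rw [pow_add]; ring
    _ ≤ _ := by
        gcongr
        · norm_num
        · exact expo_add_le a b

/-- In the cubic terms of the equation for an `n`-th order derivative which do not contain a
derivative of this order, at least two of the three factors are differentiated. -/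
theorem derivBound_mul_mul_le {C M : ℝ} (hC : 1 ≤ C) (hM : 1 ≤ M) {n a b c : ℕ}
    (h : a + b + c = n + 1) (ha : a ≤ n) (hb : b ≤ n) (hc : c ≤ n) :
    derivBound C M a * derivBound C M b * derivBound C M c ≤
      M * (3 ^ expo n * C ^ (2 * n)) := by
  have h0 : derivBound C M 0 = M := rfl
  have hM0 : 0 ≤ M := by positivity
  have two : ∀ {a b : ℕ}, a + b = n + 1 → a ≤ n → b ≤ n →
      derivBound C M a * derivBound C M b ≤ 3 ^ expo n * C ^ (2 * n) := by
    intro a b h ha hb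
    obtain ⟨a, rfl⟩ := Nat.exists_eq_succ_of_ne_zero (show a ≠ 0 by omega)
    obtain ⟨b, rfl⟩ := Nat.exists_eq_succ_of_ne_zero (show b ≠ 0 by omega)
    obtain rfl : a + b + 1 = n := by omega
    exact derivBound_mul_le hC
  rcases Nat.eq_zero_or_pos a with rfl | ha'
  · rw [h0, mul_assoc]
    exact mul_le_mul_of_nonneg_left (two (by omega) hb hc) hM0
  rcases Nat.eq_zero_or_pos b with rfl | hb'
  · rw [h0, mul_comm _ M, mul_assoc]
    exact mul_le_mul_of_nonneg_left (two (by omega) ha hc) hM0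
  rcases Nat.eq_zero_or_pos c with rfl | hc'
  · rw [h0, mul_comm _ M]
    exact mul_le_mul_of_nonneg_left (two (by omega) ha hb) hM0
  obtain ⟨a, rfl⟩ := Nat.exists_eq_succ_of_ne_zero ha'.ne'
  obtain ⟨b, rfl⟩ := Nat.exists_eq_succ_of_ne_zero hb'.ne'
  obtain ⟨c, rfl⟩ := Nat.exists_eq_succ_of_ne_zero hc'.ne'
  have h1 : expo (a + 1) + expo (b + 1) + expo (c + 1) ≤ expo n := by
    have h2 := expo_add_le a b
    have h3 := expo_add_le (a + b) c
    have h4 : expo (a + b + c + 1) ≤ expo n := expo_mono (by omega)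
    omega
  simp only [Nat.succ_eq_add_one, derivBound_succ]
  calc _ = (3 : ℝ) ^ (expo (a + 1) + expo (b + 1) + expo (c + 1)) *
        C ^ (2 * a + 1 + (2 * b + 1) + (2 * c + 1)) := by
        rw [pow_add, pow_add, pow_add, pow_add]; ring
    _ ≤ 3 ^ expo n * C ^ (2 * n) := by
        gcongr
        · norm_num
        · omega
    _ ≤ _ := le_mul_of_one_le_left (by positivity) hM

/-- The number of terms in the equation for a derivative of order `n + 1` fits the recursion
`expo (n + 1) = expo n + (n + 1)`. For `n = 0`, where this recursion fails, no cubic terms of lower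
order are present. -/
theorem card_mul_le_expo {n : ℕ} :
    ((n + 1 : ℕ) : ℝ) * 3 ^ expo n + (if n = 0 then 0 else 3 ^ (n + 1)) * 3 ^ expo n ≤
      2 * 3 ^ expo (n + 1) := by
  cases n with
  | zero => simp [expo]
  | succ n =>
    rw [if_neg n.succ_ne_zero, expo_succ, pow_add (3 : ℝ) _ (n + 2), ← add_mul]
    have h : ((n + 1 + 1 : ℕ) : ℝ) ≤ 3 ^ (n + 2) := by
      exact_mod_cast (Nat.lt_pow_self (by norm_num : 1 < 3)).le
    calc _ ≤ ((3 : ℝ) ^ (n + 2) + 3 ^ (n + 2)) * 3 ^ expo (n + 1) := by gcongr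
      _ = _ := by ring

section

variable {ι : Type*} [DecidableEq ι]

/-- The cubic terms in the equation for the derivative of order `S`. There are `3 ^ (n + 1)` of
them; three contain the derivative of order `S` itself, and for `n = 0` there are no others. -/
theorem sum_cubic_le {C M N : ℝ} (hC : 1 ≤ C) (hN : 0 ≤ N) (hM : 1 ≤ M)
    {S : Finset ι} {n : ℕ} (hn : S.card = n + 1) {w : ι → ℝ} (hw : ∀ j, 0 ≤ w j)
    {x : Finset ι → ℝ} (hx : ∀ R, 0 ≤ x R) (hxN : x ∅ ≤ N)
    (hxS : ∀ R, R ⊂ S → x R ≤ derivBound C M R.card * ∏ j ∈ R, w j) :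
    ∑ R ∈ S.powerset, ∑ Q ∈ R.powerset, x Q * x (R \ Q) * x (S \ R) ≤
      3 * N ^ 2 * x S + (if n = 0 then 0 else 3 ^ (n + 1)) *
        (M * (3 ^ expo n * C ^ (2 * n)) * ∏ j ∈ S, w j) := by
  have hP : ∀ R : Finset ι, 0 ≤ ∏ j ∈ R, w j := fun R => Finset.prod_nonneg fun j _ => hw j
  set D : ℝ := M * (3 ^ expo n * C ^ (2 * n)) * ∏ j ∈ S, w j with hD
  have hD0 : 0 ≤ D := by have := hP S; positivity
  set Y : ℝ := N ^ 2 * x S with hY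
  have hY0 : 0 ≤ Y := by have := hx S; positivity
  set D' : ℝ := if n = 0 then 0 else D with hD'
  have hD'0 : 0 ≤ D' := by rw [hD']; split_ifs <;> simp [hD0]
  have hSne : S ≠ ∅ := by rintro rfl; simp at hn
  have hxN2 : x ∅ * x ∅ ≤ N ^ 2 := by rw [sq]; gcongr; exact hx _
  have hbd : ∀ R, R ⊆ S → R ≠ S → x R ≤ derivBound C M R.card * ∏ j ∈ R, w j := fun R h h' =>
    hxS R (Finset.ssubset_iff_subset_ne.2 ⟨h, h'⟩)
  have hcard : ∀ R, R ⊆ S → R ≠ S → R.card ≤ n := fun R h h' => by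
    have := Finset.card_lt_card (Finset.ssubset_iff_subset_ne.2 ⟨h, h'⟩)
    omega
  have hgen : ∀ Q R, Q ⊆ R → R ⊆ S → Q ≠ S → R \ Q ≠ S → S \ R ≠ S →
      x Q * x (R \ Q) * x (S \ R) ≤ D' := by
    intro Q R hQR hRS h1 h2 h3
    have hc2 : (R \ Q).card + Q.card = R.card := Finset.card_sdiff_add_card_eq_card hQR
    have hc3 : (S \ R).card + R.card = S.card := Finset.card_sdiff_add_card_eq_card hRS
    have s1 := hQR.trans hRS
    have s2 : R \ Q ⊆ S := Finset.sdiff_subset.trans hRS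
    have s3 : S \ R ⊆ S := Finset.sdiff_subset
    have k1 := hcard _ s1 h1
    have k2 := hcard _ s2 h2
    have k3 := hcard _ s3 h3
    rw [hD', if_neg (by omega)]
    have hd := derivBound_nonneg hC hM
    calc _ ≤ (derivBound C M Q.card * ∏ j ∈ Q, w j) *
          (derivBound C M (R \ Q).card * ∏ j ∈ R \ Q, w j) *
          (derivBound C M (S \ R).card * ∏ j ∈ S \ R, w j) := by
          have b1 := hbd _ s1 h1
          have b2 := hbd _ s2 h2
          have b3 := hbd _ s3 h3
          have n1 := hx Q
          have n2 := hx (R \ Q)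
          have n3 := hx (S \ R)
          exact mul_le_mul (mul_le_mul b1 b2 n2 (n1.trans b1)) b3 n3
            (mul_nonneg (n1.trans b1) (n2.trans b2))
      _ = derivBound C M Q.card * derivBound C M (R \ Q).card * derivBound C M (S \ R).card *
          ∏ j ∈ S, w j := by
          rw [← Finset.prod_sdiff hRS, ← Finset.prod_sdiff hQR]
          ring
      _ ≤ D := by
          rw [hD]
          exact mul_le_mul_of_nonneg_right (derivBound_mul_mul_le hC hM (by omega) k1 k2 k3) (hP S)
  -- Only three pairs `(Q, R)` lead to a factor with a derivative of order `S`.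
  have hterm : ∀ R ∈ S.powerset, ∀ Q ∈ R.powerset, x Q * x (R \ Q) * x (S \ R) ≤
      ((if R = ∅ then (if Q = ∅ then Y else 0) else 0) +
        (if R = S then (if Q = ∅ then Y else 0) else 0) +
        (if R = S then (if Q = S then Y else 0) else 0)) + D' := by
    intro R hR Q hQ
    rw [Finset.mem_powerset] at hR hQ
    rcases eq_or_ne R ∅ with rfl | hR0
    · obtain rfl : Q = ∅ := Finset.subset_empty.1 hQ
      simp only [if_true, Finset.sdiff_empty, Ne.symm hSne, if_false]
      have := mul_le_mul_of_nonneg_right hxN2 (hx S)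
      linarith
    rcases eq_or_ne R S with rfl | hRS
    · rcases eq_or_ne Q ∅ with rfl | hQ0
      · simp only [hR0, Ne.symm hR0, if_true, if_false, Finset.sdiff_empty, Finset.sdiff_self]
        have := mul_le_mul_of_nonneg_right hxN2 (hx R)
        linarith
      rcases eq_or_ne Q R with rfl | hQR
      · simp only [hR0, if_true, if_false, Finset.sdiff_self]
        have := mul_le_mul_of_nonneg_right hxN2 (hx Q)
        linarith
      simp only [hR0, hQ0, hQR, if_true, if_false, add_zero, zero_add]
      refine hgen Q R hQ hR hQR ?_ (by simpa using hR0.symm)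
      grind
    · simp only [hR0, hRS, if_false, add_zero, zero_add]
      exact hgen Q R hQ hR (by grind) (by grind) (by grind)
  calc _ ≤ ∑ R ∈ S.powerset, ∑ Q ∈ R.powerset,
        (((if R = ∅ then (if Q = ∅ then Y else 0) else 0) +
        (if R = S then (if Q = ∅ then Y else 0) else 0) +
        (if R = S then (if Q = S then Y else 0) else 0)) + D') :=
        Finset.sum_le_sum fun R hR => Finset.sum_le_sum fun Q hQ => hterm R hR Q hQ
    _ = 3 * Y + 3 ^ (n + 1) * D' := by
        simp only [Finset.sum_add_distrib]
        have e1 : ∑ R ∈ S.powerset, ∑ Q ∈ R.powerset,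
            (if R = ∅ then (if Q = ∅ then Y else 0) else 0) = Y := by
          rw [Finset.sum_eq_single ∅ (by intro R _ h; simp [h]) (by simp)]
          simp
        have e2 : ∑ R ∈ S.powerset, ∑ Q ∈ R.powerset,
            (if R = S then (if Q = ∅ then Y else 0) else 0) = Y := by
          rw [Finset.sum_eq_single S (by intro R _ h; simp [h]) (by simp)]
          simp
        have e3 : ∑ R ∈ S.powerset, ∑ Q ∈ R.powerset,
            (if R = S then (if Q = S then Y else 0) else 0) = Y := by
          rw [Finset.sum_eq_single S (by intro R _ h; simp [h]) (by simp)]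
          simp
        have e4 : ∑ R ∈ S.powerset, ∑ Q ∈ R.powerset, D' = 3 ^ (n + 1) * D' := by
          simp only [Finset.sum_const, Finset.card_powerset, nsmul_eq_mul]
          rw [← Finset.sum_mul]
          have h := Finset.sum_pow_mul_eq_add_pow (2 : ℝ) 1 S
          rw [hn] at h
          norm_num at h
          push_cast
          rw [h]
        rw [e1, e2, e3, e4]
        ring
    _ = _ := by
        rw [hY, hD']
        split_ifs <;> ring

/-- The terms in the equation for the derivative of order `S` which stem from differentiating the
potential. -/
theorem sum_linear_le {C M : ℝ} (hC : 1 ≤ C) (hM : 1 ≤ M)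
    {S : Finset ι} {n : ℕ} (hn : S.card = n + 1) {w : ι → ℝ} (hw : ∀ j, 0 ≤ w j)
    {x : Finset ι → ℝ} (hxS : ∀ R, R ⊂ S → x R ≤ derivBound C M R.card * ∏ j ∈ R, w j) :
    ∑ j ∈ S, w j * x (S.erase j) ≤
      (n + 1 : ℕ) * (M * (3 ^ expo n * C ^ (2 * n)) * ∏ j ∈ S, w j) := by
  rw [← hn, ← nsmul_eq_mul, ← Finset.sum_const]
  refine Finset.sum_le_sum fun j hj => ?_
  have h1 := hxS _ (Finset.erase_ssubset hj)
  have h2 : (S.erase j).card = n := by rw [Finset.card_erase_of_mem hj, hn]; rfl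
  rw [h2] at h1
  have hP : 0 ≤ ∏ i ∈ S.erase j, w i := Finset.prod_nonneg fun i _ => hw i
  calc w j * x (S.erase j) ≤ w j * (derivBound C M n * ∏ i ∈ S.erase j, w i) :=
        mul_le_mul_of_nonneg_left h1 (hw j)
    _ = derivBound C M n * ∏ i ∈ S, w i := by rw [← Finset.mul_prod_erase S w hj]; ring
    _ ≤ _ := mul_le_mul_of_nonneg_right (derivBound_pred_le hC hM n)
        (Finset.prod_nonneg fun i _ => hw i)

/-- The right-hand side of the equation for the derivative of order `S` is controlled by this
derivative, with a constant which does not depend on `S`, and by those of lower order. -/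
theorem source_le {A C₀ α NV C M N vN : ℝ} (hA : 0 ≤ A) (hA1 : A ≤ C₀) (hA2 : A ^ 2 ≤ C₀)
    (hC : 1 ≤ C) (hN : 0 ≤ N) (hM : 1 ≤ M) (hvN0 : 0 ≤ vN) (hvN : vN ≤ NV)
    {S : Finset ι} {n : ℕ} (hn : S.card = n + 1) {w : ι → ℝ} (hw : ∀ j, 0 ≤ w j)
    {x : Finset ι → ℝ} (hx : ∀ R, 0 ≤ x R) (hxN : x ∅ ≤ N)
    (hxS : ∀ R, R ⊂ S → x R ≤ derivBound C M R.card * ∏ j ∈ R, w j) :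
    A * vN * x S + A * ∑ j ∈ S, w j * x (S.erase j) +
        |α| * (A ^ 2 * ∑ R ∈ S.powerset, ∑ Q ∈ R.powerset, x Q * x (R \ Q) * x (S \ R)) ≤
      C₀ * (NV + 3 * |α| * N ^ 2) * x S +
        2 * max 1 |α| * C₀ * M * (3 ^ expo (n + 1) * C ^ (2 * n)) * ∏ j ∈ S, w j := by
  have hC₀ : 0 ≤ C₀ := hA.trans hA1
  have hα := abs_nonneg α
  have hP : 0 ≤ ∏ j ∈ S, w j := Finset.prod_nonneg fun j _ => hw j
  have h1 := sum_linear_le hC hM hn hw hxS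
  have h2 := sum_cubic_le hC hN hM hn hw hx hxN hxS
  have hxS0 := hx S
  have h0 : A * vN * x S ≤ C₀ * NV * x S := by gcongr
  set c : ℝ := if n = 0 then 0 else 3 ^ (n + 1) with hc
  have hc0 : 0 ≤ c := by rw [hc]; split_ifs <;> positivity
  set G : ℝ := M * (3 ^ expo n * C ^ (2 * n)) * ∏ j ∈ S, w j with hG
  have hG0 : 0 ≤ G := by positivity
  have hl0 : 0 ≤ ∑ j ∈ S, w j * x (S.erase j) :=
    Finset.sum_nonneg fun j _ => mul_nonneg (hw j) (hx _)
  have hc0' : 0 ≤ ∑ R ∈ S.powerset, ∑ Q ∈ R.powerset, x Q * x (R \ Q) * x (S \ R) :=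
    Finset.sum_nonneg fun R _ => Finset.sum_nonneg fun Q _ =>
      mul_nonneg (mul_nonneg (hx _) (hx _)) (hx _)
  calc _ ≤ C₀ * NV * x S + C₀ * ((n + 1 : ℕ) * G) +
        |α| * (C₀ * (3 * N ^ 2 * x S + c * G)) := by gcongr
    _ ≤ C₀ * NV * x S + max 1 |α| * (C₀ * ((n + 1 : ℕ) * G)) +
        (|α| * (C₀ * (3 * N ^ 2 * x S)) + max 1 |α| * (C₀ * (c * G))) := by
        have h3 : C₀ * ((n + 1 : ℕ) * G) ≤ max 1 |α| * (C₀ * ((n + 1 : ℕ) * G)) :=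
          le_mul_of_one_le_left (by positivity) (le_max_left _ _)
        have h4 : |α| * (C₀ * (c * G)) ≤ max 1 |α| * (C₀ * (c * G)) := by
          gcongr
          exact le_max_right _ _
        linarith
    _ = C₀ * (NV + 3 * |α| * N ^ 2) * x S + max 1 |α| * C₀ * M *
        ((((n + 1 : ℕ) : ℝ) * 3 ^ expo n + c * 3 ^ expo n) * C ^ (2 * n)) * ∏ j ∈ S, w j := by
        rw [hG]; ring
    _ ≤ C₀ * (NV + 3 * |α| * N ^ 2) * x S + max 1 |α| * C₀ * M *
        ((2 * 3 ^ expo (n + 1)) * C ^ (2 * n)) * ∏ j ∈ S, w j := by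
        have h5 : ((n + 1 : ℕ) : ℝ) * 3 ^ expo n + c * 3 ^ expo n ≤ 2 * 3 ^ expo (n + 1) :=
          card_mul_le_expo
        have h6 : 0 ≤ max 1 |α| := le_max_of_le_left zero_le_one
        gcongr
    _ = _ := by ring

end

end

section

/-! ### The derivatives of the solution with respect to the parameters -/

section Parametric

open scoped ContDiff

variable {L : ℝ} [hL : Fact (0 < 2 * L)] {T : ℝ} {m : ℕ}

theorem duhamelIntegrand_nonlinP (hT : 0 ≤ T) (α : ℝ) (V : H1 L) (X : Path L T) :
    duhamelIntegrand hT (nonlinP α (constP V) X) = drift α V (fun t => X (projIcc 0 T hT t)) := by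
  funext τ
  rw [duhamelIntegrand, nonlinP_apply, constP_apply, drift]

/-- Mild solutions are the fixed points of the Duhamel map on paths. -/
theorem isMild_iff (hT : 0 ≤ T) (α : ℝ) (V u₀ : H1 L) (X : Path L T) :
    IsMild α V u₀ T (fun t => X (projIcc 0 T hT t)) ↔
      X = freeP u₀ + duhamel hT (nonlinP α (constP V) X) := by
  have key : ∀ t : Icc (0 : ℝ) T, schr t (profile α V u₀ (fun t => X (projIcc 0 T hT t)) t) =
      (freeP u₀ + duhamel hT (nonlinP α (constP V) X) : Path L T) t := by
    intro t
    rw [ContinuousMap.add_apply, duhamel_apply, duhamelFun, duhamelIntegrand_nonlinP, profile,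
      map_add]
    rfl
  constructor
  · intro h
    ext1 t
    rw [← key, ← h.eq t t.2, projIcc_val]
  · intro h
    refine ⟨X.continuous.comp continuous_projIcc, fun t ht => ?_⟩
    have h1 := key ⟨t, ht⟩
    rw [← h] at h1
    rw [h1, projIcc_of_mem hT ht]

/-- The restriction of a mild solution to `[0, T]`. -/
def IsMild.path {α : ℝ} {V u₀ : H1 L} {u : ℝ → H1 L} (h : IsMild α V u₀ T u) : Path L T :=
  ⟨fun t => u t, h.cont.comp continuous_subtype_val⟩

theorem IsMild.path_eq {α : ℝ} {V u₀ : H1 L} {u : ℝ → H1 L} (hT : 0 ≤ T)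
    (h : IsMild α V u₀ T u) :
    h.path = freeP u₀ + duhamel hT (nonlinP α (constP V) h.path) := by
  refine (isMild_iff hT α V u₀ _).1 (h.congr
    (h.path.continuous.comp continuous_projIcc) fun t ht => ?_)
  rw [projIcc_of_mem hT ht]
  rfl

theorem IsMild.path_unique {α : ℝ} {V u₀ : H1 L} {u : ℝ → H1 L} (hT : 0 ≤ T)
    (h : IsMild α V u₀ T u) {X : Path L T}
    (hX : X = freeP u₀ + duhamel hT (nonlinP α (constP V) X)) : X = h.path := by
  ext1 t
  have h1 := IsMild.unique ((isMild_iff hT α V u₀ X).2 hX) h t.2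
  change X (projIcc 0 T hT t) = _ at h1
  rwa [projIcc_val] at h1

theorem contDiff_nonlinP (α : ℝ) {P : Type*} [NormedAddCommGroup P] [NormedSpace ℝ P]
    {V X : P → Path L T} (hV : ContDiff ℝ ∞ V) (hX : ContDiff ℝ ∞ X) :
    ContDiff ℝ ∞ fun p => nonlinP α (V p) (X p) := by
  have h1 : ContDiff ℝ ∞ fun p => mulP (V p) (X p) := contDiff_bilin mulP hV hX
  have h2 : ContDiff ℝ ∞ fun p => mulP (X p) (starP (X p)) :=
    contDiff_bilin mulP hX (starP.contDiff.comp hX)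
  have h3 : ContDiff ℝ ∞ fun p => mulP (mulP (X p) (starP (X p))) (X p) :=
    contDiff_bilin mulP h2 hX
  exact h1.add (h3.const_smul α)

/-- By the implicit function theorem, the solution depends smoothly on the parameters of the
potential. -/
theorem contDiff_path (hT : 0 ≤ T) (α : ℝ) (u₀ : H1 L) {V : (Fin m → ℝ) → H1 L}
    (hV : ContDiff ℝ ∞ V) {u : (Fin m → ℝ) → ℝ → H1 L} (hu : ∀ ξ, IsMild α (V ξ) u₀ T (u ξ)) :
    ContDiff ℝ ∞ fun ξ => (hu ξ).path := by
  set f : (Fin m → ℝ) × Path L T → Path L T := fun p =>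
    p.2 - (freeP u₀ + duhamel hT (nonlinP α (constP (V p.1)) p.2)) with hf
  have hfs : ContDiff ℝ ∞ f := by
    refine contDiff_snd.sub (contDiff_const.add ((duhamel hT).contDiff.comp ?_))
    exact contDiff_nonlinP α (constP.contDiff.comp (hV.comp contDiff_fst)) contDiff_snd
  rw [contDiff_iff_contDiffAt]
  intro ξ
  set p : (Fin m → ℝ) × Path L T := (ξ, (hu ξ).path) with hp
  have hp0 : f p = 0 := sub_eq_zero.2 ((hu ξ).path_eq hT)
  have hinv : (fderiv ℝ f p ∘L ContinuousLinearMap.inr ℝ (Fin m → ℝ) (Path L T)).IsInvertible := by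
    have h1 : HasFDerivAt (fun X => f (ξ, X))
        (fderiv ℝ f p ∘L ContinuousLinearMap.inr ℝ (Fin m → ℝ) (Path L T)) (hu ξ).path :=
      ((hfs.differentiable (by simp)) p).hasFDerivAt.comp _ (hasFDerivAt_prodMk_right ξ _)
    have h2 : HasFDerivAt (fun X => f (ξ, X))
        (ContinuousLinearMap.id ℝ (Path L T) -
          (duhamel hT).comp (linP α (constP (V ξ)) (hu ξ).path)) (hu ξ).path :=
      (hasFDerivAt_id _).sub (((duhamel hT).hasFDerivAt.comp _
        (hasFDerivAt_nonlinP α (constP (V ξ)) (hu ξ).path)).const_add (freeP u₀))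
    rw [h1.unique h2]
    exact isInvertible_linearized hT α _ _
  have hcd : ContDiffAt ℝ ∞ f p := hfs.contDiffAt
  refine (hcd.contDiffAt_implicitFunction (by simp) hinv).congr_of_eventuallyEq ?_
  -- The implicit function yields solutions, so that uniqueness identifies it with `u`.
  filter_upwards [hcd.eventually_apply_implicitFunction (by simp) hinv] with η hη
  rw [hp0] at hη
  exact ((hu η).path_unique hT (sub_eq_zero.1 hη)).symm

/-- The inhomogeneous linear equation satisfied by the derivatives of the solution. -/
theorem md_path_eq (hT : 0 ≤ T) (α : ℝ) (u₀ : H1 L) (V₀ : H1 L) (W : Fin m → H1 L)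
    {X : (Fin m → ℝ) → Path L T} (hXs : ContDiff ℝ ∞ X)
    (hX : ∀ ξ, X ξ = freeP u₀ + duhamel hT (nonlinP α (constP (V₀ + ∑ j, ξ j • W j)) (X ξ)))
    {S : Finset (Fin m)} (hS : S.Nonempty) (ξ : Fin m → ℝ) :
    md S X ξ = duhamel hT
      (mulP (constP (V₀ + ∑ j, ξ j • W j)) (md S X ξ) +
        ∑ j ∈ S, mulP (constP (W j)) (md (S.erase j) X ξ) +
        α • ∑ R ∈ S.powerset, mulP (∑ Q ∈ R.powerset, mulP (md Q X ξ) (starP (md (R \ Q) X ξ)))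
          (md (S \ R) X ξ)) := by
  have hV : ContDiff ℝ ∞ fun ξ : Fin m → ℝ => V₀ + ∑ j, ξ j • W j := by fun_prop
  have hN : ContDiff ℝ ∞ fun ξ => nonlinP α (constP (V₀ + ∑ j, ξ j • W j)) (X ξ) :=
    contDiff_nonlinP α (constP.contDiff.comp hV) hXs
  have hstar : ContDiff ℝ ∞ fun ξ => starP (X ξ) := starP.contDiff.comp hXs
  have h2 : ContDiff ℝ ∞ fun ξ => mulP (X ξ) (starP (X ξ)) := contDiff_bilin mulP hXs hstar
  have h3 : ContDiff ℝ ∞ fun ξ => mulP (mulP (X ξ) (starP (X ξ))) (X ξ) :=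
    contDiff_bilin mulP h2 hXs
  have e : md S X = md S fun ξ =>
      freeP u₀ + duhamel hT (nonlinP α (constP (V₀ + ∑ j, ξ j • W j)) (X ξ)) :=
    congrArg _ (funext hX)
  have e' : md S X ξ =
      duhamel hT (md S (fun ξ => nonlinP α (constP (V₀ + ∑ j, ξ j • W j)) (X ξ)) ξ) := by
    have h4 := md_add S (contDiff_const (c := freeP (T := T) u₀)) ((duhamel hT).contDiff.comp hN)
    rw [e]
    refine (congrFun h4 ξ).trans ?_
    rw [md_const hS, zero_add]
    exact congrFun (md_clm_comp (duhamel hT) S hN) ξ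
  refine e'.trans (congrArg _ ?_)
  have e1 : md S (fun ξ => nonlinP α (constP (V₀ + ∑ j, ξ j • W j)) (X ξ)) = fun ξ =>
      md S (fun ξ => (mulP.comp constP) (V₀ + ∑ j, ξ j • W j) (X ξ)) ξ +
        md S (fun ξ => (α • ContinuousLinearMap.id ℝ (Path L T))
          (mulP (mulP (X ξ) (starP (X ξ))) (X ξ))) ξ :=
    md_add S (contDiff_bilin (mulP.comp constP) hV hXs) (h3.const_smul α)
  rw [e1, md_bilin_affine _ S V₀ W hXs, md_clm_comp _ S h3, md_bilin mulP S h2 hXs]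
  have e2 : ∀ R : Finset (Fin m), md R (fun ξ => mulP (X ξ) (starP (X ξ))) = fun ξ =>
      ∑ Q ∈ R.powerset, mulP (md Q X ξ) (starP (md (R \ Q) X ξ)) := fun R => by
    rw [md_bilin mulP R hXs hstar]
    simp only [md_clm_comp starP _ hXs]
  simp only [e2]
  rfl

/-- A Grönwall estimate for Duhamel's formula. -/
theorem norm_duhamel_le (hT : 0 ≤ T) {F Y : Path L T} (hY : Y = duhamel hT F) {K ε : ℝ}
    (hK : 0 ≤ K) (hε : 0 ≤ ε) (hF : ∀ t, ‖F t‖ ≤ K * ‖Y t‖ + ε) (t : Icc (0 : ℝ) T) :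
    ‖Y t‖ ≤ ε * T * Real.exp (T * K) := by
  set g : ℝ → H1 L := fun t => ∫ τ in 0..t, duhamelIntegrand hT F τ with hg
  have hYg : ∀ t : Icc (0 : ℝ) T, ‖Y t‖ = ‖g t‖ := fun t => by
    rw [hY, duhamel_apply, duhamelFun, LinearIsometry.norm_map]
  have hd := hasDerivAt_integral_duhamelIntegrand hT F
  have h1 := norm_le_gronwallBound_of_norm_deriv_right_le (f := g) (a := 0) (b := T) (δ := 0)
    (K := K) (ε := ε) (fun t _ => (hd t).continuousAt.continuousWithinAt)
    (fun t _ => (hd t).hasDerivWithinAt) (by simp [hg]) (fun t ht => by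
      have ht' : t ∈ Icc 0 T := ⟨ht.1, ht.2.le⟩
      rw [norm_duhamelIntegrand, projIcc_of_mem hT ht']
      exact (hF ⟨t, ht'⟩).trans_eq (by rw [hYg])) t t.2
  have ht0 := t.2.1
  have htT := t.2.2
  rw [hYg]
  refine h1.trans ((gronwallBound_le hK hε).trans ?_)
  rw [zero_add, sub_zero]
  calc ε * t * Real.exp (K * t) ≤ ε * T * Real.exp (K * T) := by gcongr
    _ = _ := by rw [mul_comm K T]

theorem norm_source_le (α : ℝ) (V : H1 L) (W : Fin m → H1 L) (x : Finset (Fin m) → H1 L)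
    (S : Finset (Fin m)) :
    ‖V * x S + ∑ j ∈ S, W j * x (S.erase j) + α • ∑ R ∈ S.powerset,
        ∑ Q ∈ R.powerset, x Q * star (x (R \ Q)) * x (S \ R)‖ ≤
      algConst L * ‖V‖ * ‖x S‖ + algConst L * ∑ j ∈ S, ‖W j‖ * ‖x (S.erase j)‖ +
        |α| * (algConst L ^ 2 * ∑ R ∈ S.powerset, ∑ Q ∈ R.powerset,
          ‖x Q‖ * ‖x (R \ Q)‖ * ‖x (S \ R)‖) := by
  have hA := algConst_pos (L := L)
  refine (norm_add_le _ _).trans (add_le_add ((norm_add_le _ _).trans (add_le_add ?_ ?_)) ?_)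
  · exact H1.norm_mul_le _ _
  · rw [Finset.mul_sum]
    refine (norm_sum_le _ _).trans (Finset.sum_le_sum fun j _ => ?_)
    exact (H1.norm_mul_le _ _).trans_eq (by ring)
  · rw [norm_smul, Real.norm_eq_abs]
    refine mul_le_mul_of_nonneg_left ?_ (abs_nonneg α)
    rw [Finset.mul_sum]
    refine (norm_sum_le _ _).trans (Finset.sum_le_sum fun R _ => ?_)
    rw [Finset.mul_sum]
    refine (norm_sum_le _ _).trans (Finset.sum_le_sum fun Q _ => ?_)
    calc _ ≤ algConst L * ‖x Q * star (x (R \ Q))‖ * ‖x (S \ R)‖ := H1.norm_mul_le _ _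
      _ ≤ algConst L * (algConst L * ‖x Q‖ * ‖star (x (R \ Q))‖) * ‖x (S \ R)‖ := by
          gcongr
          exact H1.norm_mul_le _ _
      _ = _ := by rw [H1.norm_star]; ring

/-- The bound on the mixed derivatives of the solution, by induction on the order: the derivatives
of lower order in the equation are estimated by the induction hypothesis, the one of the same order
is absorbed by Grönwall's inequality. -/
theorem norm_md_path_le (hT : 0 ≤ T) (α : ℝ) (u₀ : H1 L) (V₀ : H1 L) (W : Fin m → H1 L)
    {X : (Fin m → ℝ) → Path L T} (hXs : ContDiff ℝ ∞ X)
    (hX : ∀ ξ, X ξ = freeP u₀ + duhamel hT (nonlinP α (constP (V₀ + ∑ j, ξ j • W j)) (X ξ)))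
    {C₀ NV N : ℝ} (hC₀ : algConst L ≤ C₀) (hC₀' : algConst L ^ 2 ≤ C₀) {ξ : Fin m → ℝ}
    (hV : ‖V₀ + ∑ j, ξ j • W j‖ ≤ NV) (hN : 0 ≤ N) (hXN : ∀ t, ‖X ξ t‖ ≤ N)
    {S : Finset (Fin m)} (hS : S.Nonempty) (t : Icc (0 : ℝ) T) :
    ‖md S X ξ t‖ ≤ 3 ^ expo S.card * constCT C₀ α T NV N ^ (2 * S.card - 1) * ∏ j ∈ S, ‖W j‖ := by
  have hA := algConst_pos (L := L)
  have hC₀0 : 0 ≤ C₀ := hA.le.trans hC₀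
  have hNV : 0 ≤ NV := (norm_nonneg _).trans hV
  set C := constCT C₀ α T NV N with hCdef
  have hC : 1 ≤ C := le_max_right _ _
  have hM : 1 ≤ max 1 N := le_max_left _ _
  set K := C₀ * (NV + 3 * |α| * N ^ 2) with hK
  have hK0 : 0 ≤ K := by positivity
  have key : ∀ S : Finset (Fin m), S.Nonempty → ∀ t,
      ‖md S X ξ t‖ ≤ derivBound C (max 1 N) S.card * ∏ j ∈ S, ‖W j‖ := by
    intro S
    induction S using Finset.strongInduction with
    | H S ih =>
      intro hS t
      obtain ⟨n, hn⟩ := Nat.exists_eq_succ_of_ne_zero hS.card_ne_zero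
      have hP : 0 ≤ ∏ j ∈ S, ‖W j‖ := Finset.prod_nonneg fun j _ => norm_nonneg _
      set ε := 2 * max 1 |α| * C₀ * max 1 N * (3 ^ expo (n + 1) * C ^ (2 * n)) *
        ∏ j ∈ S, ‖W j‖ with hε
      have hε0 : 0 ≤ ε := by
        have : 0 ≤ max 1 |α| := le_max_of_le_left zero_le_one
        positivity
      have h1 := norm_duhamel_le hT (md_path_eq hT α u₀ V₀ W hXs hX hS ξ) hK0 hε0 (fun t => by
        have hs := source_le (NV := NV) (α := α) hA.le hC₀ hC₀' hC hN hM (norm_nonneg _) hV hn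
          (w := fun j => ‖W j‖) (fun j => norm_nonneg _) (x := fun R => ‖md R X ξ t‖)
          (fun R => norm_nonneg _) (by simpa using hXN t) (fun R hR => by
            rcases R.eq_empty_or_nonempty with rfl | hR'
            · simpa [derivBound] using Or.inr (hXN t)
            · exact ih R hR hR' t)
        refine le_trans (le_of_eq ?_) ((norm_source_le α (V₀ + ∑ j, ξ j • W j) W
          (fun R => md R X ξ t) S).trans hs)
        congr 1
        simp only [ContinuousMap.add_apply, ContinuousMap.smul_apply, mulP_apply, constP_apply,
          starP_apply, ContinuousMap.sum_apply, map_sum, _root_.sum_apply]) t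
      refine h1.trans ?_
      rw [hn, Nat.succ_eq_add_one, derivBound_succ]
      have h2 : 2 * max 1 |α| * C₀ * T * max 1 N * Real.exp (T * K) ≤ C := by
        refine le_trans ?_ (le_max_left _ _)
        have : 0 ≤ max 1 |α| := le_max_of_le_left zero_le_one
        gcongr
        exact le_max_right _ _
      calc ε * T * Real.exp (T * K) = (2 * max 1 |α| * C₀ * T * max 1 N * Real.exp (T * K)) *
            (3 ^ expo (n + 1) * C ^ (2 * n) * ∏ j ∈ S, ‖W j‖) := by rw [hε]; ring
        _ ≤ C * (3 ^ expo (n + 1) * C ^ (2 * n) * ∏ j ∈ S, ‖W j‖) := by gcongr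
        _ = _ := by ring
  have h := key S hS t
  rwa [derivBound, if_neg hS.card_ne_zero] at h

end Parametric

end

section

/-! ### The random potential -/

section Potential

variable {L : ℝ} [hL : Fact (0 < 2 * L)]

theorem IsRealValued.fc_neg {f : L2 L} (hf : IsRealValued f) (l : ℤ) :
    star (fc f (-l)) = fc f l := by
  rw [fc, fc, fourierCoeff, fourierCoeff]
  change (starRingEnd ℂ) _ = _
  rw [← integral_conj]
  refine integral_congr_ae ?_
  filter_upwards [hf] with x hx
  rw [neg_neg, smul_eq_mul, smul_eq_mul, map_mul, fourier_neg, Complex.conj_eq_iff_im.2 hx]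

theorem star_eq_self_of_fc {V : H1 L} (h : ∀ l, star (fc V.toL2 (-l)) = fc V.toL2 l) :
    star V = V :=
  H1.ext_coef fun l => by rw [coef_star]; exact h l

theorem fc_real_smul (c : ℝ) (f : L2 L) (l : ℤ) : fc ⇑(c • f) l = c * fc f l := by
  rw [← fcL_apply, ← fcL_apply, show c • f = (c : ℂ) • f from rfl, map_smul, smul_eq_mul]

theorem hsNorm_real_smul (s c : ℝ) (f : L2 L) : hsNorm s (c • f) = ‖c‖ₑ * hsNorm s f := by
  have h := hsNorm_smul s (c : ℂ) f
  rwa [show ‖(c : ℂ)‖ₑ = ‖c‖ₑ by rw [← ofReal_norm, ← ofReal_norm, Complex.norm_real]] at h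

variable {lam : ℕ → ℝ} {v₀ : L2 L} {v : ℕ → L2 L}

theorem potential_fc_neg (h₀ : IsRealValued v₀) (h : ∀ j, IsRealValued (v j)) {ξ : ℕ → ℝ}
    (hs : Summable fun j => (Real.sqrt (lam j) * ξ j) • v j) (l : ℤ) :
    star (fc (potential lam v₀ v ξ) (-l)) = fc (potential lam v₀ v ξ) l := by
  have hsum : ∀ l, HasSum (fun j => ((Real.sqrt (lam j) * ξ j : ℝ) : ℂ) * fc (v j) l)
      (fc (∑' j, (Real.sqrt (lam j) * ξ j) • v j : L2 L) l) := fun l => by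
    have h1 := hs.hasSum.mapL (fcL l)
    simpa only [fcL_apply, fc_real_smul] using h1
  rw [potential, fc_add, fc_add, star_add, h₀.fc_neg]
  congr 1
  refine HasSum.unique ((hsum (-l)).star) ?_
  convert hsum l using 2 with j
  rw [star_mul', (h j).fc_neg]
  congr 1
  exact Complex.conj_ofReal _

/-- The extension of a finite sequence by zero. -/
def extendZero {m : ℕ} (ξ : Fin m → ℝ) (j : ℕ) : ℝ := if h : j < m then ξ ⟨j, h⟩ else 0

theorem extendZero_mem_U {m : ℕ} {ξ : Fin m → ℝ} (hξ : ξ ∈ Um m) : extendZero ξ ∈ U := by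
  intro j
  rw [extendZero]
  split_ifs with h
  · exact hξ _
  · constructor <;> norm_num

theorem potential_extendZero {m : ℕ} (ξ : Fin m → ℝ) :
    potential lam v₀ v (extendZero ξ) = potentialTrunc lam v₀ v m ξ := by
  rw [potential, potentialTrunc, tsum_eq_sum (s := Finset.range m), Finset.sum_range]
  · simp [extendZero]
  · intro j hj
    rw [Finset.mem_range] at hj
    simp [extendZero, hj]

theorem hsNorm_potential_le (s : ℝ) {ξ : ℕ → ℝ} (hξ : ξ ∈ U) :
    hsNorm s (potential lam v₀ v ξ) ≤ supNormV s (potential lam v₀ v) :=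
  le_iSup₂ (f := fun ξ (_ : ξ ∈ U) => hsNorm s (potential lam v₀ v ξ)) ξ hξ

theorem hsNorm_mean_lt_top {s : ℝ} (h : supNormV s (potential lam v₀ v) < ∞) :
    hsNorm s v₀ < ∞ := by
  have h0 : (0 : ℕ → ℝ) ∈ U := fun j => by constructor <;> norm_num
  have h1 := (hsNorm_potential_le s h0).trans_lt h
  simpa [potential] using h1

theorem hsNorm_mode_lt_top {s : ℝ} (h : supNormV s (potential lam v₀ v) < ∞) {j : ℕ}
    (hj : 0 < lam j) : hsNorm s (v j) < ∞ := by
  have h0 : (Pi.single j (1 / 2) : ℕ → ℝ) ∈ U := fun i => by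
    rcases eq_or_ne i j with rfl | hij
    · simp only [Pi.single_eq_same]; constructor <;> norm_num
    · rw [Pi.single_eq_of_ne hij]; constructor <;> norm_num
  have h1 := (hsNorm_potential_le s h0).trans_lt h
  have hc : Real.sqrt (lam j) * (1 / 2) ≠ 0 := by positivity
  have e : potential lam v₀ v (Pi.single j (1 / 2)) = v₀ + (Real.sqrt (lam j) * (1 / 2)) • v j := by
    rw [potential, tsum_eq_single j]
    · rw [Pi.single_eq_same]
    · intro i hij
      simp [Pi.single_eq_of_ne hij]
  have e2 : v j = (Real.sqrt (lam j) * (1 / 2))⁻¹ •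
      (potential lam v₀ v (Pi.single j (1 / 2)) + (-1 : ℝ) • v₀) := by
    rw [e, neg_one_smul, add_neg_cancel_comm, inv_smul_smul₀ hc]
  rw [e2, hsNorm_real_smul]
  refine ENNReal.mul_lt_top enorm_lt_top ((hsNorm_add_le _ _ _).trans_lt ?_)
  rw [hsNorm_real_smul]
  exact ENNReal.add_lt_top.2 ⟨h1, ENNReal.mul_lt_top enorm_lt_top (hsNorm_mean_lt_top h)⟩

theorem exists_h1_potential {s : ℝ} (hs : 1 ≤ s) (h₀ : IsRealValued v₀)
    (h : ∀ j, IsRealValued (v j)) {ξ : ℕ → ℝ} (hξ : ξ ∈ U)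
    (hsum : Summable fun j => (Real.sqrt (lam j) * ξ j) • v j)
    (hsup : supNormV s (potential lam v₀ v) < ∞) :
    ∃ V : H1 L, V.toL2 = potential lam v₀ v ξ ∧ star V = V ∧
      hsNorm s V.toL2 ≤ ENNReal.ofReal (supNormV s (potential lam v₀ v)).toReal := by
  have h1 := hsNorm_potential_le (lam := lam) (v₀ := v₀) (v := v) s hξ
  obtain ⟨V, hV⟩ := exists_toL2_eq (((hsNorm_mono hs _).trans h1).trans_lt hsup)
  refine ⟨V, hV, star_eq_self_of_fc fun l => ?_, ?_⟩
  · rw [hV]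
    exact potential_fc_neg h₀ h hsum l
  · rw [hV, ENNReal.ofReal_toReal hsup.ne]
    exact h1

/-- The mean `v₀` and the modes `√λ_j v_j` as elements of `H¹(𝕋)`, obtained from the potentials at
`ξ = 0` and `ξ = e_j / 2`. -/
theorem exists_h1_modes {s : ℝ} (hs : 1 ≤ s) (h₀ : IsRealValued v₀)
    (h : ∀ j, IsRealValued (v j)) (hlam : ∀ j, 0 < lam j)
    (hsup : supNormV s (potential lam v₀ v) < ∞) :
    ∃ (V₀ : H1 L) (W : ℕ → H1 L), V₀.toL2 = v₀ ∧ star V₀ = V₀ ∧ (∀ j, star (W j) = W j) ∧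
      (∀ j, ‖W j‖ = Real.sqrt (lam j) * (hsNorm 1 (v j)).toReal) ∧
      ∀ j, (W j).toL2 = Real.sqrt (lam j) • v j := by
  obtain ⟨V₀, hV₀⟩ := exists_toL2_eq ((hsNorm_mono hs _).trans_lt (hsNorm_mean_lt_top hsup))
  choose Y hY using fun j =>
    exists_toL2_eq ((hsNorm_mono hs _).trans_lt (hsNorm_mode_lt_top hsup (hlam j)))
  have e : ∀ j, (Real.sqrt (lam j) • Y j).toL2 = Real.sqrt (lam j) • v j := fun j => by
    rw [← hY]
    exact H1.toL2.map_smul ((Real.sqrt (lam j) : ℝ) : ℂ) (Y j)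
  refine ⟨V₀, fun j => Real.sqrt (lam j) • Y j, hV₀, star_eq_self_of_fc fun l => ?_,
    fun j => star_eq_self_of_fc fun l => ?_, fun j => ?_, e⟩
  · rw [hV₀, h₀.fc_neg]
  · rw [e, fc_real_smul, fc_real_smul, star_mul', (h j).fc_neg]
    congr 1
    exact Complex.conj_ofReal _
  · rw [norm_smul, Real.norm_of_nonneg (Real.sqrt_nonneg _), H1.norm_def, hY]

theorem toL2_affine {m : ℕ} {V₀ : H1 L} {W : ℕ → H1 L} (hV₀ : V₀.toL2 = v₀)
    (hW : ∀ j, (W j).toL2 = Real.sqrt (lam j) • v j) (ξ : Fin m → ℝ) :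
    (V₀ + ∑ j : Fin m, ξ j • W j).toL2 = potentialTrunc lam v₀ v m ξ := by
  rw [map_add, hV₀, potentialTrunc, map_sum]
  refine congrArg _ (Finset.sum_congr rfl fun j _ => ?_)
  rw [mul_comm (Real.sqrt (lam j)), mul_smul, ← hW]
  exact H1.toL2.map_smul ((ξ j : ℝ) : ℂ) (W j)

theorem star_affine {m : ℕ} {V₀ : H1 L} {W : ℕ → H1 L} (hV₀ : star V₀ = V₀)
    (hW : ∀ j, star (W j) = W j) (ξ : Fin m → ℝ) :
    star (V₀ + ∑ j : Fin m, ξ j • W j) = V₀ + ∑ j : Fin m, ξ j • W j := by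
  change starL _ = _
  rw [map_add, map_sum]
  refine congrArg₂ _ hV₀ (Finset.sum_congr rfl fun j _ => ?_)
  exact (starL.map_smul (ξ j) (W j)).trans (congrArg _ (hW j))

end Potential

/-! ### The equation with a random potential -/

section Solution

variable {L : ℝ} [hL : Fact (0 < 2 * L)] {α : ℝ} {V u₀ : H1 L}

theorem exists_unique_isNLSSolution (α : ℝ) (u₀ : H1 L) (hV : star V = V) :
    ∃ u, IsNLSSolution α V.toL2 u₀.toL2 u ∧
      ∀ w, IsNLSSolution α V.toL2 u₀.toL2 w → EqOn w u (Ici 0) := by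
  obtain ⟨u, hu⟩ := exists_isMild_global α u₀ hV
  refine ⟨u, isNLSSolution_of_isMild hu, fun w hw t ht => ?_⟩
  have h := (isMild_of_isNLSSolution hw t).unique (hu t) ⟨ht, le_rfl⟩
  simpa only [max_eq_left (mem_Ici.1 ht)] using h

theorem norm_le_of_Ioo {T M : ℝ} {u : ℝ → H1 L} (hT : 0 < T) (hu : Continuous u)
    (h : ∀ t ∈ Ioo 0 T, ‖u t‖ ≤ M) {t : ℝ} (ht : t ∈ Icc 0 T) : ‖u t‖ ≤ M := by
  rw [← closure_Ioo hT.ne] at ht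
  exact le_on_closure (g := fun _ => M) h hu.norm.continuousOn continuousOn_const ht

theorem norm_le_toReal_of_hsNorm_le {s : ℝ} (hs : 1 ≤ s) {u : H1 L} {D : ℝ≥0∞} (hD : D < ∞)
    (h : hsNorm s u.toL2 ≤ D) : ‖u‖ ≤ D.toReal :=
  ENNReal.toReal_mono hD.ne ((hsNorm_mono hs _).trans h)

end Solution

end

end QmcNLS

end

theorem mainTheorem5 (L : ℝ) [Fact (0 < 2 * L)] :
    ∃ C₀ : ℝ, 0 < C₀ ∧
      ∀ (s α : ℝ) (lam : ℕ → ℝ) (v₀ : QmcNLS.L2 L) (v : ℕ → QmcNLS.L2 L) (ψin : QmcNLS.L2 L),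
        1 ≤ s →
        (∀ j, 0 < lam j) → StrictAnti lam →
        QmcNLS.IsRealValued v₀ → (∀ j, QmcNLS.IsRealValued (v j)) →
        (∀ ξ ∈ QmcNLS.U, Summable fun j => (Real.sqrt (lam j) * ξ j) • v j) →
        QmcNLS.supNormV s (QmcNLS.potential lam v₀ v) < ⊤ →
        QmcNLS.hsNorm s ψin < ⊤ →
        -- existence and uniqueness of the solution
        (∀ ξ ∈ QmcNLS.U, ∃ u : ℝ → QmcNLS.H1 L,
          QmcNLS.IsNLSSolution α (QmcNLS.potential lam v₀ v ξ) ψin u ∧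
          ∀ w : ℝ → QmcNLS.H1 L,
            QmcNLS.IsNLSSolution α (QmcNLS.potential lam v₀ v ξ) ψin w →
              Set.EqOn w u (Set.Ici 0)) ∧
        ∀ ψ : ℝ → (ℕ → ℝ) → QmcNLS.H1 L,
          (∀ ξ ∈ QmcNLS.U, QmcNLS.IsNLSSolution α (QmcNLS.potential lam v₀ v ξ) ψin
            (fun t => ψ t ξ)) →
          ∀ T : ℝ, 0 < T →
            QmcNLS.supNormPsi s T ψ < ⊤ ∧
            ∀ (m : ℕ) (ψm : ℝ → (Fin m → ℝ) → QmcNLS.H1 L),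
              (∀ ξ ∈ QmcNLS.Um m, QmcNLS.IsNLSSolution α (QmcNLS.potentialTrunc lam v₀ v m ξ) ψin
                (fun t => ψm t ξ)) →
              -- the mixed first derivatives exist in `H¹`, in whatever order they are taken
              (∀ μ ∈ QmcNLS.Gam m, ∀ j, μ j = 0 → ∀ ξ ∈ QmcNLS.Um m, ∀ t ∈ Set.Icc 0 T,
                HasDerivWithinAt
                  (fun r => QmcNLS.mixedDeriv μ (ψm t) (Function.update ξ j r))
                  (QmcNLS.mixedDeriv (Function.update μ j 1) (ψm t) ξ)
                  (Set.Icc (-1 / 2) (1 / 2)) (ξ j)) ∧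
              -- the bound
              (∀ ν ∈ QmcNLS.Gam m, ν ≠ 0 → ∀ ξ ∈ QmcNLS.Um m, ∀ t ∈ Set.Icc 0 T,
                ‖QmcNLS.mixedDeriv ν (ψm t) ξ‖ ≤
                  (3 : ℝ) ^ ((((∑ j, ν j : ℕ) : ℝ) + 2) * (((∑ j, ν j : ℕ) : ℝ) - 1) / 2) *
                  QmcNLS.constCT C₀ α T
                    (QmcNLS.supNormV s (QmcNLS.potential lam v₀ v)).toReal
                    (QmcNLS.supNormPsi s T ψ).toReal ^ (2 * (∑ j, ν j) - 1) *
                  ∏ j : Fin m,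
                    (Real.sqrt (lam j) * (QmcNLS.hsNorm 1 (v j)).toReal) ^ ν j) := by
  have hA := QmcNLS.algConst_pos (L := L)
  refine ⟨max (QmcNLS.algConst L) (QmcNLS.algConst L ^ 2), lt_max_of_lt_left hA, ?_⟩
  intro s α lam v₀ v ψin hs hlam _ hv₀ hv hsum hsup hψin
  obtain ⟨u₀, rfl⟩ := QmcNLS.exists_toL2_eq ((QmcNLS.hsNorm_mono hs _).trans_lt hψin)
  have hpot := fun (ξ : ℕ → ℝ) (hξ : ξ ∈ QmcNLS.U) =>
    QmcNLS.exists_h1_potential hs hv₀ hv hξ (hsum ξ hξ) hsup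
  refine ⟨fun ξ hξ => ?_, fun ψ hψ T hT => ?_⟩
  · obtain ⟨V, hV, hVs, -⟩ := hpot ξ hξ
    rw [← hV]
    exact QmcNLS.exists_unique_isNLSSolution α u₀ hVs
  have hsupψ : QmcNLS.supNormPsi s T ψ < ⊤ := by
    obtain ⟨D, hD, hb⟩ := QmcNLS.exists_hsNorm_bound α u₀ hs hψin
      (QmcNLS.supNormV s (QmcNLS.potential lam v₀ v)).toReal T
    refine lt_of_le_of_lt (iSup₂_le fun t ht => iSup₂_le fun ξ hξ => ?_) hD
    obtain ⟨V, hV, hVs, hVb⟩ := hpot ξ hξ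
    have h := hψ ξ hξ
    rw [← hV] at h
    have h1 := hb V _ hVs hVb (QmcNLS.isMild_of_isNLSSolution h T) t ⟨ht.1.le, ht.2.le⟩
    simpa only [max_eq_left ht.1.le] using h1
  refine ⟨hsupψ, fun m ψm hψm => ?_⟩
  obtain ⟨V₀, W, hV₀, hV₀s, hWs, hWn, hW⟩ := QmcNLS.exists_h1_modes hs hv₀ hv hlam hsup
  have haff := fun ξ : Fin m → ℝ => QmcNLS.toL2_affine hV₀ hW ξ
  -- The affine potential is defined for all `ξ`, which extends the solution beyond `U_m`.
  choose u hu using fun ξ : Fin m → ℝ =>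
    QmcNLS.exists_isMild_global α u₀ (QmcNLS.star_affine hV₀s hWs ξ)
  set X : (Fin m → ℝ) → QmcNLS.Path L T := fun ξ => (hu ξ T).path with hXdef
  have hXs : ContDiff ℝ ((⊤ : ℕ∞) : WithTop ℕ∞) X :=
    QmcNLS.contDiff_path hT.le α u₀ (by fun_prop) fun ξ => hu ξ T
  have hXe := fun ξ => (hu ξ T).path_eq hT.le
  have heq : ∀ ξ ∈ QmcNLS.Um m, ∀ t : Set.Icc 0 T, ψm t ξ = X ξ t := by
    intro ξ hξ t
    have h := hψm ξ hξ
    rw [← haff] at h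
    have h1 := (QmcNLS.isMild_of_isNLSSolution h T).unique (hu ξ T) t.2
    simp only [max_eq_left t.2.1] at h1
    exact h1
  have hXM : ∀ ξ ∈ QmcNLS.Um m, ∀ t : Set.Icc 0 T, ‖X ξ t‖ ≤ (QmcNLS.supNormPsi s T ψ).toReal := by
    intro ξ hξ t
    have hext := QmcNLS.extendZero_mem_U hξ
    refine QmcNLS.norm_le_of_Ioo (u := u ξ) hT (hu ξ T).cont (fun t ht => ?_) t.2
    refine QmcNLS.norm_le_toReal_of_hsNorm_le hs hsupψ ?_
    have h := hψ _ hext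
    rw [QmcNLS.potential_extendZero, ← haff] at h
    have h1 := (QmcNLS.isMild_of_isNLSSolution h T).unique (hu ξ T) ⟨ht.1.le, ht.2.le⟩
    simp only [max_eq_left ht.1.le] at h1
    rw [← h1]
    exact le_iSup₂_of_le (f := fun t (_ : t ∈ Set.Ioo 0 T) =>
      ⨆ ξ ∈ QmcNLS.U, QmcNLS.hsNorm s (ψ t ξ).toL2) t ht
      (le_iSup₂_of_le (f := fun ξ (_ : ξ ∈ QmcNLS.U) => QmcNLS.hsNorm s (ψ t ξ).toL2) _ hext le_rfl)
  have hVN : ∀ ξ ∈ QmcNLS.Um m, ‖V₀ + ∑ j : Fin m, ξ j • W j‖ ≤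
      (QmcNLS.supNormV s (QmcNLS.potential lam v₀ v)).toReal := by
    intro ξ hξ
    refine QmcNLS.norm_le_toReal_of_hsNorm_le hs hsup ?_
    rw [haff, ← QmcNLS.potential_extendZero]
    exact QmcNLS.hsNorm_potential_le s (QmcNLS.extendZero_mem_U hξ)
  have hev : ∀ t : Set.Icc 0 T, ContDiff ℝ ((⊤ : ℕ∞) : WithTop ℕ∞) fun ξ => X ξ t := fun t =>
    ContDiff.comp (g := ContinuousMap.evalCLM ℝ t) (ContinuousLinearMap.contDiff _) hXs
  constructor
  · intro μ hμ j hj ξ hξ t ht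
    exact QmcNLS.hasDerivWithinAt_mixedDeriv (hev ⟨t, ht⟩) (fun η hη => heq η hη ⟨t, ht⟩) hμ hj hξ
  · intro ν hν hν0 ξ hξ t ht
    set S : Finset (Fin m) := {j | ν j = 1} with hS
    have hind : ∀ j, ν j = if j ∈ S then 1 else 0 := fun j => by
      rcases hν j with h | h <;> simp [hS, h]
    have hcard : ∑ j, ν j = S.card := by simp [hind]
    have hSne : S.Nonempty := by
      by_contra h
      rw [Finset.not_nonempty_iff_eq_empty] at h
      exact hν0 (funext fun j => by simp [hind j, h])
    have hprod : ∏ j : Fin m, (Real.sqrt (lam j) * (QmcNLS.hsNorm 1 (v j)).toReal) ^ ν j =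
        ∏ j ∈ S, ‖W j‖ := by
      simp only [hind, hWn, pow_ite, pow_one, pow_zero, Finset.prod_ite_mem, Finset.univ_inter]
    rw [hcard, hprod, ← QmcNLS.cast_expo hSne.card_ne_zero, Real.rpow_natCast,
      QmcNLS.mixedDeriv_eq_md (hev ⟨t, ht⟩) (fun η hη => heq η hη ⟨t, ht⟩) hν hξ]
    have he := congrFun (QmcNLS.md_clm_comp (ContinuousMap.evalCLM ℝ ⟨t, ht⟩) S hXs) ξ
    refine (congrArg norm he).trans_le ?_
    exact QmcNLS.norm_md_path_le hT.le α u₀ V₀ (fun j => W j) hXs hXe (le_max_left _ _)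
      (le_max_right _ _) (hVN ξ hξ) ENNReal.toReal_nonneg (hXM ξ hξ) hSne ⟨t, ht⟩
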